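/- **Definitions.** Let $W$ be a simply laced Coxeter group with generators $s_i$ $(i\in I)$ and Coxeter matrix $(m_{ij})$, so $m_{ij}\in\{2,3\}$ for $i\ne j$. Let $V$ be the real vector space with basis the simple roots $\alpha_i$ $(i \in I)$ and bilinear form $B(\alpha_i,\alpha_j)=-\cos(\pi/m_{ij})$, on which $W$ acts by $s_i v=v-2B(v,\alpha_i)\alpha_i$. Let $\Phi=\{w\alpha_i\}$, let $\Phi^+$ be the set of roots with nonnegative coordinates, and $\Phi^-=-\Phi^+$. For $w\in W$ put $\Phi(w)=\Phi^+\cap w^{-1}(\Phi^-)$. The root sequence of a reduced expression $j_1\cdots j_k$ of $w$ is $(r_1,\dots,r_k)$, where $r_1=\alpha_{j_k}$ and $r_l=s_{j_k}\cdots s_{j_{k-l+2}}(\alpha_{j_{k-l+1}})$ for $2\le l\le k$. An inversion triple of $w$ is a subset of $\Phi(w)$ of the form $\{\alpha,\beta,\alpha+\beta\}$; it is contractible if its elements appear consecutively, in some order, in the root sequence of some reduced expression of $w$. Let $N(w)$ be the number of contractible inversion triples of $w$; $w$ is freely braided if these are pairwise disjoint. Let $\operatorname{supp}(w)$ be the set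 of letters appearing in some (equivalently, any) reduced expression of $w$. We call $w$ content maximal if it is freely braided and $\#\operatorname{supp}(w)=\ell(w)-N(w)$. A letter is braided in a content maximal element $w$ if it appears more than once in some reduced expression of $w$, and not braided otherwise. **Setting.** Let $W_1\subset W_2\subset\cdots$ be simply laced Coxeter groups with alphabets $I_1\subset I_2\subset\cdots$, such that for $m<n$ the Coxeter matrix of $W_m$ is the restriction of that of $W_n$. Let $i_1\in I_1$ and, for $n>1$, let $I_n=I_{n-1}\cup\{i_n\}$ with $i_n\notin I_{n-1}$; suppose that for $n>1$ and $j\in I_{n-1}$ we have $m_{i_nj}=2$ if and only if $j\ne i_{n-1}$. **Lemma 4.1.** Let $n\ge 1$ and, if $n=1$, assume that $s_{i_1}$ commutes with every generator of $W_1$. Then each content maximal $w\in W_n$ satisfies exactly one of the following seven conditions. 1. $i_n\notin\operatorname{supp}(w)$; 2. $i_n\in\operatorname{supp}(w)$, $i_n$ is not braided in $w$, and if $n>1$ then $i_{n-1}\notin\operatorname{supp}(w)$; 3. $n>1$, $i_n\in\operatorname{supp}(w)$, $i_n$ is not braided in $w$, $i_{n-1}\in\operatorname{supp}(w)$ and $\ell(ws_{i_n})<\ell(w)$;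 4. $n>1$, $i_n\in\operatorname{supp}(w)$, $i_n$ is not braided in $w$, $i_{n-1}\in\operatorname{supp}(w)$ and $\ell(s_{i_n}w)<\ell(w)$; 5. $n>1$, $i_n\in\operatorname{supp}(w)$, $i_n$ is braided in $w$, and if $n>2$ then $i_{n-2}\notin\operatorname{supp}(w)$; 6. $n>2$, $i_n\in\operatorname{supp}(w)$, $i_n$ is braided in $w$, $i_{n-2}\in\operatorname{supp}(w)$ and $\ell(ws_{i_{n-1}})<\ell(w)$; 7. $n>2$, $i_n\in\operatorname{supp}(w)$, $i_n$ is braided in $w$, $i_{n-2}\in\operatorname{supp}(w)$ and $\ell(s_{i_{n-1}}w)<\ell(w)$. Suppose moreover that $I_1$ is finite. Then for every $n\ge1$ the number $f(n)$ of content maximal elements of $W_n$ is finite, and for every $n>3$ the numbers of content maximal elements of $W_n$ satisfying conditions 1–7 are, respectively, $$f(n-1),\quad f(n-2),\quad f(n-1)-f(n-2),\quad f(n-1)-f(n-2),\quad f(n-3),\quad f(n-2)-f(n-3),\quad f(n-2)-f(n-3).$$ Consequently $f(n)=3f(n-1)+f(n-2)-f(n-3)$ for $n>3$. -/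

import Mathlib

noncomputable section

namespace CoxeterMatrix

variable {J : Type*} (M : CoxeterMatrix J)

/-- A Coxeter matrix is simply laced if all its off-diagonal entries are `2` or `3`
(the value `0` of Mathlib, which encodes infinite order, is excluded). -/
def IsSimplyLaced : Prop := ∀ i j : J, i ≠ j → M i j = 2 ∨ M i j = 3

/-- The simple root `α_i`, a basis vector of `V = J →₀ ℝ`. -/
def simpleRoot (i : J) : J →₀ ℝ := Finsupp.single i 1

/-- The Coxeter form: the bilinear form on `V` with `B(α_i, α_j) = -cos (π / m_{ij})`. -/
def coxeterForm : (J →₀ ℝ) →ₗ[ℝ] (J →₀ ℝ) →ₗ[ℝ] ℝ :=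
  Finsupp.linearCombination ℝ fun i =>
    Finsupp.linearCombination ℝ fun j => -Real.cos (Real.pi / (M i j : ℝ))

/-- The reflection `v ↦ v - 2 B(v, α_i) α_i`. -/
def reflection (i : J) : Module.End ℝ (J →₀ ℝ) :=
  LinearMap.id - ((2 : ℝ) • M.coxeterForm.flip (simpleRoot i)).smulRight (simpleRoot i)

theorem coxeterForm_simpleRoot (i j : J) :
    M.coxeterForm (simpleRoot i) (simpleRoot j) = -Real.cos (Real.pi / (M i j : ℝ)) := by
  simp [coxeterForm, simpleRoot]

theorem reflection_apply (i : J) (v : J →₀ ℝ) :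
    M.reflection i v = v - (2 * M.coxeterForm v (simpleRoot i)) • simpleRoot i := by
  simp [reflection]

variable {M}

/-- The reflections of a simply laced Coxeter matrix satisfy the Coxeter relations. -/
theorem IsSimplyLaced.isLiftable_reflection (hM : M.IsSimplyLaced) :
    M.IsLiftable M.reflection := by
  have hself : ∀ i, M.coxeterForm (simpleRoot i) (simpleRoot i) = 1 := by
    intro i
    simp [coxeterForm_simpleRoot]
  intro i j
  apply LinearMap.ext
  intro v
  by_cases hij : i = j
  · subst hij
    simp [reflection_apply, hself]
    module
  · have hsymm : M.coxeterForm (simpleRoot j) (simpleRoot i)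
        = M.coxeterForm (simpleRoot i) (simpleRoot j) := by
      rw [coxeterForm_simpleRoot, coxeterForm_simpleRoot, M.symmetric j i]
    rcases hM i j hij with h | h
    · have h0 : M.coxeterForm (simpleRoot i) (simpleRoot j) = 0 := by
        simp [coxeterForm_simpleRoot, h]
      rw [h0] at hsymm
      simp only [h, pow_succ, pow_zero, one_mul, Module.End.mul_apply, reflection_apply, map_sub,
        map_smul, hself, h0, hsymm, Module.End.one_apply]
      module
    · have h0 : M.coxeterForm (simpleRoot i) (simpleRoot j) = -1 / 2 := by
        simp [coxeterForm_simpleRoot, h]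
        norm_num
      rw [h0] at hsymm
      simp only [h, pow_succ, pow_zero, one_mul, Module.End.mul_apply, reflection_apply, map_sub,
        map_smul, hself, h0, hsymm, Module.End.one_apply]
      module

end CoxeterMatrix

namespace CoxeterSystem

open CoxeterMatrix

variable {J : Type*} {M : CoxeterMatrix J} {W : Type*} [Group W]

/-- The reflection representation of `W` on `V = J →₀ ℝ`, with `s_i` acting as `reflection i`. -/
def reflRep (hM : M.IsSimplyLaced) (cs : CoxeterSystem M W) : W →* Module.End ℝ (J →₀ ℝ) :=
  cs.lift ⟨M.reflection, hM.isLiftable_reflection⟩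

/-- The root system `Φ = {w α_i}`. -/
def roots (hM : M.IsSimplyLaced) (cs : CoxeterSystem M W) : Set (J →₀ ℝ) :=
  {β | ∃ (w : W) (i : J), β = cs.reflRep hM w (simpleRoot i)}

/-- The positive roots: those with nonnegative coordinates in the basis of simple roots. -/
def posRoots (hM : M.IsSimplyLaced) (cs : CoxeterSystem M W) : Set (J →₀ ℝ) :=
  {β | β ∈ cs.roots hM ∧ ∀ i, 0 ≤ β i}

/-- The negative roots `Φ⁻ = -Φ⁺`. -/
def negRoots (hM : M.IsSimplyLaced) (cs : CoxeterSystem M W) : Set (J →₀ ℝ) :=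
  {β | -β ∈ cs.posRoots hM}

/-- The inversion set `Φ(w) = Φ⁺ ∩ w⁻¹(Φ⁻)`. -/
def inversionSet (hM : M.IsSimplyLaced) (cs : CoxeterSystem M W) (w : W) : Set (J →₀ ℝ) :=
  {β | β ∈ cs.posRoots hM ∧ cs.reflRep hM w β ∈ cs.negRoots hM}

/-- `ω` is a reduced expression for `w`. -/
def IsReducedExpr (cs : CoxeterSystem M W) (ω : List J) (w : W) : Prop :=
  cs.IsReduced ω ∧ cs.wordProd ω = w

/-- The root sequence of the word `i_1 ⋯ i_n`: the list `(r_1, …, r_n)` with `r_1 = α_{i_n}` and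
`r_l = s_{i_n} ⋯ s_{i_{n-l+2}} (α_{i_{n-l+1}})`. Its last entry is thus the image of `α_{i_1}`
under the inverse of `s_{i_2} ⋯ s_{i_n}`, and the entries before it form the root sequence of
`i_2 ⋯ i_n`. -/
def rootSeq (hM : M.IsSimplyLaced) (cs : CoxeterSystem M W) : List J → List (J →₀ ℝ)
  | [] => []
  | i :: ω => cs.rootSeq hM ω ++ [cs.reflRep hM (cs.wordProd ω)⁻¹ (simpleRoot i)]

/-- An inversion triple of `w`: a subset of `Φ(w)` of the form `{α, β, α + β}`. -/
def IsInversionTriple (hM : M.IsSimplyLaced) (cs : CoxeterSystem M W) (w : W)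
    (T : Set (J →₀ ℝ)) : Prop :=
  T ⊆ cs.inversionSet hM w ∧ ∃ α β : J →₀ ℝ, T = {α, β, α + β}

/-- An inversion triple of `w` is contractible if its elements appear consecutively, in some order,
in the root sequence of some reduced expression for `w`. -/
def IsContractible (hM : M.IsSimplyLaced) (cs : CoxeterSystem M W) (w : W)
    (T : Set (J →₀ ℝ)) : Prop :=
  cs.IsInversionTriple hM w T ∧
    ∃ ω : List J, cs.IsReducedExpr ω w ∧
      ∃ x y z : J →₀ ℝ, [x, y, z] <:+: cs.rootSeq hM ω ∧ T = {x, y, z}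

/-- `N(w)`, the number of contractible inversion triples of `w`. -/
def numContractible (hM : M.IsSimplyLaced) (cs : CoxeterSystem M W) (w : W) : ℕ :=
  {T | cs.IsContractible hM w T}.ncard

/-- `w` is freely braided if its contractible inversion triples are pairwise disjoint. -/
def IsFreelyBraided (hM : M.IsSimplyLaced) (cs : CoxeterSystem M W) (w : W) : Prop :=
  ∀ T T' : Set (J →₀ ℝ), cs.IsContractible hM w T → cs.IsContractible hM w T' → T ≠ T' →
    Disjoint T T'

/-- The support of `w`: the letters that appear in some reduced expression for `w`. -/
def supp (cs : CoxeterSystem M W) (w : W) : Set J :=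
  {i | ∃ ω : List J, cs.IsReducedExpr ω w ∧ i ∈ ω}

/-- `w` is content maximal if it is freely braided and `#supp(w) = ℓ(w) - N(w)`. -/
def IsContentMaximal (hM : M.IsSimplyLaced) (cs : CoxeterSystem M W) (w : W) : Prop :=
  cs.IsFreelyBraided hM w ∧
    ((cs.supp w).ncard : ℤ) = (cs.length w : ℤ) - (cs.numContractible hM w : ℤ)

/-- The letter `i` is braided in `w` if it appears more than once in some reduced expression
for `w`. -/
def IsBraidedIn (cs : CoxeterSystem M W) (i : J) (w : W) : Prop :=
  ∃ ω : List J, cs.IsReducedExpr ω w ∧ List.Duplicate i ω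

/-- The set of content maximal elements of `W`. -/
def contentMaximalSet (hM : M.IsSimplyLaced) (cs : CoxeterSystem M W) : Set W :=
  {w | cs.IsContentMaximal hM w}

section Alphabet

/-! Here the alphabet is a subset `A` of an ambient type of letters; the following predicates take
letters of the ambient type. -/

variable {B : Type*} {A : Set B} {M' : CoxeterMatrix A}

/-- The letter `x` lies in the support of `w`. -/
def InSupp (cs : CoxeterSystem M' W) (x : B) (w : W) : Prop :=
  ∃ hx : x ∈ A, (⟨x, hx⟩ : A) ∈ cs.supp w

/-- The letter `x` is braided in `w`. -/
def Braided (cs : CoxeterSystem M' W) (x : B) (w : W) : Prop :=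
  ∃ hx : x ∈ A, cs.IsBraidedIn ⟨x, hx⟩ w

/-- `x` is a letter with `ℓ(w s_x) < ℓ(w)`. -/
def RightDescent (cs : CoxeterSystem M' W) (x : B) (w : W) : Prop :=
  ∃ hx : x ∈ A, cs.length (w * cs.simple ⟨x, hx⟩) < cs.length w

/-- `x` is a letter with `ℓ(s_x w) < ℓ(w)`. -/
def LeftDescent (cs : CoxeterSystem M' W) (x : B) (w : W) : Prop :=
  ∃ hx : x ∈ A, cs.length (cs.simple ⟨x, hx⟩ * w) < cs.length w

/-- The seven conditions, numbered `0, …, 6`, on an element `w` of the `n`-th group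
of a chain with distinguished letters `i_1, i_2, …`. The letters `i_{n-1}` and `i_{n-2}` are only
used under `1 < n` and `2 < n`, respectively. -/
def ChainCase (cs : CoxeterSystem M' W) (i : ℕ → B) (n : ℕ) (w : W) : Fin 7 → Prop
  | 0 => ¬ cs.InSupp (i n) w
  | 1 => cs.InSupp (i n) w ∧ ¬ cs.Braided (i n) w ∧ (1 < n → ¬ cs.InSupp (i (n - 1)) w)
  | 2 => 1 < n ∧ cs.InSupp (i n) w ∧ ¬ cs.Braided (i n) w ∧ cs.InSupp (i (n - 1)) w ∧
      cs.RightDescent (i n) w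
  | 3 => 1 < n ∧ cs.InSupp (i n) w ∧ ¬ cs.Braided (i n) w ∧ cs.InSupp (i (n - 1)) w ∧
      cs.LeftDescent (i n) w
  | 4 => 1 < n ∧ cs.InSupp (i n) w ∧ cs.Braided (i n) w ∧ (2 < n → ¬ cs.InSupp (i (n - 2)) w)
  | 5 => 2 < n ∧ cs.InSupp (i n) w ∧ cs.Braided (i n) w ∧ cs.InSupp (i (n - 2)) w ∧
      cs.RightDescent (i (n - 1)) w
  | 6 => 2 < n ∧ cs.InSupp (i n) w ∧ cs.Braided (i n) w ∧ cs.InSupp (i (n - 2)) w ∧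
      cs.LeftDescent (i (n - 1)) w

/-- The set of content maximal elements that satisfy the `k`-th of the seven conditions. -/
def caseSet (hM : M'.IsSimplyLaced) (cs : CoxeterSystem M' W) (i : ℕ → B) (n : ℕ) (k : Fin 7) :
    Set W :=
  {w | cs.IsContentMaximal hM w ∧ cs.ChainCase i n w k}

end Alphabet

/-- The number of content maximal elements of `W`, as an integer. -/
def numContentMaximal (hM : M.IsSimplyLaced) (cs : CoxeterSystem M W) : ℤ :=
  ((cs.contentMaximalSet hM).ncard : ℤ)

end CoxeterSystem

end

/-! Content maximality becomes a condition on words. Call s, t a pair of w if m_st = 3 and sts is a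
factor of some reduced expression (`BraidRel`). A reduced word of w has ℓ(w) − #supp(w) repetitions
of letters. When the contractible triples are disjoint, each of them accounts for a repetition in
every reduced word, since two of its three roots carry the same letter. Equality #supp(w) = ℓ(w) −
N(w) therefore forces all repetitions to come from triples: every letter occurs at most twice, a
repeated letter has a unique partner, and the word restricted to a pair reads aba or bab
(`IsPaired`). Moreover, a letter x between two occurrences of c either commutes with c or is its
partner. Otherwise it would stay there under all moves, and the triple of c could never become a
factor (`IsBraided`). Conversely, the pairs of a braided word can be brought together by
commutations, and counting gives content maximality. So w is content maximal if and only if some,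
equivalently every, reduced expression is braided (`IsContentMaximal.isBraided`,
`IsBraided.isContentMaximal`). Matsumoto's theorem, derived from the positivity of roots, carries
such properties from one reduced expression to all others.

Now let x = i_n, b = i_{n-1}, c = i_{n-2}. The only neighbour of x is b, and those of b are x and c.
If x is not braided, it occurs once, and b cannot occur on both sides of it, since x would then be
the partner of b. Hence x moves to an end: w = s_x w' or w = w' s_x. If x is braided, its partner is
b, and c cannot occur on both sides of the factor xbx; so this factor moves to an end. Conversely,
putting x or xbx in front of a content maximal element that avoids these letters gives a content
maximal element.

The two ends are distinguished by descents as soon as the next letter (b, respectively c) lies in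
the support: a reduced word that avoids a letter and contains a neighbour of it sends its simple
root to a vector with a positive coordinate at the neighbour, so that the letter cannot be a descent
at the far end (`reflRep_wordProd_pos`). If the next letter is absent, the left end can always be
chosen. Thus the conditions correspond to sets of elements w' described by which of x, b, c they
avoid, and right descents reduce to left ones by inversion. Since W_m embeds in W_n as a parabolic
subgroup, the content maximal elements avoiding i_n, ..., i_{m+1} number f(m). -/

noncomputable section

/-! ### The Coxeter form and its reflections -/

namespace CoxeterMatrix

variable {J : Type*} {M : CoxeterMatrix J}

theorem coxeterForm_simpleRoot_self (i : J) :
    M.coxeterForm (simpleRoot i) (simpleRoot i) = 1 := by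
  simp [coxeterForm_simpleRoot]

theorem coxeterForm_comm (u v : J →₀ ℝ) : M.coxeterForm u v = M.coxeterForm v u := by
  have h : M.coxeterForm = M.coxeterForm.flip := by
    apply Finsupp.lhom_ext'
    intro i
    apply LinearMap.ext_ring
    apply Finsupp.lhom_ext'
    intro j
    apply LinearMap.ext_ring
    change M.coxeterForm (simpleRoot i) (simpleRoot j) = M.coxeterForm (simpleRoot j) (simpleRoot i)
    rw [coxeterForm_simpleRoot, coxeterForm_simpleRoot, M.symmetric j i]
  conv_lhs => rw [h]
  rfl

theorem coxeterForm_of_eq_two {i j : J} (h : M i j = 2) :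
    M.coxeterForm (simpleRoot i) (simpleRoot j) = 0 := by
  simp [coxeterForm_simpleRoot, h]

theorem coxeterForm_of_eq_three {i j : J} (h : M i j = 3) :
    M.coxeterForm (simpleRoot i) (simpleRoot j) = -1 / 2 := by
  simp [coxeterForm_simpleRoot, h]
  norm_num

theorem ne_of_eq_two {i j : J} (h : M i j = 2) : i ≠ j := by
  rintro rfl
  simp at h

theorem ne_of_eq_three {i j : J} (h : M i j = 3) : i ≠ j := by
  rintro rfl
  simp at h

theorem reflection_self (i : J) : M.reflection i (simpleRoot i) = -simpleRoot i := by
  rw [reflection_apply, coxeterForm_simpleRoot_self]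
  module

theorem reflection_of_eq_two {i j : J} (h : M i j = 2) :
    M.reflection i (simpleRoot j) = simpleRoot j := by
  rw [reflection_apply, coxeterForm_comm, coxeterForm_of_eq_two h]
  module

theorem reflection_of_eq_three {i j : J} (h : M i j = 3) :
    M.reflection i (simpleRoot j) = simpleRoot i + simpleRoot j := by
  rw [reflection_apply, coxeterForm_comm, coxeterForm_of_eq_three h]
  module

theorem coxeterForm_reflection (i : J) (u v : J →₀ ℝ) :
    M.coxeterForm (M.reflection i u) (M.reflection i v) = M.coxeterForm u v := by
  simp only [reflection_apply, map_sub, map_smul, LinearMap.sub_apply, LinearMap.smul_apply,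
    coxeterForm_simpleRoot_self, smul_eq_mul, coxeterForm_comm (M := M) (simpleRoot i) v]
  ring

theorem reflection_apply_of_ne {i k : J} (h : k ≠ i) (v : J →₀ ℝ) :
    M.reflection i v k = v k := by
  simp [reflection_apply, simpleRoot, h.symm]

theorem simpleRoot_nonneg (i k : J) : 0 ≤ (simpleRoot i : J →₀ ℝ) k := by
  classical
  rw [simpleRoot, Finsupp.single_apply]
  split_ifs <;> norm_num

@[simp] theorem simpleRoot_apply_self (i : J) : (simpleRoot i : J →₀ ℝ) i = 1 := by
  simp [simpleRoot]

theorem simpleRoot_apply_of_ne {i k : J} (h : k ≠ i) : (simpleRoot i : J →₀ ℝ) k = 0 := by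
  simp [simpleRoot, h.symm]

end CoxeterMatrix

/-! ### The reflection representation: signs of roots and lengths -/

namespace CoxeterSystem

open CoxeterMatrix

variable {J : Type*} {M : CoxeterMatrix J} {W : Type*} [Group W]
  (hM : M.IsSimplyLaced) (cs : CoxeterSystem M W)

@[simp] theorem reflRep_simple (i : J) : cs.reflRep hM (cs.simple i) = M.reflection i :=
  cs.lift_apply_simple hM.isLiftable_reflection i

theorem reflRep_mul_apply (u w : W) (v : J →₀ ℝ) :
    cs.reflRep hM (u * w) v = cs.reflRep hM u (cs.reflRep hM w v) := by
  rw [map_mul, Module.End.mul_apply]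

theorem reflRep_inv_apply_self (w : W) (v : J →₀ ℝ) :
    cs.reflRep hM w⁻¹ (cs.reflRep hM w v) = v := by
  rw [← reflRep_mul_apply, inv_mul_cancel, map_one, Module.End.one_apply]

theorem reflRep_apply_inv_self (w : W) (v : J →₀ ℝ) :
    cs.reflRep hM w (cs.reflRep hM w⁻¹ v) = v := by
  rw [← reflRep_mul_apply, mul_inv_cancel, map_one, Module.End.one_apply]

theorem reflRep_injective (w : W) : Function.Injective (cs.reflRep hM w) :=
  Function.LeftInverse.injective (cs.reflRep_inv_apply_self hM w)

theorem coxeterForm_reflRep (w : W) : ∀ u v : J →₀ ℝ,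
    M.coxeterForm (cs.reflRep hM w u) (cs.reflRep hM w v) = M.coxeterForm u v := by
  induction w using cs.simple_induction_left with
  | one => simp
  | mul_simple_left w i ih =>
    intro u v
    rw [reflRep_mul_apply, reflRep_mul_apply, reflRep_simple, coxeterForm_reflection, ih]

theorem simple_mul_comm {i j : J} (h : M i j = 2) :
    cs.simple i * cs.simple j = cs.simple j * cs.simple i := by
  have := cs.simple_mul_simple_pow i j
  rw [h, pow_two] at this
  rw [← inv_inj]
  simp only [mul_inv_rev, inv_simple]
  rw [← mul_left_inj (cs.simple i * cs.simple j), this, mul_assoc]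
  simp

theorem simple_braid {i j : J} (h : M i j = 3) :
    cs.simple i * cs.simple j * cs.simple i = cs.simple j * cs.simple i * cs.simple j := by
  have := cs.simple_mul_simple_pow i j
  rw [h, pow_succ, pow_two] at this
  rw [← mul_left_inj (cs.simple j * cs.simple i * cs.simple j)]
  simp only [← mul_assoc] at this ⊢
  rw [this]
  simp

/-- An element that lengthens when multiplied by `s_i` on the right sends `α_i` to a vector with
nonnegative coordinates. -/
theorem reflRep_simpleRoot_nonneg : ∀ (w : W) (i : J), cs.length w < cs.length (w * cs.simple i) →
    ∀ k, 0 ≤ cs.reflRep hM w (simpleRoot i) k := by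
  intro w
  induction hn : cs.length w using Nat.strong_induction_on generalizing w with
  | _ n ih =>
  subst hn
  intro i hi k
  by_cases hw : w = 1
  · subst hw
    simpa using simpleRoot_nonneg i k
  obtain ⟨t, ht⟩ := cs.exists_rightDescent_of_ne_one hw
  rw [isRightDescent_iff] at ht
  obtain ⟨v, rfl⟩ : ∃ v, w = v * cs.simple t := ⟨w * cs.simple t, by simp⟩
  simp only [simple_mul_simple_cancel_right] at ht
  have hti : t ≠ i := by
    rintro rfl
    simp at hi
    omega
  have hlv := cs.length_mul_simple v i
  rcases hM t i hti with h | h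
  · rw [reflRep_mul_apply, reflRep_simple, reflection_of_eq_two h]
    refine ih _ (by omega) v rfl i ?_ k
    have h1 := cs.length_mul_simple (v * cs.simple i) t
    rw [mul_assoc, cs.simple_mul_comm h, ← mul_assoc] at hi
    omega
  -- Here s_t α_i = α_t + α_i, and v α_t ≥ 0 by induction. If s_i shortens v, write v = u s_i; then
  -- v(α_t + α_i) = u α_t, and the braid relation shows that s_t lengthens u.
  · rw [reflRep_mul_apply, reflRep_simple, reflection_of_eq_three h, map_add, Finsupp.add_apply]
    have h1 := ih _ (by omega) v rfl t (by omega) k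
    rcases hlv with hlv | hlv
    · exact add_nonneg h1 (ih _ (by omega) v rfl i (by omega) k)
    · obtain ⟨u, rfl⟩ : ∃ u, v = u * cs.simple i := ⟨v * cs.simple i, by simp⟩
      simp only [simple_mul_simple_cancel_right] at hlv
      rw [← Finsupp.add_apply, ← map_add, reflRep_mul_apply, reflRep_simple, map_add,
        reflection_self, reflection_of_eq_three (by rwa [M.symmetric])]
      have : simpleRoot i + simpleRoot t + -simpleRoot i = (simpleRoot t : J →₀ ℝ) := by abel
      rw [this]
      refine ih _ (by omega) u rfl t ?_ k
      have h3 : u * cs.simple i * cs.simple t * cs.simple i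
          = u * cs.simple t * cs.simple i * cs.simple t := by
        simpa only [mul_assoc] using congrArg (u * ·) (cs.simple_braid ((M.symmetric i t).trans h))
      rw [h3] at hi
      have h4 := cs.length_mul_simple (u * cs.simple t * cs.simple i) t
      have h5 := cs.length_mul_simple (u * cs.simple t) i
      have h6 := cs.length_mul_simple u t
      omega

theorem reflRep_simpleRoot_nonpos {w : W} {i : J} (h : cs.length (w * cs.simple i) < cs.length w)
    (k : J) : cs.reflRep hM w (simpleRoot i) k ≤ 0 := by
  have := cs.reflRep_simpleRoot_nonneg hM (w * cs.simple i) i (by simpa using h) k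
  rw [reflRep_mul_apply, reflRep_simple, reflection_self, map_neg, Finsupp.neg_apply] at this
  linarith

theorem reflRep_simpleRoot_ne_zero (w : W) (i : J) : cs.reflRep hM w (simpleRoot i) ≠ 0 := by
  intro h
  have := cs.reflRep_inv_apply_self hM w (simpleRoot i)
  rw [h, map_zero] at this
  simpa using DFunLike.congr_fun this i

theorem length_lt_mul_simple_iff (w : W) (i : J) :
    cs.length w < cs.length (w * cs.simple i) ↔ ∀ k, 0 ≤ cs.reflRep hM w (simpleRoot i) k := by
  refine ⟨cs.reflRep_simpleRoot_nonneg hM w i, fun h => ?_⟩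
  by_contra h'
  have hlt : cs.length (w * cs.simple i) < cs.length w :=
    lt_of_le_of_ne (not_lt.1 h') (cs.length_mul_simple_ne w i)
  refine cs.reflRep_simpleRoot_ne_zero hM w i (Finsupp.ext fun k => ?_)
  exact le_antisymm (cs.reflRep_simpleRoot_nonpos hM hlt k) (h k)

/-- The coordinates of a root have one sign, so a single positive coordinate decides. -/
theorem length_lt_mul_simple_of_pos {w : W} {i k : J}
    (h : 0 < cs.reflRep hM w (simpleRoot i) k) : cs.length w < cs.length (w * cs.simple i) := by
  by_contra h'
  have hlt : cs.length (w * cs.simple i) < cs.length w :=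
    lt_of_le_of_ne (not_lt.1 h') (cs.length_mul_simple_ne w i)
  exact absurd (cs.reflRep_simpleRoot_nonpos hM hlt k) (not_le.2 h)

theorem mul_simple_length_lt_iff (w : W) (i : J) :
    cs.length (w * cs.simple i) < cs.length w ↔ ∀ k, cs.reflRep hM w (simpleRoot i) k ≤ 0 := by
  refine ⟨fun h => cs.reflRep_simpleRoot_nonpos hM h, fun h => ?_⟩
  by_contra h'
  have hlt : cs.length w < cs.length (w * cs.simple i) :=
    lt_of_le_of_ne (not_lt.1 h') (cs.length_mul_simple_ne w i).symm
  refine cs.reflRep_simpleRoot_ne_zero hM w i (Finsupp.ext fun k => ?_)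
  exact le_antisymm (h k) (cs.reflRep_simpleRoot_nonneg hM w i hlt k)

theorem length_lt_simple_mul_iff (w : W) (i : J) :
    cs.length w < cs.length (cs.simple i * w) ↔ ∀ k, 0 ≤ cs.reflRep hM w⁻¹ (simpleRoot i) k := by
  rw [← cs.length_lt_mul_simple_iff hM, ← cs.length_inv, ← cs.length_inv (cs.simple i * w),
    mul_inv_rev, inv_simple]

theorem isReduced_cons_iff_length (i : J) (ω : List J) :
    cs.IsReduced (i :: ω) ↔ cs.IsReduced ω ∧
      cs.length (cs.wordProd ω) < cs.length (cs.simple i * cs.wordProd ω) := by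
  unfold IsReduced
  rw [wordProd_cons, List.length_cons]
  have h1 := cs.length_wordProd_le ω
  have h2 := cs.length_simple_mul (cs.wordProd ω) i
  omega

theorem isReduced_cons_iff (i : J) (ω : List J) :
    cs.IsReduced (i :: ω) ↔ cs.IsReduced ω ∧
      ∀ k, 0 ≤ cs.reflRep hM (cs.wordProd ω)⁻¹ (simpleRoot i) k := by
  rw [isReduced_cons_iff_length, length_lt_simple_mul_iff hM cs]

theorem IsReduced.of_append_left {cs : CoxeterSystem M W} {u v : List J}
    (h : cs.IsReduced (u ++ v)) : cs.IsReduced u := by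
  simpa using h.take u.length

theorem IsReduced.of_append_right {cs : CoxeterSystem M W} {u v : List J}
    (h : cs.IsReduced (u ++ v)) : cs.IsReduced v := by
  simpa using h.drop u.length

/-- The action of a word changes only the coordinates at its letters. -/
theorem reflRep_wordProd_apply_of_notMem {ω : List J} {k : J} (hk : k ∉ ω) (v : J →₀ ℝ) :
    cs.reflRep hM (cs.wordProd ω) v k = v k := by
  induction ω with
  | nil => simp
  | cons i ω ih =>
    simp only [List.mem_cons, not_or] at hk
    rw [wordProd_cons, reflRep_mul_apply, reflRep_simple, reflection_apply_of_ne hk.1, ih hk.2]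

theorem reflRep_wordProd_inv_apply_of_notMem {ω : List J} {k : J} (hk : k ∉ ω) (v : J →₀ ℝ) :
    cs.reflRep hM (cs.wordProd ω)⁻¹ v k = v k := by
  rw [← wordProd_reverse]
  exact cs.reflRep_wordProd_apply_of_notMem hM (by simpa using hk) v

include hM in
-- The letters of ω leave the coordinate at x alone, so ω⁻¹α_x still has coordinate 1 there.
theorem isReduced_cons_of_notMem {ω : List J} (hω : cs.IsReduced ω) {x : J} (hx : x ∉ ω) :
    cs.IsReduced (x :: ω) := by
  rw [isReduced_cons_iff_length]
  refine ⟨hω, ?_⟩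
  rw [← cs.length_inv, ← cs.length_inv (cs.simple x * _), mul_inv_rev, inv_simple]
  apply cs.length_lt_mul_simple_of_pos hM (k := x)
  rw [cs.reflRep_wordProd_inv_apply_of_notMem hM hx]
  simp

end CoxeterSystem

/-! ### Braid moves and Matsumoto's theorem -/

/-- One commutation or one long braid move between words in the letters of a Coxeter matrix. -/
inductive CoxeterMatrix.BraidStep {J : Type*} (M : CoxeterMatrix J) : List J → List J → Prop
  | comm (u v : List J) {s t : J} (h : M s t = 2) : BraidStep M (u ++ [s, t] ++ v) (u ++ [t, s] ++ v)
  | braid (u v : List J) {s t : J} (h : M s t = 3) :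
      BraidStep M (u ++ [s, t, s] ++ v) (u ++ [t, s, t] ++ v)

namespace CoxeterSystem

open CoxeterMatrix

variable {J : Type*} {M : CoxeterMatrix J} {W : Type*} [Group W]
  (hM : M.IsSimplyLaced) (cs : CoxeterSystem M W)

theorem wordProd_eq_of_braidStep {ω ω' : List J} (h : M.BraidStep ω ω') :
    cs.wordProd ω = cs.wordProd ω' := by
  cases h with
  | comm u v h => simp only [wordProd_append, wordProd_cons, wordProd_nil, mul_one,
      cs.simple_mul_comm h]
  | braid u v h =>
    have := cs.simple_braid h
    simp only [wordProd_append, wordProd_cons, wordProd_nil, mul_one, ← mul_assoc] at this ⊢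
    rw [mul_assoc (cs.wordProd u), mul_assoc (cs.wordProd u), this]
    simp only [mul_assoc]

theorem _root_.CoxeterMatrix.BraidStep.length_eq {ω ω' : List J} (h : M.BraidStep ω ω') :
    ω.length = ω'.length := by
  cases h <;> simp

theorem _root_.CoxeterMatrix.BraidStep.cons {ω ω' : List J} (h : M.BraidStep ω ω') (i : J) :
    M.BraidStep (i :: ω) (i :: ω') := by
  cases h with
  | comm u v h => exact .comm (i :: u) v h
  | braid u v h => exact .braid (i :: u) v h

variable {cs} in
theorem IsReducedExpr.of_braidStep {ω ω' : List J} {w : W} (hω : cs.IsReducedExpr ω w)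
    (h : M.BraidStep ω ω') : cs.IsReducedExpr ω' w := by
  have h1 := cs.wordProd_eq_of_braidStep h
  refine ⟨?_, h1 ▸ hω.2⟩
  have := hω.1
  unfold IsReduced at this ⊢
  rw [← h1, this, h.length_eq]

theorem simple_mul_length_lt_iff (w : W) (i : J) :
    cs.length (cs.simple i * w) < cs.length w ↔
      ∀ k, cs.reflRep hM w⁻¹ (simpleRoot i) k ≤ 0 := by
  rw [← cs.mul_simple_length_lt_iff hM, ← cs.length_inv, ← cs.length_inv w, mul_inv_rev,
    inv_simple]

include hM in
theorem exists_isReducedExpr_of_eq_two {s t : J} (h : M s t = 2) {w : W}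
    (hs : cs.length (cs.simple s * w) < cs.length w)
    (ht : cs.length (cs.simple t * w) < cs.length w) :
    ∃ ω, cs.IsReducedExpr (t :: ω) (cs.simple s * w) ∧
      cs.IsReducedExpr (s :: ω) (cs.simple t * w) := by
  obtain ⟨ω, hω, hw⟩ := cs.exists_isReduced (cs.simple t * (cs.simple s * w))
  have h1 : cs.length (cs.simple t * (cs.simple s * w)) < cs.length (cs.simple s * w) := by
    rw [simple_mul_length_lt_iff hM] at ht ⊢
    intro k
    rw [mul_inv_rev, reflRep_mul_apply, inv_simple, reflRep_simple, reflection_of_eq_two h]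
    exact ht k
  have hA : cs.wordProd (t :: ω) = cs.simple s * w := by rw [wordProd_cons, ← hw]; simp
  have hB : cs.wordProd (s :: ω) = cs.simple t * w := by
    rw [wordProd_cons, ← hw, ← mul_assoc, cs.simple_mul_comm h, mul_assoc]; simp
  have h2 := cs.length_simple_mul w s
  have h3 := cs.length_simple_mul w t
  have h4 := cs.length_simple_mul (cs.simple s * w) t
  have hω' := hω.eq
  rw [← hw] at hω'
  refine ⟨ω, ⟨?_, hA⟩, ⟨?_, hB⟩⟩
  · unfold IsReduced
    rw [hA, List.length_cons]
    omega
  · unfold IsReduced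
    rw [hB, List.length_cons]
    omega

include hM in
-- Two left descents force w to begin with sts = tst: since s_s α_t = α_s + α_t and s_s s_t α_s =
-- α_t, the inverses of s_s w and s_t s_s w send α_t and α_s to nonpositive vectors.
theorem exists_isReducedExpr_of_eq_three {s t : J} (h : M s t = 3) {w : W}
    (hs : cs.length (cs.simple s * w) < cs.length w)
    (ht : cs.length (cs.simple t * w) < cs.length w) :
    ∃ ω, cs.IsReducedExpr (t :: s :: ω) (cs.simple s * w) ∧
      cs.IsReducedExpr (s :: t :: ω) (cs.simple t * w) := by
  obtain ⟨ω, hω, hw⟩ := cs.exists_isReduced (cs.simple s * (cs.simple t * (cs.simple s * w)))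
  have h1 : cs.length (cs.simple t * (cs.simple s * w)) < cs.length (cs.simple s * w) := by
    rw [simple_mul_length_lt_iff hM] at hs ht ⊢
    intro k
    rw [mul_inv_rev, reflRep_mul_apply, inv_simple, reflRep_simple, reflection_of_eq_three h,
      map_add, Finsupp.add_apply]
    linarith [hs k, ht k]
  have h1' : cs.length (cs.simple s * (cs.simple t * (cs.simple s * w))) <
      cs.length (cs.simple t * (cs.simple s * w)) := by
    rw [simple_mul_length_lt_iff hM] at hs ht ⊢
    intro k
    rw [mul_inv_rev, mul_inv_rev, reflRep_mul_apply, reflRep_mul_apply, inv_simple, inv_simple,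
      reflRep_simple, reflRep_simple, reflection_of_eq_three ((M.symmetric t s).trans h), map_add,
      reflection_of_eq_three h, reflection_self]
    convert ht k using 3
    abel
  have hA : cs.wordProd (t :: s :: ω) = cs.simple s * w := by
    rw [wordProd_cons, wordProd_cons, ← hw]; simp
  have hB : cs.wordProd (s :: t :: ω) = cs.simple t * w := by
    have := cs.simple_braid h
    rw [wordProd_cons, wordProd_cons, ← hw]
    simp only [← mul_assoc]
    rw [mul_assoc (cs.simple s) (cs.simple t) (cs.simple s), ← mul_assoc (cs.simple s), this]
    simp [mul_assoc]
  have h2 := cs.length_simple_mul w s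
  have h3 := cs.length_simple_mul w t
  have h4 := cs.length_simple_mul (cs.simple s * w) t
  have h5 := cs.length_simple_mul (cs.simple t * (cs.simple s * w)) s
  have hω' := hω.eq
  rw [← hw] at hω'
  refine ⟨ω, ⟨?_, hA⟩, ⟨?_, hB⟩⟩
  · unfold IsReduced
    rw [hA, List.length_cons, List.length_cons]
    omega
  · unfold IsReduced
    rw [hB, List.length_cons, List.length_cons]
    omega

include hM in
/-- Matsumoto's theorem for simply laced Coxeter systems. -/
theorem reflTransGen_braidStep {ω ω' : List J} {w : W} (h : cs.IsReducedExpr ω w)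
    (h' : cs.IsReducedExpr ω' w) : Relation.ReflTransGen M.BraidStep ω ω' := by
  induction hn : ω.length using Nat.strong_induction_on generalizing ω ω' w with
  | _ n ih =>
  subst hn
  have hlen : ω'.length = ω.length := by
    rw [← h.1.eq, ← h'.1.eq, h.2, h'.2]
  have key : ∀ {i : J} {η : List J}, cs.IsReducedExpr (i :: η) w →
      cs.IsReducedExpr η (cs.simple i * w) ∧ cs.length (cs.simple i * w) < cs.length w := by
    intro i η hη
    have hp : cs.wordProd η = cs.simple i * w := by rw [← hη.2, wordProd_cons]; simp
    have hr := (cs.isReduced_cons_iff_length i η).1 hη.1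
    refine ⟨⟨hr.1, hp⟩, ?_⟩
    rw [← hp]
    convert hr.2
    rw [hp]
    simp
  have lift : ∀ (i : J) {η η' : List J}, Relation.ReflTransGen M.BraidStep η η' →
      Relation.ReflTransGen M.BraidStep (i :: η) (i :: η') := fun i η η' hη =>
    hη.lift (i :: ·) fun _ _ hs => hs.cons i
  match ω, ω', hlen with
  | [], [], _ => exact .refl
  | s :: ω, t :: ω', hlen =>
    simp only [List.length_cons, add_left_inj] at hlen
    obtain ⟨hs, hsl⟩ := key h
    obtain ⟨ht, htl⟩ := key h'
    have hlt : ∀ {η : List J}, cs.IsReducedExpr η (cs.simple t * w) →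
        η.length < (s :: ω).length := by
      intro η hη
      rw [← hη.1.eq, hη.2, ← ht.2, ht.1.eq, hlen]
      simp
    by_cases hst : s = t
    · subst hst
      exact lift s (ih _ (by simp) hs ht rfl)
    -- For different first letters, w has reduced expressions that begin with st and ts, or with sts
    -- and tst, followed by the same η. One move joins them, and each shares its first letter with
    -- one of the given words, so that induction applies.
    · rcases hM s t hst with hm | hm
      · obtain ⟨η, h1, h2⟩ := cs.exists_isReducedExpr_of_eq_two hM hm hsl htl
        exact ((lift s (ih _ (by simp) hs h1 rfl)).tail (.comm [] η hm)).trans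
          (lift t (ih _ (hlt h2) h2 ht rfl))
      · obtain ⟨η, h1, h2⟩ := cs.exists_isReducedExpr_of_eq_three hM hm hsl htl
        exact ((lift s (ih _ (by simp) hs h1 rfl)).tail (.braid [] η hm)).trans
          (lift t (ih _ (hlt h2) h2 ht rfl))

include hM in
/-- Two reduced expressions for the same element share every property that is preserved by
commutations and long braid moves between reduced expressions for this element. -/
theorem IsReducedExpr.induction {cs : CoxeterSystem M W} {w : W} {P : List J → Prop}
    (hP : ∀ η η', cs.IsReducedExpr η w → M.BraidStep η η' → P η → P η') {ω ω' : List J}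
    (h : cs.IsReducedExpr ω w) (h' : cs.IsReducedExpr ω' w) (hω : P ω) : P ω' := by
  have H := cs.reflTransGen_braidStep hM h h'
  have : cs.IsReducedExpr ω' w ∧ P ω' := by
    clear h'
    induction H with
    | refl => exact ⟨h, hω⟩
    | tail _ hs ih => exact ⟨ih.1.of_braidStep hs, hP _ _ ih.1 hs ih.2⟩
  exact this.2

end CoxeterSystem

/-! ### Subwords in two letters -/

namespace List

variable {J : Type*}

theorem Sublist.of_append_of_head_notMem {c : J} {l u v : List J} (hc : c ∉ u)
    (h : (c :: l) <+ u ++ v) : (c :: l) <+ v := by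
  induction u with
  | nil => exact h
  | cons i u ih =>
    simp only [mem_cons, not_or] at hc
    rw [cons_append] at h
    rcases h with _ | h | h
    · exact ih hc.2 ‹_›
    · exact absurd rfl hc.1

theorem Sublist.of_append_of_last_notMem {c : J} {l u v : List J} (hc : c ∉ v)
    (h : (l ++ [c]) <+ u ++ v) : (l ++ [c]) <+ u := by
  have h' := h.reverse
  simp only [reverse_append, reverse_cons, reverse_nil, nil_append, cons_append] at h'
  have := (h'.of_append_of_head_notMem (by simpa using hc)).reverse
  simpa using this

theorem pair_sublist_iff_two_le_count [DecidableEq J] {a : J} {l : List J} : [a, a] <+ l ↔ 2 ≤ l.count a :=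
  replicate_sublist_iff (n := 2)

open Classical in
/-- The subword of the occurrences of two letters. -/
def restrictPair (a b : J) (l : List J) : List J := l.filter fun x => x = a ∨ x = b

theorem restrictPair_append (a b : J) (u v : List J) :
    (u ++ v).restrictPair a b = u.restrictPair a b ++ v.restrictPair a b := filter_append _ _

@[simp] theorem restrictPair_nil (a b : J) : ([] : List J).restrictPair a b = [] := rfl

theorem restrictPair_cons_of_eq {a b x : J} (h : x = a ∨ x = b) (l : List J) :
    (x :: l).restrictPair a b = x :: l.restrictPair a b := by
  simp [restrictPair, h]

theorem restrictPair_cons_of_ne {a b x : J} (ha : x ≠ a) (hb : x ≠ b) (l : List J) :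
    (x :: l).restrictPair a b = l.restrictPair a b := by
  simp [restrictPair, ha, hb]

theorem restrictPair_comm (a b : J) (l : List J) : l.restrictPair a b = l.restrictPair b a :=
  filter_congr fun x _ => by simp only [decide_eq_decide]; exact or_comm

theorem restrictPair_sublist (a b : J) (l : List J) : l.restrictPair a b <+ l := filter_sublist

theorem restrictPair_eq_nil_iff {a b : J} {l : List J} :
    l.restrictPair a b = [] ↔ a ∉ l ∧ b ∉ l := by
  simp only [restrictPair, filter_eq_nil_iff, decide_eq_true_eq, not_or]
  constructor
  · exact fun h => ⟨fun ha => (h a ha).1 rfl, fun hb => (h b hb).2 rfl⟩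
  · rintro ⟨ha, hb⟩ x hx
    exact ⟨fun h => ha (h ▸ hx), fun h => hb (h ▸ hx)⟩

theorem mem_restrictPair {a b x : J} {l : List J} :
    x ∈ l.restrictPair a b ↔ x ∈ l ∧ (x = a ∨ x = b) := by
  simp [restrictPair]

theorem sublist_restrictPair_iff {a b : J} {k l : List J} (hk : ∀ x ∈ k, x = a ∨ x = b) :
    k <+ l.restrictPair a b ↔ k <+ l := by
  classical
  refine ⟨fun h => h.trans (restrictPair_sublist a b l), fun h => ?_⟩
  have := h.filter (fun x => x = a ∨ x = b)
  rwa [filter_eq_self.2 (by simpa using hk)] at this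

theorem restrictPair_swap {a b s t : J} (hst : s ≠ t) (h : ¬(s = a ∧ t = b) ∧ ¬(s = b ∧ t = a)) :
    [s, t].restrictPair a b = [t, s].restrictPair a b := by
  simp only [restrictPair, filter_cons, filter_nil]
  split_ifs <;> grind

end List

/-! ### Paired and braided words -/

namespace CoxeterMatrix

open List

variable {J : Type*} (M : CoxeterMatrix J) (R : J → J → Prop) (ω : List J)

/-- The relation `R` matches some letters of the word `ω` in pairs such that the letters of each
pair form a long braid (not necessarily of consecutive letters), and all other letters occur at
most once. -/
structure IsPaired : Prop where
  symm : ∀ {a b}, R a b → R b a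
  unique : ∀ {a b c}, R a b → R a c → b = c
  bond : ∀ {a b}, R a b → M a b = 3
  restrict : ∀ {a b}, R a b → ω.restrictPair a b = [a, b, a] ∨ ω.restrictPair a b = [b, a, b]
  exists_of_dup : ∀ {a}, [a, a] <+ ω → ∃ b, R a b

/-- A paired word in which the only letters that obstruct contraction of a braid are its own. -/
structure IsBraided : Prop extends IsPaired M R ω where
  eq_two_or : ∀ {c x}, [c, x, c] <+ ω → M c x = 2 ∨ R c x

variable {M R ω}

/-- The factor sts repeats s, so s has a partner d. If d ≠ t, restriction to s and d would make two
occurrences of s adjacent, unlike in sds and dsd. So d = t, and a restricted word of length three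
leaves no room for further occurrences. -/
theorem IsPaired.rel_of_infix {s t : J} {u v : List J} (h : M.IsPaired R (u ++ [s, t, s] ++ v))
    (hst : M s t = 3) : R s t ∧ (s ∉ u ∧ t ∉ u) ∧ (s ∉ v ∧ t ∉ v) := by
  have hne := ne_of_eq_three hst
  obtain ⟨d, hd⟩ := h.exists_of_dup (a := s) (by
    have : [s, s] <+ [s, t, s] := by simp
    exact this.trans ((sublist_append_right u _).trans (sublist_append_left _ v)))
  have hsd := ne_of_eq_three (h.bond hd)
  have hr := h.restrict hd
  rw [restrictPair_append, restrictPair_append] at hr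
  by_cases htd : t = d
  · subst htd
    refine ⟨hd, ?_⟩
    rw [← restrictPair_eq_nil_iff, ← restrictPair_eq_nil_iff]
    have h3 : [s, t, s].restrictPair s t = [s, t, s] := by simp [restrictPair]
    rw [h3] at hr
    have hl : (restrictPair s t u).length + (restrictPair s t v).length = 0 := by
      rcases hr with hr | hr <;> have := congrArg length hr <;> simp at this <;> omega
    simpa [length_eq_zero_iff] using hl
  · exfalso
    rw [restrictPair_cons_of_eq (Or.inl rfl), restrictPair_cons_of_ne hne.symm htd,
      restrictPair_cons_of_eq (Or.inl rfl), restrictPair_nil] at hr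
    generalize restrictPair s d u = U at hr
    generalize restrictPair s d v = V at hr
    rcases U with _ | ⟨a, _ | ⟨b, U⟩⟩
    · simp at hr
      grind
    · simp at hr
      grind
    · rcases hr with hr | hr <;> have := congrArg length hr <;> simp at this <;> omega

/-- Partners do not commute, so commutations keep the order within a pair. By
`IsPaired.rel_of_infix`, a long braid move exchanges the two forms of one pair and leaves the others
alone. -/
theorem IsPaired.of_braidStep {ω' : List J} (h : M.IsPaired R ω) (hs : M.BraidStep ω ω') :
    M.IsPaired R ω' := by
  classical
  cases hs with
  | @comm u v s t hst =>
    refine ⟨h.symm, h.unique, h.bond, fun {a b} hab => ?_, fun {a} ha => h.exists_of_dup (a := a) ?_⟩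
    · have := h.restrict hab
      have hb := h.bond hab
      have hb' := (M.symmetric b a).trans hb
      simp only [restrictPair_append] at this ⊢
      rwa [← restrictPair_swap (ne_of_eq_two hst)]
      constructor
      · rintro ⟨rfl, rfl⟩
        omega
      · rintro ⟨rfl, rfl⟩
        omega
    · rw [pair_sublist_iff_two_le_count] at ha ⊢
      simp only [count_append, count_cons, count_nil] at ha ⊢
      omega
  | @braid u v s t hst =>
    obtain ⟨hR, hu, hv⟩ := h.rel_of_infix hst
    have hne := ne_of_eq_three hst
    have key : (u ++ [t, s, t] ++ v).restrictPair s t = [t, s, t] := by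
      rw [restrictPair_append, restrictPair_append, restrictPair_eq_nil_iff.2 hu,
        restrictPair_eq_nil_iff.2 hv]
      simp [restrictPair]
    refine ⟨h.symm, h.unique, h.bond, fun {a b} hab => ?_, fun {a} ha => ?_⟩
    · by_cases has : a = s
      · subst has
        obtain rfl := h.unique hab hR
        exact Or.inr key
      by_cases hat : a = t
      · subst hat
        obtain rfl := h.unique hab (h.symm hR)
        rw [restrictPair_comm]
        exact Or.inl key
      have hbs : b ≠ s := by
        rintro rfl
        exact hat (h.unique (h.symm hab) hR)
      have hbt : b ≠ t := by
        rintro rfl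
        exact has (h.unique (h.symm hab) (h.symm hR))
      have := h.restrict hab
      simpa [restrictPair_append, restrictPair_cons_of_ne, Ne.symm has, Ne.symm hat, hbs.symm,
        hbt.symm] using this
    · by_cases has : a = s
      · subst has
        exact ⟨t, hR⟩
      by_cases hat : a = t
      · subst hat
        exact ⟨s, h.symm hR⟩
      apply h.exists_of_dup
      rw [pair_sublist_iff_two_le_count] at ha ⊢
      simpa [count_append, count_cons, Ne.symm has, Ne.symm hat] using ha

/-- In paired words, a letter that does not commute with `c` and is not matched with it stays
between two occurrences of `c` under commutations and long braid moves. -/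
theorem IsPaired.sublist_of_braidStep {ω' : List J} (h : M.IsPaired R ω) (hs : M.BraidStep ω ω')
    {c x : J} (hcx : M c x = 3) (hR : ¬ R c x) (hω : [c, x, c] <+ ω) : [c, x, c] <+ ω' := by
  classical
  have hmem : ∀ y ∈ [c, x, c], y = c ∨ y = x := by simp
  have hxc := (M.symmetric x c).trans hcx
  have hne := ne_of_eq_three hcx
  cases hs with
  | @comm u v s t hst =>
    rw [← sublist_restrictPair_iff hmem] at hω ⊢
    simp only [restrictPair_append] at hω ⊢
    rwa [← restrictPair_swap (ne_of_eq_two hst)]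
    constructor
    · rintro ⟨rfl, rfl⟩
      omega
    · rintro ⟨rfl, rfl⟩
      omega
  | @braid u v s t hst =>
    obtain ⟨hRst, hu, hv⟩ := h.rel_of_infix hst
    have hst' := ne_of_eq_three hst
    -- All occurrences of s and t lie in the factor sts. So c = s would make x its partner t, and c
    -- = t would occur only once.
    by_cases hcs : c = s
    · subst hcs
      exfalso
      rw [append_assoc] at hω
      have h1 := Sublist.of_append_of_last_notMem (l := [c, x]) hv.1
        (Sublist.of_append_of_head_notMem hu.1 hω)
      have h2 := Sublist.eq_of_length h1 rfl
      simp only [nil_append, cons_append, cons.injEq, and_true, true_and] at h2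
      exact hR (h2 ▸ hRst)
    by_cases hct : c = t
    · subst hct
      exfalso
      have h1 : [c, c] <+ [c, x, c] := by simp
      have h2 := pair_sublist_iff_two_le_count.1 (h1.trans hω)
      simp [count_append, count_eq_zero_of_not_mem hu.2,
        count_eq_zero_of_not_mem hv.2, hst'] at h2
    -- In this case x occurs only inside the factor, so the occurrences of c lie on both sides of
    -- it, and the new factor tst again contains x.
    by_cases hx : x = s ∨ x = t
    · have hxu : x ∉ u := by rcases hx with rfl | rfl; exacts [hu.1, hu.2]
      have hxv : x ∉ v := by rcases hx with rfl | rfl; exacts [hv.1, hv.2]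
      have hcu : c ∈ u := by
        by_contra hcu
        have h1 := Sublist.of_append_of_head_notMem (u := u ++ [s, t, s])
          (by simp [hcu, hcs, hct]) hω
        exact hxv (h1.subset (by simp))
      have hcv : c ∈ v := by
        by_contra hcv
        rw [append_assoc] at hω
        have h1 := Sublist.of_append_of_last_notMem (l := [c, x]) (v := [s, t, s] ++ v)
          (by simp [hcv, hcs, hct]) hω
        exact hxu (h1.subset (by simp))
      have hx' : x ∈ [t, s, t] := by rcases hx with rfl | rfl <;> simp
      exact ((singleton_sublist.2 hcu).append (singleton_sublist.2 hx')).append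
        (singleton_sublist.2 hcv)
    · rw [not_or] at hx
      rw [← sublist_restrictPair_iff hmem] at hω ⊢
      simpa [restrictPair_append, restrictPair_cons_of_ne, Ne.symm hcs, Ne.symm hct,
        Ne.symm hx.1, Ne.symm hx.2] using hω

theorem IsPaired.count_le_two (h : M.IsPaired R ω) [DecidableEq J] (a : J) : ω.count a ≤ 2 := by
  by_contra hc
  push Not at hc
  obtain ⟨b, hb⟩ := h.exists_of_dup (a := a) (by
    rw [pair_sublist_iff_two_le_count]; exact hc.le)
  have h3 : replicate 3 a <+ ω := replicate_sublist_iff.2 hc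
  rw [← sublist_restrictPair_iff (a := a) (b := b) (by simp)] at h3
  have hne := ne_of_eq_three (h.bond hb)
  rcases h.restrict hb with hr | hr <;> rw [hr] at h3 <;>
    have := h3.eq_of_length rfl <;> simp [replicate_succ] at this <;> grind

theorem IsPaired.mem_of_rel (h : M.IsPaired R ω) {a b : J} (hab : R a b) : a ∈ ω := by
  have : a ∈ ω.restrictPair a b := by rcases h.restrict hab with hr | hr <;> simp [hr]
  exact (mem_restrictPair.1 this).1

theorem IsPaired.exists_eq_of_dup (h : M.IsPaired R ω) {a b : J} (ha : [a, a] <+ ω) (hab : R a b) :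
    ∃ u₁ u₂ u₃ u₄, ω = u₁ ++ a :: u₂ ++ b :: u₃ ++ a :: u₄ ∧ (a ∉ u₁ ∧ b ∉ u₁) ∧
      (a ∉ u₂ ∧ b ∉ u₂) ∧ (a ∉ u₃ ∧ b ∉ u₃) ∧ a ∉ u₄ ∧ b ∉ u₄ := by
  have hne := ne_of_eq_three (h.bond hab)
  have hr : ω.restrictPair a b = [a, b, a] := by
    refine (h.restrict hab).resolve_right fun hr => ?_
    rw [← sublist_restrictPair_iff (a := a) (b := b) (by simp), hr] at ha
    rcases ha with _ | ha | ha <;> simp_all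
  simp only [← restrictPair_eq_nil_iff]
  unfold restrictPair at hr ⊢
  obtain ⟨u₁, v₁, rfl, h1, -, hr⟩ := filter_eq_cons_iff.1 hr
  obtain ⟨u₂, v₂, rfl, h2, -, hr⟩ := filter_eq_cons_iff.1 hr
  obtain ⟨u₃, v₃, rfl, h3, -, hr⟩ := filter_eq_cons_iff.1 hr
  exact ⟨u₁, u₂, u₃, v₃, by simp, filter_eq_nil_iff.2 h1, filter_eq_nil_iff.2 h2,
    filter_eq_nil_iff.2 h3, hr⟩

end CoxeterMatrix

/-! ### Labelled root sequences and contractible triples -/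

namespace CoxeterSystem

open CoxeterMatrix List

variable {J : Type*} {M : CoxeterMatrix J} {W : Type*} [Group W]
  (hM : M.IsSimplyLaced) (cs : CoxeterSystem M W)

/-- The letters of a word, each with its root, in the order of the word. -/
def rootList : List J → List (J × (J →₀ ℝ))
  | [] => []
  | i :: ω => (i, cs.reflRep hM (cs.wordProd ω)⁻¹ (simpleRoot i)) :: rootList ω

theorem rootSeq_eq_reverse_map_rootList (ω : List J) :
    cs.rootSeq hM ω = ((cs.rootList hM ω).map Prod.snd).reverse := by
  induction ω with
  | nil => rfl
  | cons i ω ih => simp [rootSeq, rootList, ih]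

@[simp] theorem map_fst_rootList (ω : List J) : (cs.rootList hM ω).map Prod.fst = ω := by
  induction ω with
  | nil => rfl
  | cons i ω ih => simp [rootList, ih]

theorem length_rootList (ω : List J) : (cs.rootList hM ω).length = ω.length := by
  rw [← length_map (f := Prod.fst), map_fst_rootList]

theorem rootList_append (u v : List J) :
    cs.rootList hM (u ++ v) = (cs.rootList hM u).map
      (fun p => (p.1, cs.reflRep hM (cs.wordProd v)⁻¹ p.2)) ++ cs.rootList hM v := by
  induction u with
  | nil => rfl
  | cons i u ih =>
    simp only [cons_append, rootList, ih, map_cons, wordProd_append, mul_inv_rev,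
      reflRep_mul_apply]

theorem mem_rootList_iff {ω : List J} {p : J × (J →₀ ℝ)} :
    p ∈ cs.rootList hM ω ↔ ∃ u v, ω = u ++ p.1 :: v ∧
      p.2 = cs.reflRep hM (cs.wordProd v)⁻¹ (simpleRoot p.1) := by
  constructor
  · induction ω with
    | nil => simp [rootList]
    | cons i ω ih =>
      intro h
      rcases mem_cons.1 h with rfl | h
      · exact ⟨[], ω, rfl, rfl⟩
      · obtain ⟨u, v, rfl, hp⟩ := ih h
        exact ⟨i :: u, v, rfl, hp⟩
  · rintro ⟨u, v, rfl, hp⟩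
    rw [rootList_append, rootList, mem_append, mem_cons]
    exact Or.inr (Or.inl (Prod.ext rfl hp))

/-- If the root of i equals that of a later letter p, and u is the word between them, then u⁻¹α_i =
−α_p, so the factor iu is not reduced. -/
theorem nodup_rootList {ω : List J} (hω : cs.IsReduced ω) :
    ((cs.rootList hM ω).map Prod.snd).Nodup := by
  induction ω with
  | nil => simp [rootList]
  | cons i ω ih =>
    rw [rootList, map_cons, nodup_cons]
    refine ⟨fun hmem => ?_, ih ((cs.isReduced_cons_iff_length i ω).1 hω).1⟩
    obtain ⟨p, hp, hpi⟩ := mem_map.1 hmem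
    obtain ⟨u, v, rfl, hp2⟩ := (cs.mem_rootList_iff hM).1 hp
    rw [hp2] at hpi
    have h1 : cs.reflRep hM (cs.wordProd u)⁻¹ (simpleRoot i) = -simpleRoot p.1 := by
      have h2 : cs.reflRep hM (cs.wordProd v)⁻¹ (simpleRoot p.1) =
          cs.reflRep hM (cs.wordProd v)⁻¹
            (M.reflection p.1 (cs.reflRep hM (cs.wordProd u)⁻¹ (simpleRoot i))) := by
        rw [hpi, ← reflRep_simple hM cs, ← reflRep_mul_apply, ← reflRep_mul_apply,
          wordProd_append, wordProd_cons]
        simp [mul_assoc]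
      have h3 := congrArg (M.reflection p.1) (cs.reflRep_injective hM _ h2)
      rw [reflection_self, ← reflRep_simple hM cs, ← reflRep_mul_apply,
        simple_mul_simple_self, map_one, Module.End.one_apply] at h3
      exact h3.symm
    have h4 : cs.IsReduced (i :: u) := by
      rw [← cons_append] at hω
      exact hω.of_append_left
    have h5 := ((cs.isReduced_cons_iff hM i u).1 h4).2 p.1
    rw [h1] at h5
    norm_num at h5

theorem eq_of_mem_rootList {ω : List J} (hω : cs.IsReduced ω) {p q : J × (J →₀ ℝ)}
    (hp : p ∈ cs.rootList hM ω) (hq : q ∈ cs.rootList hM ω) (h : p.2 = q.2) : p = q :=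
  inj_on_of_nodup_map (cs.nodup_rootList hM hω) hp hq h

theorem mem_inversionSet_of_mem_rootList {ω : List J} {w : W} (h : cs.IsReducedExpr ω w)
    {p : J × (J →₀ ℝ)} (hp : p ∈ cs.rootList hM ω) : p.2 ∈ cs.inversionSet hM w := by
  obtain ⟨u, v, rfl, hp2⟩ := (cs.mem_rootList_iff hM).1 hp
  obtain ⟨hr, rfl⟩ := h
  have h1 := ((cs.isReduced_cons_iff hM _ _).1 hr.of_append_right).2
  refine ⟨⟨⟨_, _, hp2⟩, by rwa [hp2]⟩, ?_⟩
  have h2 : -(cs.reflRep hM (cs.wordProd (u ++ p.1 :: v)) p.2) =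
      cs.reflRep hM (cs.wordProd u) (simpleRoot p.1) := by
    rw [hp2, ← reflRep_mul_apply, wordProd_append, wordProd_cons]
    simp only [mul_assoc, mul_inv_cancel, mul_one]
    rw [reflRep_mul_apply, reflRep_simple, reflection_self, map_neg, neg_neg]
  refine ⟨⟨_, _, h2⟩, ?_⟩
  rw [h2, ← length_lt_mul_simple_iff]
  have h3 : cs.IsReduced (u ++ [p.1]) := by
    have : u ++ p.1 :: v = (u ++ [p.1]) ++ v := by simp
    rw [this] at hr
    exact hr.of_append_left
  have h4 := h3.of_append_left.eq
  have h5 := h3.eq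
  rw [wordProd_append, wordProd_singleton, length_append] at h5
  rw [h5, h4]
  simp

/-- Under a commutation the two letters are swapped together with their roots. -/
theorem rootList_comm (u v : List J) {s t : J} (h : M s t = 2) : ∃ U V r r',
    cs.rootList hM (u ++ [s, t] ++ v) = U ++ [(s, r), (t, r')] ++ V ∧
    cs.rootList hM (u ++ [t, s] ++ v) = U ++ [(t, r'), (s, r)] ++ V := by
  have h1 := cs.wordProd_eq_of_braidStep (.comm [] v h)
  simp only [nil_append] at h1
  refine ⟨(cs.rootList hM u).map
      (fun p => (p.1, cs.reflRep hM (cs.wordProd ([s, t] ++ v))⁻¹ p.2)), cs.rootList hM v,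
      cs.reflRep hM (cs.wordProd v)⁻¹ (simpleRoot s),
      cs.reflRep hM (cs.wordProd v)⁻¹ (simpleRoot t), ?_, ?_⟩
  · rw [append_assoc, rootList_append]
    simp only [append_assoc, cons_append, nil_append, rootList,
      wordProd_cons, mul_inv_rev, inv_simple, reflRep_mul_apply, reflRep_simple,
      reflection_of_eq_two ((M.symmetric t s).trans h)]
  · rw [append_assoc, rootList_append, h1]
    simp only [append_assoc, cons_append, nil_append, rootList,
      wordProd_cons, mul_inv_rev, inv_simple, reflRep_mul_apply, reflRep_simple,
      reflection_of_eq_two h]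

/-- Under a long braid move the three roots are reversed. -/
theorem rootList_braid (u v : List J) {s t : J} (h : M s t = 3) : ∃ U V,
    (U.map Prod.fst = u ∧ V.map Prod.fst = v) ∧
    cs.rootList hM (u ++ [s, t, s] ++ v) = U ++
      [(s, cs.reflRep hM (cs.wordProd v)⁻¹ (simpleRoot t)),
        (t, cs.reflRep hM (cs.wordProd v)⁻¹ (simpleRoot s + simpleRoot t)),
        (s, cs.reflRep hM (cs.wordProd v)⁻¹ (simpleRoot s))] ++ V ∧
    cs.rootList hM (u ++ [t, s, t] ++ v) = U ++
      [(t, cs.reflRep hM (cs.wordProd v)⁻¹ (simpleRoot s)),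
        (s, cs.reflRep hM (cs.wordProd v)⁻¹ (simpleRoot s + simpleRoot t)),
        (t, cs.reflRep hM (cs.wordProd v)⁻¹ (simpleRoot t))] ++ V := by
  have h1 := cs.wordProd_eq_of_braidStep (.braid [] v h)
  simp only [nil_append] at h1
  have h' := (M.symmetric t s).trans h
  have h2 : M.reflection s (simpleRoot s + simpleRoot t) = simpleRoot t := by
    rw [map_add, reflection_self, reflection_of_eq_three h]; abel
  have h3 : M.reflection t (simpleRoot t + simpleRoot s) = simpleRoot s := by
    rw [map_add, reflection_self, reflection_of_eq_three h']; abel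
  refine ⟨(cs.rootList hM u).map
      (fun p => (p.1, cs.reflRep hM (cs.wordProd ([s, t, s] ++ v))⁻¹ p.2)), cs.rootList hM v,
      ⟨by rw [map_map]; exact cs.map_fst_rootList hM u, cs.map_fst_rootList hM v⟩, ?_, ?_⟩
  · rw [append_assoc, rootList_append]
    simp only [append_assoc, cons_append, nil_append, rootList,
      wordProd_cons, mul_inv_rev, inv_simple, reflRep_mul_apply, reflRep_simple,
      reflection_of_eq_three h', reflection_of_eq_three h, ← add_comm (simpleRoot s), h2]
  · rw [append_assoc, rootList_append, h1]
    simp only [append_assoc, cons_append, nil_append, rootList,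
      wordProd_cons, mul_inv_rev, inv_simple, reflRep_mul_apply, reflRep_simple,
      reflection_of_eq_three h', reflection_of_eq_three h, add_comm (simpleRoot s), h3]

/-- The roots of a long braid in the letters `s`, `t` that is followed by the word `v`. -/
def braidRoots (v : List J) (s t : J) : Set (J →₀ ℝ) :=
  {cs.reflRep hM (cs.wordProd v)⁻¹ (simpleRoot t),
    cs.reflRep hM (cs.wordProd v)⁻¹ (simpleRoot s + simpleRoot t),
    cs.reflRep hM (cs.wordProd v)⁻¹ (simpleRoot s)}

theorem isContractible_braidRoots {u v : List J} {s t : J} {w : W} (h : M s t = 3)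
    (hw : cs.IsReducedExpr (u ++ [s, t, s] ++ v) w) :
    cs.IsContractible hM w (cs.braidRoots hM v s t) := by
  obtain ⟨U, V, -, hUV, -⟩ := cs.rootList_braid hM u v h
  refine ⟨⟨?_, cs.reflRep hM (cs.wordProd v)⁻¹ (simpleRoot t),
    cs.reflRep hM (cs.wordProd v)⁻¹ (simpleRoot s), ?_⟩, _, hw, 
    cs.reflRep hM (cs.wordProd v)⁻¹ (simpleRoot s),
    cs.reflRep hM (cs.wordProd v)⁻¹ (simpleRoot s + simpleRoot t),
    cs.reflRep hM (cs.wordProd v)⁻¹ (simpleRoot t), ?_, ?_⟩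
  · have hm := fun p => cs.mem_inversionSet_of_mem_rootList hM hw (p := p)
    rw [hUV] at hm
    rintro r (rfl | rfl | rfl)
    · exact hm (s, _) (by simp)
    · exact hm (t, _) (by simp)
    · exact hm (s, _) (by simp)
  · rw [braidRoots, map_add, add_comm (cs.reflRep hM (cs.wordProd v)⁻¹ (simpleRoot s))]
    ext r
    simp only [Set.mem_insert_iff, Set.mem_singleton_iff]
    tauto
  · rw [rootSeq_eq_reverse_map_rootList, hUV]
    refine ⟨(V.map Prod.snd).reverse, (U.map Prod.snd).reverse, ?_⟩
    simp
  · rw [braidRoots]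
    ext r
    simp only [Set.mem_insert_iff, Set.mem_singleton_iff]
    tauto

theorem not_isReduced_pair (u v : List J) (s : J) : ¬ cs.IsReduced (u ++ s :: s :: v) := by
  intro h
  have h1 := (h.of_append_right).eq
  have h2 := cs.length_wordProd_le v
  rw [wordProd_cons, wordProd_cons, simple_mul_simple_cancel_left] at h1
  simp at h1
  omega

theorem sum_relation_of_eq_triple {V : Type*} [AddCommGroup V] [Module ℝ V] {x y z α β : V}
    (hxy : x ≠ y) (hxz : x ≠ z) (hyz : y ≠ z) (hx : x ≠ 0) (hy : y ≠ 0) (hz : z ≠ 0)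
    (h : ({x, y, z} : Set V) = {α, β, α + β}) : x + y = z ∨ x + z = y ∨ y + z = x := by
  have hα : α ∈ ({x, y, z} : Set V) := by rw [h]; simp
  have hβ : β ∈ ({x, y, z} : Set V) := by rw [h]; simp
  have hαβ : α + β ∈ ({x, y, z} : Set V) := by rw [h]; simp
  have hX : x ∈ ({α, β, α + β} : Set V) := by rw [← h]; simp
  have hY : y ∈ ({α, β, α + β} : Set V) := by rw [← h]; simp
  have hZ : z ∈ ({α, β, α + β} : Set V) := by rw [← h]; simp
  clear h
  have hα0 : α ≠ 0 := by rcases hα with rfl | rfl | rfl <;> assumption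
  have hβ0 : β ≠ 0 := by rcases hβ with rfl | rfl | rfl <;> assumption
  have h1 : α + β ≠ α := by simpa using hβ0
  have h2 : α + β ≠ β := by simpa using hα0
  have h3 : α ≠ β := by
    rintro rfl
    simp only [Set.mem_insert_iff, Set.mem_singleton_iff] at hX hY hZ
    grind
  simp only [Set.mem_insert_iff, Set.mem_singleton_iff] at hα hβ hαβ
  rcases hα with rfl | rfl | rfl <;> rcases hβ with rfl | rfl | rfl <;>
    rcases hαβ with h | h | h <;> simp_all [add_comm]

/-- The root of a letter depends only on the word after it. -/
theorem eq_rootList_of_append {ω : List J} {P Q : List (J × (J →₀ ℝ))}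
    (h : cs.rootList hM ω = P ++ Q) : Q = cs.rootList hM (Q.map Prod.fst) := by
  have h1 : ω = P.map Prod.fst ++ Q.map Prod.fst := by
    rw [← map_append, ← h, map_fst_rootList]
  have h2 := h
  rw [h1, rootList_append] at h2
  exact (append_inj_right h2 (by simp [length_rootList])).symm

include hM in
-- The vectors −α_c, α_b, s_b α_a are the roots of a factor abc followed by v, after v and then s_c
-- have been applied. Coordinates at a and b leave only s_b α_a = α_b + α_c, that is, a long braid.
theorem eq_three_and_eq_of_sum_relation {a b c : J} (hab : a ≠ b) (hbc : b ≠ c)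
    (h : -simpleRoot c + simpleRoot b = M.reflection b (simpleRoot a) ∨
      -simpleRoot c + M.reflection b (simpleRoot a) = (simpleRoot b : J →₀ ℝ) ∨
      simpleRoot b + M.reflection b (simpleRoot a) = -simpleRoot c) : M b a = 3 ∧ a = c := by
  have hca := simpleRoot_nonneg c a
  have hra : M.reflection b (simpleRoot a) a = 1 := by
    rw [reflection_apply_of_ne hab]; simp
  rcases h with h | h | h
  · have := DFunLike.congr_fun h a
    simp only [Finsupp.add_apply, Finsupp.neg_apply, hra, simpleRoot_apply_of_ne hab] at this
    linarith
  · have hm : M b a = 3 := by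
      refine (hM b a hab.symm).resolve_left fun hm => ?_
      have := DFunLike.congr_fun h b
      rw [reflection_of_eq_two hm] at this
      simp only [Finsupp.add_apply, Finsupp.neg_apply, simpleRoot_apply_of_ne hab.symm,
        simpleRoot_apply_of_ne hbc, simpleRoot_apply_self] at this
      norm_num at this
    refine ⟨hm, ?_⟩
    by_contra hac
    have := DFunLike.congr_fun h a
    simp only [Finsupp.add_apply, Finsupp.neg_apply, hra, simpleRoot_apply_of_ne hab,
      simpleRoot_apply_of_ne hac] at this
    norm_num at this
  · have := DFunLike.congr_fun h a
    simp only [Finsupp.add_apply, Finsupp.neg_apply, hra, simpleRoot_apply_of_ne hab] at this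
    linarith

theorem exists_of_infix_rootSeq {ω : List J} {x y z : J →₀ ℝ}
    (hxyz : [x, y, z] <:+: cs.rootSeq hM ω) : ∃ u v a b c, ω = u ++ a :: b :: c :: v ∧
      z = cs.reflRep hM (cs.wordProd v)⁻¹ (M.reflection c (M.reflection b (simpleRoot a))) ∧
      y = cs.reflRep hM (cs.wordProd v)⁻¹ (M.reflection c (simpleRoot b)) ∧
      x = cs.reflRep hM (cs.wordProd v)⁻¹ (simpleRoot c) := by
  rw [rootSeq_eq_reverse_map_rootList, ← reverse_infix] at hxyz
  simp only [reverse_cons, reverse_nil, nil_append, cons_append, reverse_reverse] at hxyz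
  obtain ⟨L₁, L₂, hL⟩ := hxyz
  rw [append_assoc, cons_append, cons_append, cons_append, nil_append] at hL
  obtain ⟨P, Q₁, hPQ, -, hQ₁⟩ := map_eq_append_iff.1 hL.symm
  obtain ⟨⟨a, z⟩, Q₂, rfl, rfl, hQ₂⟩ := map_eq_cons_iff.1 hQ₁
  obtain ⟨⟨b, y⟩, Q₃, rfl, rfl, hQ₃⟩ := map_eq_cons_iff.1 hQ₂
  obtain ⟨⟨c, x⟩, Q, rfl, rfl, hQ⟩ := map_eq_cons_iff.1 hQ₃
  have hroots := cs.eq_rootList_of_append hM hPQ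
  simp only [map_cons, rootList, wordProd_cons, mul_inv_rev, inv_simple, cons.injEq, Prod.mk.injEq,
    true_and, reflRep_mul_apply, reflRep_simple] at hroots
  refine ⟨P.map Prod.fst, Q.map Prod.fst, a, b, c, ?_, hroots.1, hroots.2.1, hroots.2.2.1⟩
  rw [← map_fst_rootList hM cs ω, hPQ]
  simp

/-- Contractible triples arise only from long braids. -/
theorem IsContractible.exists_eq_braidRoots {cs : CoxeterSystem M W} {w : W} {T : Set (J →₀ ℝ)}
    (hT : cs.IsContractible hM w T) : ∃ u v s t, M s t = 3 ∧
      cs.IsReducedExpr (u ++ [s, t, s] ++ v) w ∧ T = cs.braidRoots hM v s t := by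
  obtain ⟨⟨-, α, β, hαβ⟩, ω, hω, x, y, z, hxyz, hT⟩ := hT
  have hnd : [x, y, z].Nodup := by
    refine (hxyz.sublist.nodup ?_)
    rw [rootSeq_eq_reverse_map_rootList, nodup_reverse]
    exact cs.nodup_rootList hM hω.1
  obtain ⟨u, v, a, b, c, rfl, hz, hy, hx⟩ := cs.exists_of_infix_rootSeq hM hxyz
  have hab : a ≠ b := by
    rintro rfl
    exact cs.not_isReduced_pair u (c :: v) a hω.1
  have hbc : b ≠ c := by
    rintro rfl
    exact cs.not_isReduced_pair (u ++ [a]) v b (by simpa using hω.1)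
  simp only [nodup_cons, mem_cons, not_or, not_mem_nil, not_false_eq_true, and_true] at hnd
  have hx0 : x ≠ 0 := hx ▸ cs.reflRep_simpleRoot_ne_zero hM _ c
  have hy0 : y ≠ 0 := by
    rw [hy, ← reflRep_simple hM cs, ← reflRep_mul_apply]
    exact cs.reflRep_simpleRoot_ne_zero hM _ b
  have hz0 : z ≠ 0 := by
    rw [hz, ← reflRep_simple hM cs, ← reflRep_simple hM cs, ← reflRep_mul_apply,
      ← reflRep_mul_apply]
    exact cs.reflRep_simpleRoot_ne_zero hM _ a
  have hsum := sum_relation_of_eq_triple hnd.1.1 hnd.1.2 hnd.2.1 hx0 hy0 hz0 (hT.symm.trans hαβ)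
  have key : ∀ r, M.reflection c (cs.reflRep hM (cs.wordProd v)
      (cs.reflRep hM (cs.wordProd v)⁻¹ (M.reflection c r))) = r := by
    intro r
    rw [reflRep_apply_inv_self, ← reflRep_simple hM cs, ← reflRep_mul_apply,
      simple_mul_simple_self, map_one, Module.End.one_apply]
  have hsx : M.reflection c (cs.reflRep hM (cs.wordProd v) x) = -simpleRoot c := by
    rw [hx, reflRep_apply_inv_self, reflection_self]
  have hsy : M.reflection c (cs.reflRep hM (cs.wordProd v) y) = simpleRoot b := by
    rw [hy, key]
  have hsz : M.reflection c (cs.reflRep hM (cs.wordProd v) z) =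
      M.reflection b (simpleRoot a) := by rw [hz, key]
  obtain ⟨hm, rfl⟩ := eq_three_and_eq_of_sum_relation hM hab hbc (c := c) (by
    rw [← hsx, ← hsy, ← hsz]
    simp only [← map_add]
    rcases hsum with h | h | h
    · exact Or.inl (by rw [h])
    · exact Or.inr (Or.inl (by rw [h]))
    · exact Or.inr (Or.inr (by rw [h])))
  have hm' := (M.symmetric a b).trans hm
  refine ⟨u, v, a, b, hm', by simpa using hω, ?_⟩
  have h2 : M.reflection a (simpleRoot a + simpleRoot b) = simpleRoot b := by
    rw [map_add, reflection_self, reflection_of_eq_three hm']; abel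
  rw [reflection_of_eq_three hm, add_comm, h2] at hz
  rw [reflection_of_eq_three hm'] at hy
  rw [hT, braidRoots, hx, hy, hz]
  ext r
  simp only [Set.mem_insert_iff, Set.mem_singleton_iff]
  tauto

end CoxeterSystem

/-! ### Counting labels against disjoint blocks -/

open Classical in
/-- A list of labelled points has a family of disjoint blocks, each containing two points with the
same label. If there are just as many blocks as necessary for the number of labels, then points in
different blocks have different labels. -/
theorem List.label_dichotomy {J V : Type*} {L : List (J × V)} (hL : L.Nodup) {F : Set (Set V)}
    (hfin : F.Finite) (hdisj : ∀ T ∈ F, ∀ T' ∈ F, T ≠ T' → _root_.Disjoint T T')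
    (hF : ∀ T ∈ F, ∃ p ∈ L, ∃ q ∈ L, p ≠ q ∧ p.1 = q.1 ∧ p.2 ∈ T ∧ q.2 ∈ T)
    (hcard : (L.map Prod.fst).toFinset.card + F.ncard = L.length) {p q : J × V} (hp : p ∈ L)
    (hq : q ∈ L) (hpq : p.1 = q.1) :
    (p = q ∨ ∃ T ∈ F, p.2 ∈ T) ∧ ∀ T ∈ F, p.2 ∈ T → q.2 ∈ T := by
  have hF' : ∀ T, ∃ p q, T ∈ F → p ∈ L ∧ q ∈ L ∧ p ≠ q ∧ p.1 = q.1 ∧ p.2 ∈ T ∧ q.2 ∈ T := by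
    intro T
    by_cases hT : T ∈ F
    · obtain ⟨p, hp, q, hq, h⟩ := hF T hT
      exact ⟨p, q, fun _ => ⟨hp, hq, h⟩⟩
    · exact ⟨p, p, fun h => absurd h hT⟩
  choose f g hfg using hF'
  have huniq : ∀ T ∈ F, ∀ T' ∈ F, ∀ r, r ∈ T → r ∈ T' → T = T' := by
    intro T hT T' hT' r h h'
    by_contra hne
    exact Set.disjoint_left.1 (hdisj T hT T' hT' hne) h h'
  -- One point g T is removed from each block. The rest X still carries every label, since f T has
  -- the same label as g T. By the cardinality hypothesis X has as many points as there are labels,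
  -- so labels are injective on X.
  set G := hfin.toFinset.image g with hG
  have hGcard : G.card = F.ncard := by
    rw [Set.ncard_eq_toFinset_card F hfin, hG, Finset.card_image_of_injOn]
    intro T hT T' hT' h
    simp only [Set.Finite.coe_toFinset] at hT hT'
    have h1 := (hfg T hT).2.2.2.2.2
    rw [h] at h1
    exact huniq T hT T' hT' _ h1 (hfg T' hT').2.2.2.2.2
  have hGL : G ⊆ L.toFinset := by
    intro e he
    obtain ⟨T, hT, rfl⟩ := Finset.mem_image.1 he
    exact List.mem_toFinset.2 (hfg T (hfin.mem_toFinset.1 hT)).2.1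
  set X := L.toFinset \ G with hX
  have hrep : ∀ e ∈ L, ∃ e' ∈ X, e'.1 = e.1 ∧ (∀ T ∈ F, e.2 ∈ T ↔ e'.2 ∈ T) ∧
      (e' = e ∨ ∃ T ∈ F, e.2 ∈ T) := by
    intro e he
    by_cases heG : e ∈ G
    · obtain ⟨T, hT, rfl⟩ := Finset.mem_image.1 heG
      replace hT := hfin.mem_toFinset.1 hT
      obtain ⟨h1, h2, h3, h4, h5, h6⟩ := hfg T hT
      refine ⟨f T, ?_, h4, fun T' hT' => ?_, Or.inr ⟨T, hT, h6⟩⟩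
      · rw [hX, Finset.mem_sdiff]
        refine ⟨List.mem_toFinset.2 h1, fun hfG => ?_⟩
        obtain ⟨T', hT', h7⟩ := Finset.mem_image.1 hfG
        replace hT' := hfin.mem_toFinset.1 hT'
        have h8 := (hfg T' hT').2.2.2.2.2
        rw [h7] at h8
        obtain rfl := huniq T hT T' hT' _ h5 h8
        exact h3 h7.symm
      · constructor
        · intro h
          obtain rfl := huniq T hT T' hT' _ h6 h
          exact h5
        · intro h
          obtain rfl := huniq T hT T' hT' _ h5 h
          exact h6
    · exact ⟨e, Finset.mem_sdiff.2 ⟨List.mem_toFinset.2 he, heG⟩, rfl, fun _ _ => Iff.rfl,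
        Or.inl rfl⟩
  have himage : X.image Prod.fst = (L.map Prod.fst).toFinset := by
    ext a
    simp only [Finset.mem_image, List.mem_toFinset, List.mem_map]
    constructor
    · rintro ⟨e, he, rfl⟩
      exact ⟨e, List.mem_toFinset.1 (Finset.mem_sdiff.1 he).1, rfl⟩
    · rintro ⟨e, he, rfl⟩
      obtain ⟨e', he', h, -⟩ := hrep e he
      exact ⟨e', he', h⟩
  have hinj : Set.InjOn Prod.fst (X : Set (J × V)) := by
    rw [← Finset.card_image_iff, himage, hX, Finset.card_sdiff_of_subset hGL,
      List.toFinset_card_of_nodup hL]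
    omega
  obtain ⟨p', hp', hp1, hp2, hp3⟩ := hrep p hp
  obtain ⟨q', hq', hq1, hq2, hq3⟩ := hrep q hq
  have heq : p' = q' := hinj hp' hq' (by rw [hp1, hq1, hpq])
  subst heq
  refine ⟨?_, fun T hT h => (hq2 T hT).2 ((hp2 T hT).1 h)⟩
  rcases hp3 with rfl | hp3
  · rcases hq3 with rfl | ⟨T, hT, h⟩
    · exact Or.inl rfl
    · exact Or.inr ⟨T, hT, (hq2 T hT).1 h⟩
  · exact Or.inr hp3

/-! ### Contractible triples of freely braided elements -/

namespace CoxeterSystem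

open CoxeterMatrix List

variable {J : Type*} {M : CoxeterMatrix J} {W : Type*} [Group W]
  (hM : M.IsSimplyLaced) (cs : CoxeterSystem M W)

/-- The letters `a`, `b` form a long braid that occurs as a factor of a reduced expression. -/
def BraidRel (w : W) (a b : J) : Prop :=
  M a b = 3 ∧ ∃ u v, cs.IsReducedExpr (u ++ [a, b, a] ++ v) w

include hM in
theorem perm_letters {ω ω' : List J} {w : W} (h : cs.IsReducedExpr ω w)
    (h' : cs.IsReducedExpr ω' w) (a : J) : a ∈ ω ↔ a ∈ ω' := by
  refine IsReducedExpr.induction hM (P := fun η => a ∈ ω ↔ a ∈ η) ?_ h h' Iff.rfl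
  intro η η' _ hs hη
  rw [hη]
  cases hs <;> simp <;> tauto

include hM in
theorem supp_eq {ω : List J} {w : W} (h : cs.IsReducedExpr ω w) : cs.supp w = {a | a ∈ ω} := by
  ext a
  exact ⟨fun ⟨ω', h', ha⟩ => (cs.perm_letters hM h h' a).2 ha, fun ha => ⟨ω, h, ha⟩⟩

include hM in
open Classical in
theorem ncard_supp {ω : List J} {w : W} (h : cs.IsReducedExpr ω w) :
    (cs.supp w).ncard = ω.toFinset.card := by
  rw [cs.supp_eq hM h, ← Set.ncard_coe_finset]
  simp

theorem length_eq {ω : List J} {w : W} (h : cs.IsReducedExpr ω w) :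
    cs.length w = ω.length := by
  rw [← h.2, h.1.eq]

theorem exists_isReducedExpr (w : W) : ∃ ω, cs.IsReducedExpr ω w := by
  obtain ⟨ω, h, h'⟩ := cs.exists_isReduced w
  exact ⟨ω, h, h'.symm⟩

/-- Moves only permute the roots of a reduced word, so every triple is a subset of the roots of one
fixed word. -/
theorem finite_contractible (w : W) : {T | cs.IsContractible hM w T}.Finite := by
  obtain ⟨ω₀, h₀⟩ := cs.exists_isReducedExpr w
  have hmem : ∀ ω, cs.IsReducedExpr ω w → ∀ r, r ∈ (cs.rootList hM ω).map Prod.snd →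
      r ∈ (cs.rootList hM ω₀).map Prod.snd := by
    intro ω h r hr
    refine IsReducedExpr.induction hM
      (P := fun η => r ∈ (cs.rootList hM η).map Prod.snd) ?_ h h₀ hr
    intro η η' _ hs hη
    cases hs with
    | comm u v hst =>
      obtain ⟨U, V, x, y, h1, h2⟩ := cs.rootList_comm hM u v hst
      rw [h1] at hη
      rw [h2]
      simp only [map_append, map_cons, map_nil, mem_append, mem_cons] at hη ⊢
      tauto
    | braid u v hst =>
      obtain ⟨U, V, -, h1, h2⟩ := cs.rootList_braid hM u v hst
      rw [h1] at hη
      rw [h2]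
      simp only [map_append, map_cons, map_nil, mem_append, mem_cons] at hη ⊢
      tauto
  refine (Set.Finite.powerset (s := {r | r ∈ (cs.rootList hM ω₀).map Prod.snd})
    (List.finite_toSet _)).subset ?_
  rintro T ⟨-, ω, hω, x, y, z, hxyz, rfl⟩ r hr
  refine hmem ω hω r ?_
  rw [← mem_reverse, ← rootSeq_eq_reverse_map_rootList]
  refine hxyz.subset ?_
  simpa using hr

open Classical in
/-- The part of a labelled root sequence whose roots lie in a given set. -/
def rootListIn (T : Set (J →₀ ℝ)) (ω : List J) : List (J × (J →₀ ℝ)) :=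
  (cs.rootList hM ω).filter fun p => p.2 ∈ T

open Classical in
theorem filter_eq_of_nodup {A V : Type*} {U N L : List (A × V)} {T : Set V}
    (h : ((U ++ N ++ L).map Prod.snd).Nodup) (hN : ∀ r, r ∈ T ↔ r ∈ N.map Prod.snd) :
    (U ++ N ++ L).filter (fun p => p.2 ∈ T) = N := by
  simp only [map_append, append_assoc] at h
  rw [nodup_append', nodup_append'] at h
  obtain ⟨-, ⟨-, -, h1⟩, h2⟩ := h
  simp only [hN]
  have hU : U.filter (fun p => p.2 ∈ N.map Prod.snd) = [] := by
    rw [filter_eq_nil_iff]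
    intro p hp
    rw [decide_eq_true_eq]
    exact fun h => h2 (mem_map_of_mem hp) (mem_append_left _ h)
  have hL : L.filter (fun p => p.2 ∈ N.map Prod.snd) = [] := by
    rw [filter_eq_nil_iff]
    intro p hp
    rw [decide_eq_true_eq]
    exact fun h => h1 h (mem_map_of_mem hp)
  have hN : N.filter (fun p => p.2 ∈ N.map Prod.snd) = N := by
    rw [filter_eq_self]
    intro p hp
    rw [decide_eq_true_eq]
    exact mem_map_of_mem hp
  rw [filter_append, filter_append, hU, hL, hN, nil_append, append_nil]

/-- In a freely braided element the letters of a contractible triple are the same up to a braid move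
in all reduced expressions. -/
theorem IsFreelyBraided.exists_rootListIn {cs : CoxeterSystem M W} {w : W}
    (hw : cs.IsFreelyBraided hM w) {u v : List J} {s t : J} (hst : M s t = 3)
    (h₀ : cs.IsReducedExpr (u ++ [s, t, s] ++ v) w) {ω : List J} (hω : cs.IsReducedExpr ω w) :
    ∃ x y z, cs.rootListIn hM (cs.braidRoots hM v s t) ω = [(s, x), (t, y), (s, z)] ∨
      cs.rootListIn hM (cs.braidRoots hM v s t) ω = [(t, x), (s, y), (t, z)] := by
  classical
  have hT := cs.isContractible_braidRoots hM hst h₀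
  have hts := (M.symmetric t s).trans hst
  set T := cs.braidRoots hM v s t with hTdef
  have hbase : ∀ {a b : J} (u v : List J), M a b = 3 →
      cs.IsReducedExpr (u ++ [a, b, a] ++ v) w → T = cs.braidRoots hM v a b →
      ∃ x y z, cs.rootListIn hM T (u ++ [a, b, a] ++ v) = [(a, x), (b, y), (a, z)] := by
    intro a b u v hab hr hTab
    obtain ⟨U, V, -, h1, -⟩ := cs.rootList_braid hM u v hab
    have h2 := filter_eq_of_nodup (h1 ▸ cs.nodup_rootList hM hr.1) (T := T) (by
      rw [hTab, braidRoots]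
      intro r
      simp only [map_cons, map_nil, mem_cons, not_mem_nil, or_false]
      rfl)
    exact ⟨_, _, _, by rw [rootListIn, h1, h2]⟩
  refine IsReducedExpr.induction hM (P := fun ω => ∃ x y z,
      cs.rootListIn hM T ω = [(s, x), (t, y), (s, z)] ∨
      cs.rootListIn hM T ω = [(t, x), (s, y), (t, z)]) ?_ h₀ hω ?_
  · rintro η η' hη hs ⟨x, y, z, h⟩
    cases hs with
    | @comm u v a b hab =>
      refine ⟨x, y, z, ?_⟩
      obtain ⟨U, V, r, r', h1, h2⟩ := cs.rootList_comm hM u v hab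
      unfold rootListIn at h ⊢
      rw [h1] at h
      rw [h2]
      -- If both roots lay in T, the commuting letters a, b would be adjacent in sts or tst.
      by_cases hrr : r ∈ T ∧ r' ∈ T
      · exfalso
        simp only [filter_append, filter_cons, hrr, decide_true, if_true, filter_nil] at h
        have hba := (M.symmetric b a).trans hab
        generalize filter _ U = U' at h
        generalize filter _ V = V' at h
        have h' : U'.map Prod.fst ++ [a, b] ++ V'.map Prod.fst = [s, t, s] ∨
            U'.map Prod.fst ++ [a, b] ++ V'.map Prod.fst = [t, s, t] := by
          rcases h with h | h
          · exact Or.inl (by simpa using congrArg (List.map Prod.fst) h)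
          · exact Or.inr (by simpa using congrArg (List.map Prod.fst) h)
        have h'' : (a = s ∧ b = t) ∨ (a = t ∧ b = s) := by
          generalize U'.map Prod.fst = U'' at h'
          generalize V'.map Prod.fst = V'' at h'
          rcases U'' with _ | ⟨c, _ | ⟨d, U''⟩⟩
          · simp at h'
            tauto
          · simp at h'
            tauto
          · rcases h' with h' | h' <;> have := congrArg List.length h' <;> simp at this <;> omega
        rcases h'' with ⟨rfl, rfl⟩ | ⟨rfl, rfl⟩ <;> omega
      · convert h using 2 <;>
        · simp only [filter_append]
          congr 2
          simp only [filter_cons, filter_nil]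
          by_cases h3 : r ∈ T <;> by_cases h4 : r' ∈ T <;> simp_all
    | @braid u v a b hab =>
      have hba := (M.symmetric b a).trans hab
      -- A braid move on T itself exchanges the two forms. The triple of any other braid move is
      -- disjoint from T, as w is freely braided, so the filtered list does not change.
      by_cases hTT : T = cs.braidRoots hM v a b
      · obtain ⟨x', y', z', h1⟩ := hbase u v hab hη hTT
        obtain ⟨x'', y'', z'', h2⟩ := hbase u v hba (hη.of_braidStep (.braid u v hab)) (by
          rw [hTT, braidRoots, braidRoots, add_comm]
          ext r
          simp only [Set.mem_insert_iff, Set.mem_singleton_iff]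
          tauto)
        refine ⟨x'', y'', z'', ?_⟩
        rw [h2]
        rw [h1] at h
        simp only [cons.injEq, Prod.mk.injEq, and_true] at h ⊢
        tauto
      · refine ⟨x, y, z, ?_⟩
        have hd := hw _ _ hT (cs.isContractible_braidRoots hM hab hη) hTT
        obtain ⟨U, V, -, h1, h2⟩ := cs.rootList_braid hM u v hab
        have hn : ∀ r ∈ cs.braidRoots hM v a b, r ∉ T :=
          fun r hr hrT => Set.disjoint_left.1 hd hrT hr
        have hn1 := hn _ (Or.inl rfl)
        have hn2 := hn _ (Or.inr (Or.inl rfl))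
        have hn3 := hn _ (Or.inr (Or.inr rfl))
        unfold rootListIn at h ⊢
        rw [h1] at h
        rw [h2]
        simp only [filter_append, filter_cons, filter_nil, hn1, hn2, hn3, decide_false,
          Bool.false_eq_true, if_false] at h ⊢
        exact h
  · obtain ⟨x, y, z, h⟩ := hbase u v hst h₀ rfl
    exact ⟨x, y, z, Or.inl h⟩

end CoxeterSystem

/-! ### Content maximal elements are those with braided reduced expressions -/

namespace CoxeterSystem

open CoxeterMatrix List

variable {J : Type*} {M : CoxeterMatrix J} {W : Type*} [Group W]
  (hM : M.IsSimplyLaced) (cs : CoxeterSystem M W)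

variable {cs} in
theorem BraidRel.symm {w : W} {a b : J} (h : cs.BraidRel w a b) : cs.BraidRel w b a := by
  obtain ⟨h1, u, v, h2⟩ := h
  exact ⟨(M.symmetric b a).trans h1, u, v, h2.of_braidStep (.braid u v h1)⟩

include hM in
/-- The contractible triples of a content maximal element match letters in pairs. -/
theorem IsContentMaximal.isPaired {cs : CoxeterSystem M W} {w : W}
    (hw : cs.IsContentMaximal hM w) {ω : List J} (hω : cs.IsReducedExpr ω w) :
    M.IsPaired (cs.BraidRel w) ω := by
  classical
  obtain ⟨hfree, hcount⟩ := hw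
  have hfin := cs.finite_contractible hM w
  have hsndnd := cs.nodup_rootList hM hω.1
  have hnd := hsndnd.of_map
  have hmap := cs.map_fst_rootList hM ω
  have hmem : ∀ {T p}, p ∈ cs.rootListIn hM T ω ↔ p ∈ cs.rootList hM ω ∧ p.2 ∈ T := by
    intro T p
    simp [rootListIn]
  have hblock : ∀ s t, cs.BraidRel w s t → ∃ T, cs.IsContractible hM w T ∧ 
      ∃ x y z, cs.rootListIn hM T ω = [(s, x), (t, y), (s, z)] ∨
        cs.rootListIn hM T ω = [(t, x), (s, y), (t, z)] := fun s t ⟨hst, u, v, h₀⟩ =>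
    ⟨_, cs.isContractible_braidRoots hM hst h₀, hfree.exists_rootListIn hM hst h₀ hω⟩
  have hrel : ∀ T, cs.IsContractible hM w T → ∃ s t, cs.BraidRel w s t ∧ 
      ∃ x y z, cs.rootListIn hM T ω = [(s, x), (t, y), (s, z)] := by
    intro T hT
    obtain ⟨u, v, s, t, hst, h₀, rfl⟩ := hT.exists_eq_braidRoots
    have hR : cs.BraidRel w s t := ⟨hst, u, v, h₀⟩
    obtain ⟨x, y, z, h | h⟩ := hfree.exists_rootListIn hM hst h₀ hω
    · exact ⟨s, t, hR, x, y, z, h⟩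
    · exact ⟨t, s, hR.symm, x, y, z, h⟩
  -- The blocks are the contractible triples, each with two roots of the same letter. The
  -- cardinality hypothesis of `List.label_dichotomy` is #supp(w) = ℓ(w) − N(w).
  have hlab := fun {p q} => List.label_dichotomy (p := p) (q := q) hnd hfin
    (fun T hT T' hT' => hfree T T' hT hT') (fun T hT => by
      obtain ⟨s, t, -, x, y, z, h⟩ := hrel T hT
      have h1 : (s, x) ∈ cs.rootListIn hM T ω := by simp [h]
      have h2 : (s, z) ∈ cs.rootListIn hM T ω := by simp [h]
      have h3 : (cs.rootListIn hM T ω).Nodup := hnd.filter _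
      rw [h] at h3
      refine ⟨_, (hmem.1 h1).1, _, (hmem.1 h2).1, fun h4 => ?_, rfl, (hmem.1 h1).2, (hmem.1 h2).2⟩
      rw [h4] at h3
      simp at h3) (by
      rw [hmap, length_rootList]
      rw [cs.ncard_supp hM hω, cs.length_eq hω, numContractible] at hcount
      omega)
  have hpair : ∀ {a b}, cs.BraidRel w a b → ∃ T, cs.IsContractible hM w T ∧
      (∃ e ∈ cs.rootList hM ω, e.1 = a ∧ e.2 ∈ T) ∧ (∃ e ∈ cs.rootList hM ω, e.1 = b ∧ e.2 ∈ T) ∧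
      (∀ p ∈ cs.rootList hM ω, p.2 ∈ T → p.1 = a ∨ p.1 = b) ∧
      ((cs.rootListIn hM T ω).map Prod.fst = [a, b, a] ∨
        (cs.rootListIn hM T ω).map Prod.fst = [b, a, b]) := by
    intro a b hab
    obtain ⟨T, hT, x, y, z, h⟩ := hblock a b hab
    refine ⟨T, hT, ?_, ?_, fun p hp hpT => ?_, ?_⟩
    · rcases h with h | h
      · have h1 : (a, x) ∈ cs.rootListIn hM T ω := by simp [h]
        exact ⟨_, (hmem.1 h1).1, rfl, (hmem.1 h1).2⟩
      · have h1 : (a, y) ∈ cs.rootListIn hM T ω := by simp [h]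
        exact ⟨_, (hmem.1 h1).1, rfl, (hmem.1 h1).2⟩
    · rcases h with h | h
      · have h1 : (b, y) ∈ cs.rootListIn hM T ω := by simp [h]
        exact ⟨_, (hmem.1 h1).1, rfl, (hmem.1 h1).2⟩
      · have h1 : (b, x) ∈ cs.rootListIn hM T ω := by simp [h]
        exact ⟨_, (hmem.1 h1).1, rfl, (hmem.1 h1).2⟩
    · have := hmem.2 ⟨hp, hpT⟩
      rcases h with h | h <;> rw [h] at this <;>
        rcases (by simpa using this : p = _ ∨ p = _ ∨ p = _) with rfl | rfl | rfl <;> simp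
    · rcases h with h | h <;> simp [h]
  refine ⟨BraidRel.symm, ?_, fun h => h.1, ?_, ?_⟩
  · intro a b c hab hac
    obtain ⟨T, hT, ⟨e, he, hea, heT⟩, ⟨f, hf, hfb, hfT⟩, -, -⟩ := hpair hab
    obtain ⟨T', hT', ⟨e', he', hea', heT'⟩, -, h', -⟩ := hpair hac
    -- Both blocks contain a root of the letter a. Roots with equal letters lie in the same block,
    -- so the blocks coincide.
    have h1 := (hlab he' he (hea'.trans hea.symm)).2 T' hT' heT'
    obtain rfl : T = T' := by
      by_contra hne
      exact Set.disjoint_left.1 (hfree T T' hT hT' hne) heT h1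
    have hne := ne_of_eq_three hab.1
    rcases h' f hf hfT with h2 | h2
    · exact absurd (h2.symm.trans hfb) hne
    · exact hfb.symm.trans h2
  · intro a b hab
    obtain ⟨T, hT, ⟨e, he, hea, heT⟩, ⟨f, hf, hfb, hfT⟩, h, h'⟩ := hpair hab
    -- All occurrences of a and b have their roots in T, so selecting by letters and selecting by
    -- roots agree.
    have : ω.restrictPair a b = (cs.rootListIn hM T ω).map Prod.fst := by
      conv_lhs => rw [← hmap]
      unfold restrictPair rootListIn
      rw [filter_map]
      congr 1
      apply filter_congr
      intro p hp
      simp only [Function.comp_apply, decide_eq_decide]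
      refine ⟨?_, h p hp⟩
      rintro (h1 | h1)
      · exact (hlab he hp (hea.trans h1.symm)).2 T hT heT
      · exact (hlab hf hp (hfb.trans h1.symm)).2 T hT hfT
    rwa [this]
  · intro a ha
    rw [← hmap] at ha
    obtain ⟨l', hl', h⟩ := sublist_map_iff.1 ha
    obtain ⟨e, l₁, rfl, hea, h⟩ := map_eq_cons_iff.1 h.symm
    obtain ⟨f, l₂, rfl, hfa, h⟩ := map_eq_cons_iff.1 h
    have he : e ∈ cs.rootList hM ω := hl'.subset (by simp)
    have hf : f ∈ cs.rootList hM ω := hl'.subset (by simp)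
    have hef : e ≠ f := by
      rintro rfl
      have := hl'.nodup hnd
      simp at this
    obtain ⟨T, hT, heT⟩ := (hlab he hf (hea.trans hfa.symm)).1.resolve_left hef
    obtain ⟨s, t, hR, x, y, z, h⟩ := hrel T hT
    have h1 := hmem.2 ⟨he, heT⟩
    rw [h] at h1
    rcases (by simpa using h1 : e = _ ∨ e = _ ∨ e = _) with rfl | rfl | rfl
    · exact ⟨t, hea ▸ hR⟩
    · exact ⟨s, hea ▸ hR.symm⟩
    · exact ⟨t, hea ▸ hR⟩

theorem _root_.CoxeterMatrix.IsPaired.rel_of_braidRel (hM : M.IsSimplyLaced)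
    {cs : CoxeterSystem M W} {w : W} {ω : List J} {R : J → J → Prop} (h : M.IsPaired R ω)
    (hω : cs.IsReducedExpr ω w) {a b : J} (hab : cs.BraidRel w a b) : R a b := by
  obtain ⟨h3, u, v, h0⟩ := hab
  exact (IsReducedExpr.induction hM (P := fun η => M.IsPaired R η)
    (fun _ _ _ hs hη => hη.of_braidStep hs) hω h0 h).rel_of_infix h3 |>.1

include hM in
/-- Every reduced expression of a content maximal element is braided. -/
theorem IsContentMaximal.isBraided {cs : CoxeterSystem M W} {w : W}
    (hw : cs.IsContentMaximal hM w) {ω : List J} (hω : cs.IsReducedExpr ω w) :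
    M.IsBraided (cs.BraidRel w) ω := by
  classical
  have hp := hw.isPaired hM hω
  refine ⟨hp, fun {c x} hcx => ?_⟩
  have hdup : [c, c] <+ [c, x, c] := by simp
  by_contra hcon
  rw [not_or] at hcon
  have hne : c ≠ x := by
    rintro rfl
    have h3 := replicate_sublist_iff.1 (show replicate 3 c <+ ω from hcx)
    have := hp.count_le_two c
    omega
  have h3 := (hM c x hne).resolve_left hcon.1
  -- In an expression with the factor cdc, where d is the partner of c, the letter x would still be
  -- enclosed by the two occurrences of c, so x = d.
  obtain ⟨d, hd⟩ := hp.exists_of_dup (hdup.trans hcx)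
  obtain ⟨hcd, u, v, h0⟩ := hd
  have hQ := IsReducedExpr.induction hM (P := fun η => [c, x, c] <+ η)
    (fun η η' hη hs h => (hw.isPaired hM hη).sublist_of_braidStep hs h3 hcon.2 h) hω h0 hcx
  obtain ⟨h1, h2, h4⟩ := (hw.isPaired hM h0).rel_of_infix hcd
  rw [append_assoc] at hQ
  have h5 := Sublist.of_append_of_last_notMem (l := [c, x]) h4.1
    (Sublist.of_append_of_head_notMem h2.1 hQ)
  have h6 := h5.eq_of_length rfl
  simp only [nil_append, cons_append, cons.injEq, and_true, true_and] at h6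
  exact hcon.2 (h6 ▸ h1)

theorem wordProd_mul_simple_comm {u : List J} {s : J} (h : ∀ x ∈ u, M s x = 2) :
    cs.wordProd u * cs.simple s = cs.simple s * cs.wordProd u := by
  induction u with
  | nil => simp
  | cons x u ih =>
    rw [wordProd_cons, mul_assoc, ih fun y hy => h y (mem_cons_of_mem x hy), ← mul_assoc,
      ← cs.simple_mul_comm (h x mem_cons_self), mul_assoc]

variable {cs} in
theorem IsReducedExpr.of_wordProd_eq {ω ω' : List J} {w : W} (h : cs.IsReducedExpr ω w)
    (hl : ω'.length = ω.length) (hp : cs.wordProd ω' = cs.wordProd ω) : cs.IsReducedExpr ω' w :=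
  ⟨by unfold IsReduced; rw [hp, hl]; exact h.1, hp.trans h.2⟩

/-- The letters of a pair can be brought together. -/
theorem _root_.CoxeterMatrix.IsBraided.braidRel {cs : CoxeterSystem M W} {w : W} {ω : List J}
    {R : J → J → Prop} (h : M.IsBraided R ω) (hω : cs.IsReducedExpr ω w) {a b : J} (hab : R a b) :
    cs.BraidRel w a b := by
  wlog hdup : [a, a] <+ ω generalizing a b
  · refine (this (h.symm hab) ?_).symm
    rcases h.restrict hab with hr | hr
    · exact absurd ((by simp [hr] : [a, a] <+ ω.restrictPair a b).trans
        (restrictPair_sublist a b ω)) hdup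
    · exact (by simp [hr] : [b, b] <+ ω.restrictPair a b).trans (restrictPair_sublist a b ω)
  obtain ⟨u₁, u₂, u₃, u₄, rfl, h1, h2, h3, h4⟩ := h.exists_eq_of_dup hdup hab
  -- Apart from b, all letters between the two occurrences of a commute with a, so both occurrences
  -- can be moved next to b.
  have hcomm : ∀ x, x ≠ b → [a, x, a] <+ u₁ ++ a :: u₂ ++ b :: u₃ ++ a :: u₄ → M a x = 2 :=
    fun x hx hs => (h.eq_two_or hs).resolve_right fun hR => hx (h.unique hR hab)
  have hc2 := cs.wordProd_mul_simple_comm (u := u₂) (s := a) fun x hx =>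
    hcomm x (by rintro rfl; exact h2.2 hx) (by
      have : [a, x, a] <+ [] ++ a :: [x] ++ [] ++ a :: [] := by simp
      exact this.trans (((((nil_sublist _).append ((singleton_sublist.2 hx).cons_cons a)).append
        (nil_sublist _)).append ((nil_sublist _).cons_cons a))))
  have hc3 := cs.wordProd_mul_simple_comm (u := u₃) (s := a) fun x hx =>
    hcomm x (by rintro rfl; exact h3.2 hx) (by
      have : [a, x, a] <+ [] ++ a :: [] ++ [x] ++ a :: [] := by simp
      exact this.trans (((((nil_sublist _).append ((nil_sublist _).cons_cons a)).append
        ((singleton_sublist.2 hx).cons b)).append ((nil_sublist _).cons_cons a))))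
  refine ⟨h.bond hab, u₁ ++ u₂, u₃ ++ u₄, hω.of_wordProd_eq (by simp; omega) ?_⟩
  simp only [wordProd_append, wordProd_cons, wordProd_nil, mul_one]
  calc cs.wordProd u₁ * cs.wordProd u₂ * (cs.simple a * (cs.simple b * cs.simple a)) *
        (cs.wordProd u₃ * cs.wordProd u₄)
      = cs.wordProd u₁ * (cs.wordProd u₂ * cs.simple a) * cs.simple b *
          (cs.simple a * cs.wordProd u₃) * cs.wordProd u₄ := by simp only [mul_assoc]
    _ = _ := by rw [hc2, ← hc3]; simp only [mul_assoc]

/-- The roots of the letters `s` and `t` in a word. -/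
def rootsOf (ω : List J) (s t : J) : Set (J →₀ ℝ) :=
  {r | ∃ p ∈ cs.rootList hM ω, p.2 = r ∧ (p.1 = s ∨ p.1 = t)}

/-- A long braid move reverses the roots of a single pair, and {s, t} either is this pair or is
disjoint from it. -/
theorem rootsOf_eq_of_braidStep {η η' : List J} {R : J → J → Prop} (h : M.IsPaired R η)
    (hs : M.BraidStep η η') {s t : J} (hst : R s t) :
    cs.rootsOf hM η' s t = cs.rootsOf hM η s t := by
  cases hs with
  | @comm u v a b hab =>
    obtain ⟨U, V, r, r', h1, h2⟩ := cs.rootList_comm hM u v hab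
    ext x
    simp only [rootsOf, h1, h2, mem_append, mem_cons, not_mem_nil, or_false]
    refine exists_congr fun p => and_congr_left' ?_
    tauto
  | @braid u v a b hab =>
    obtain ⟨U, V, -, h1, h2⟩ := cs.rootList_braid hM u v hab
    have hR := (h.rel_of_infix hab).1
    have hiff : (a = s ∨ a = t) ↔ (b = s ∨ b = t) := by
      constructor
      · rintro (rfl | rfl)
        · exact Or.inr (h.unique hR hst)
        · exact Or.inl (h.unique hR (h.symm hst))
      · rintro (rfl | rfl)
        · exact Or.inr (h.unique (h.symm hR) hst)
        · exact Or.inl (h.unique (h.symm hR) (h.symm hst))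
    have aux : ∀ (x y z : J →₀ ℝ) (a b : J), ((a = s ∨ a = t) ↔ (b = s ∨ b = t)) → ∀ r,
        (∃ p ∈ U ++ [(a, x), (b, y), (a, z)] ++ V, p.2 = r ∧ (p.1 = s ∨ p.1 = t)) →
        ∃ p ∈ U ++ [(b, z), (a, y), (b, x)] ++ V, p.2 = r ∧ (p.1 = s ∨ p.1 = t) := by
      rintro x y z a b hab r ⟨p, hp, hpr, hp'⟩
      simp only [mem_append, mem_cons, not_mem_nil, or_false] at hp
      rcases hp with (hp | rfl | rfl | rfl) | hp
      · exact ⟨p, by simp [hp], hpr, hp'⟩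
      · exact ⟨(b, x), by simp, hpr, hab.1 hp'⟩
      · exact ⟨(a, y), by simp, hpr, hab.2 hp'⟩
      · exact ⟨(b, z), by simp, hpr, hab.1 hp'⟩
      · exact ⟨p, by simp [hp], hpr, hp'⟩
    ext x
    rw [rootsOf, rootsOf, h1, h2]
    exact ⟨aux _ _ _ _ _ hiff.symm x, aux _ _ _ _ _ hiff x⟩

theorem rootsOf_eq_braidRoots {u v : List J} {s t : J} (h : M s t = 3)
    (hu : s ∉ u ∧ t ∉ u) (hv : s ∉ v ∧ t ∉ v) :
    cs.rootsOf hM (u ++ [s, t, s] ++ v) s t = cs.braidRoots hM v s t := by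
  obtain ⟨U, V, ⟨hU, hV⟩, h1, -⟩ := cs.rootList_braid hM u v h
  have hmem : ∀ (L : List (J × (J →₀ ℝ))), (s ∉ L.map Prod.fst ∧ t ∉ L.map Prod.fst) →
      ∀ p ∈ L, ¬ (p.1 = s ∨ p.1 = t) := by
    rintro L ⟨hs, ht⟩ p hp (rfl | rfl)
    · exact hs (mem_map_of_mem hp)
    · exact ht (mem_map_of_mem hp)
  rw [← hU] at hu
  rw [← hV] at hv
  ext r
  simp only [rootsOf, h1, mem_append, mem_cons, not_mem_nil, or_false]
  constructor
  · rintro ⟨p, (hp | rfl | rfl | rfl) | hp, rfl, hst⟩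
    · exact absurd hst (hmem U hu p hp)
    · exact Or.inl rfl
    · exact Or.inr (Or.inl rfl)
    · exact Or.inr (Or.inr rfl)
    · exact absurd hst (hmem V hv p hp)
  · rintro (rfl | rfl | rfl)
    · exact ⟨(s, _), by simp, rfl, by simp⟩
    · exact ⟨(t, _), by simp, rfl, by simp⟩
    · exact ⟨(s, _), by simp, rfl, by simp⟩

/-- By invariance under moves, every contractible triple can be read off one fixed word as the root
set of a pair. -/
theorem _root_.CoxeterMatrix.IsPaired.braidRoots_eq {cs : CoxeterSystem M W} {w : W} {ω : List J}
    {R : J → J → Prop} (h : M.IsPaired R ω) (hω : cs.IsReducedExpr ω w) {u v : List J} {s t : J}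
    (hst : M s t = 3) (h₀ : cs.IsReducedExpr (u ++ [s, t, s] ++ v) w) :
    R s t ∧ cs.braidRoots hM v s t = cs.rootsOf hM ω s t := by
  have hP : ∀ η, cs.IsReducedExpr η w → M.IsPaired R η := fun η hη =>
    IsReducedExpr.induction hM (P := fun η => M.IsPaired R η)
      (fun _ _ _ hs hη => hη.of_braidStep hs) hω hη h
  obtain ⟨hR, hu, hv⟩ := (hP _ h₀).rel_of_infix hst
  refine ⟨hR, ?_⟩
  rw [← cs.rootsOf_eq_braidRoots hM hst hu hv]
  exact IsReducedExpr.induction hM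
    (P := fun η => cs.rootsOf hM (u ++ [s, t, s] ++ v) s t = cs.rootsOf hM η s t)
    (fun η η' hη hs hη' => hη'.trans (cs.rootsOf_eq_of_braidStep hM (hP η hη) hs hR).symm)
    h₀ hω rfl

open Classical in
theorem _root_.CoxeterMatrix.IsPaired.length_eq {ω : List J} {R : J → J → Prop}
    (h : M.IsPaired R ω) :
    ω.length = ω.toFinset.card + (ω.toFinset.filter fun a => [a, a] <+ ω).card := by
  rw [← sum_toFinset_count_eq_length, Finset.card_filter, Finset.card_eq_sum_ones,
    ← Finset.sum_add_distrib]
  refine Finset.sum_congr rfl fun a ha => ?_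
  have h1 := h.count_le_two a
  have h2 : 0 < ω.count a := count_pos_iff.2 (mem_toFinset.1 ha)
  simp only [pair_sublist_iff_two_le_count]
  split_ifs <;> omega

theorem _root_.CoxeterMatrix.IsPaired.not_dup {ω : List J} {R : J → J → Prop}
    (h : M.IsPaired R ω) {a b : J} (hab : R a b) (ha : [a, a] <+ ω) (hb : [b, b] <+ ω) : False := by
  have hne := ne_of_eq_three (h.bond hab)
  classical
  rw [← sublist_restrictPair_iff (a := a) (b := b) (by simp),
    pair_sublist_iff_two_le_count] at ha hb
  rcases h.restrict hab with hr | hr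
  · simp [hr, hne] at hb
  · simp [hr, hne.symm] at ha

/-- Elements with a braided reduced expression are content maximal. -/
theorem _root_.CoxeterMatrix.IsBraided.isContentMaximal {cs : CoxeterSystem M W} {w : W}
    {ω : List J} {R : J → J → Prop} (h : M.IsBraided R ω) (hω : cs.IsReducedExpr ω w) :
    cs.IsContentMaximal hM w := by
  classical
  have hcontr : ∀ T, cs.IsContractible hM w T ↔ ∃ s t, R s t ∧ T = cs.rootsOf hM ω s t := by
    intro T
    constructor
    · intro hT
      obtain ⟨u, v, s, t, hst, h₀, rfl⟩ := hT.exists_eq_braidRoots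
      exact ⟨s, t, h.toIsPaired.braidRoots_eq hM hω hst h₀⟩
    · rintro ⟨s, t, hR, rfl⟩
      obtain ⟨hst, u, v, h₀⟩ := h.braidRel hω hR
      rw [← (h.toIsPaired.braidRoots_eq hM hω hst h₀).2]
      exact cs.isContractible_braidRoots hM hst h₀
  have hcomm : ∀ s t, cs.rootsOf hM ω s t = cs.rootsOf hM ω t s := by
    intro s t
    simp only [rootsOf, or_comm]
  have hmeet : ∀ {r s t s' t'}, R s t → R s' t' → r ∈ cs.rootsOf hM ω s t →
      r ∈ cs.rootsOf hM ω s' t' → (s = s' ∧ t = t') ∨ (s = t' ∧ t = s') := by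
    rintro r s t s' t' hst hst' ⟨p, hp, hpr, hp1⟩ ⟨q, hq, hqr, hq1⟩
    obtain rfl := cs.eq_of_mem_rootList hM hω.1 hp hq (hpr.trans hqr.symm)
    rcases hp1 with hp1 | hp1 <;> rcases hq1 with hq1 | hq1 <;> rw [hp1] at hq1 <;> subst hq1
    · exact Or.inl ⟨rfl, h.unique hst hst'⟩
    · exact Or.inr ⟨rfl, h.unique hst (h.symm hst')⟩
    · exact Or.inr ⟨h.unique (h.symm hst) hst', rfl⟩
    · exact Or.inl ⟨h.unique (h.symm hst) (h.symm hst'), rfl⟩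
  have hnonempty : ∀ {s t}, R s t → ∃ r, r ∈ cs.rootsOf hM ω s t := by
    intro s t hst
    have hs := h.mem_of_rel hst
    rw [← cs.map_fst_rootList hM ω] at hs
    obtain ⟨p, hp, hps⟩ := mem_map.1 hs
    exact ⟨p.2, p, hp, rfl, Or.inl hps⟩
  constructor
  · intro T T' hT hT' hne
    obtain ⟨s, t, hst, rfl⟩ := (hcontr T).1 hT
    obtain ⟨s', t', hst', rfl⟩ := (hcontr T').1 hT'
    rw [Set.disjoint_left]
    intro r hr hr'
    rcases hmeet hst hst' hr hr' with ⟨rfl, rfl⟩ | ⟨rfl, rfl⟩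
    · exact hne rfl
    · exact hne (hcomm _ _)
  · rw [cs.ncard_supp hM hω, cs.length_eq hω, h.toIsPaired.length_eq, numContractible]
    have : {T | cs.IsContractible hM w T}.ncard =
        (ω.toFinset.filter fun a => [a, a] <+ ω).card := by
      rw [← Set.ncard_coe_finset]
      have hpart : ∀ a, ∃ b, [a, a] <+ ω → R a b := by
        intro a
        by_cases ha : [a, a] <+ ω
        · obtain ⟨b, hb⟩ := h.exists_of_dup ha
          exact ⟨b, fun _ => hb⟩
        · exact ⟨a, fun h => absurd h ha⟩
      choose f hf using hpart
      symm
      -- Exactly one letter of each pair is repeated in ω, so the repeated letters enumerate the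
      -- triples; f chooses the partner.
      refine Set.ncard_congr (fun a _ => cs.rootsOf hM ω a (f a)) ?_ ?_ ?_
      · intro a ha
        simp only [Finset.coe_filter, mem_toFinset] at ha
        exact (hcontr _).2 ⟨a, f a, hf a ha.2, rfl⟩
      · intro a b ha hb hab
        simp only [Finset.coe_filter, mem_toFinset] at ha hb
        obtain ⟨r, hr⟩ := hnonempty (hf a ha.2)
        have hr' := hr
        rw [hab] at hr'
        rcases hmeet (hf a ha.2) (hf b hb.2) hr hr' with h1 | h1
        · exact h1.1
        · exact (h.toIsPaired.not_dup (hf a ha.2) ha.2 (h1.2 ▸ hb.2)).elim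
      · intro T hT
        obtain ⟨s, t, hst, rfl⟩ := (hcontr T).1 hT
        have hmk : ∀ {s t}, R s t → [s, s] <+ ω → ∃ a, ∃ _ : a ∈ (↑(ω.toFinset.filter
            fun a => [a, a] <+ ω) : Set J), cs.rootsOf hM ω a (f a) = cs.rootsOf hM ω s t := by
          intro s t hst hs
          refine ⟨s, ?_, by rw [h.unique (hf s hs) hst]⟩
          simp only [Finset.coe_filter, mem_toFinset]
          exact ⟨hs.subset (by simp), hs⟩
        rcases h.restrict hst with hr | hr
        · exact hmk hst ((by simp [hr] : [s, s] <+ ω.restrictPair s t).trans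
            (restrictPair_sublist s t ω))
        · rw [hcomm s t]
          exact hmk (h.symm hst) ((by simp [hr] : [t, t] <+ ω.restrictPair s t).trans
            (restrictPair_sublist s t ω))
    rw [this]
    push_cast
    ring

end CoxeterSystem

/-! ### Operations on braided words; estimates for the Coxeter form -/

namespace CoxeterMatrix

open List

variable {J : Type*} {M : CoxeterMatrix J} {R : J → J → Prop} {ω : List J}

theorem _root_.List.restrictPair_reverse (a b : J) (l : List J) :
    l.reverse.restrictPair a b = (l.restrictPair a b).reverse := filter_reverse

theorem IsBraided.reverse (h : M.IsBraided R ω) : M.IsBraided R ω.reverse where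
  symm := h.symm
  unique := h.unique
  bond := h.bond
  restrict hab := by
    rw [restrictPair_reverse]
    rcases h.restrict hab with hr | hr <;> simp [hr]
  exists_of_dup ha := h.exists_of_dup (by simpa using ha.reverse)
  eq_two_or hc := h.eq_two_or (by simpa using hc.reverse)

/-- Removing all occurrences of a union of pairs and unmatched letters keeps a word braided. -/
theorem IsBraided.of_sublist (h : M.IsBraided R ω) {η : List J} (hη : η <+ ω) (P : J → Prop)
    (hP : ∀ a b, R a b → P a → P b)
    (hr : ∀ a b, P a → P b → η.restrictPair a b = ω.restrictPair a b) (hmem : ∀ x ∈ η, P x) :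
    M.IsBraided (fun a b => R a b ∧ P a) η where
  symm hab := ⟨h.symm hab.1, hP _ _ hab.1 hab.2⟩
  unique hab hac := h.unique hab.1 hac.1
  bond hab := h.bond hab.1
  restrict {a b} hab := by
    rw [hr a b hab.2 (hP _ _ hab.1 hab.2)]
    exact h.restrict hab.1
  exists_of_dup {a} ha := by
    obtain ⟨b, hb⟩ := h.exists_of_dup (ha.trans hη)
    exact ⟨b, hb, hmem a (ha.subset (by simp))⟩
  eq_two_or {c x} hc := (h.eq_two_or (hc.trans hη)).imp_right fun hR =>
    ⟨hR, hmem c (hc.subset (by simp))⟩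

/-- Meant for a factor k that is an unmatched letter or the long braid of a pair: its removal breaks
no other pair. -/
theorem IsBraided.exists_delete {u k v : List J} (h : M.IsBraided R (u ++ k ++ v))
    (hk : ∀ a ∈ k, a ∉ u ∧ a ∉ v) (hR : ∀ a b, R a b → b ∈ k → a ∈ k) :
    ∃ R', M.IsBraided R' (u ++ v) := by
  refine ⟨_, h.of_sublist (η := u ++ v) ?_ (fun a => a ∉ k) ?_ ?_ ?_⟩
  · rw [append_assoc]
    exact (sublist_append_right k v).append_left u
  · exact fun a b hab ha hb => ha (hR a b hab hb)
  · intro a b ha hb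
    rw [restrictPair_append, restrictPair_append, restrictPair_append,
      restrictPair_eq_nil_iff.2 ⟨ha, hb⟩, append_nil]
  · intro x hx hxk
    rcases mem_append.1 hx with hx | hx
    · exact (hk x hxk).1 hx
    · exact (hk x hxk).2 hx

theorem IsBraided.cons (h : M.IsBraided R ω) {x : J} (hx : x ∉ ω) : M.IsBraided R (x :: ω) where
  symm := h.symm
  unique := h.unique
  bond := h.bond
  restrict {a b} hab := by
    have ha : x ≠ a := fun e => hx (e ▸ h.mem_of_rel hab)
    have hb : x ≠ b := fun e => hx (e ▸ h.mem_of_rel (h.symm hab))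
    rw [restrictPair_cons_of_ne ha hb]
    exact h.restrict hab
  exists_of_dup {a} ha := by
    rcases ha with _ | ha | ha
    · exact h.exists_of_dup ‹_›
    · exact absurd (singleton_sublist.1 ‹_›) hx
  eq_two_or {c y} hc := by
    rcases hc with _ | hc | hc
    · exact h.eq_two_or ‹_›
    · rename_i hc
      exact absurd (hc.subset (by simp)) hx

theorem IsBraided.cons_braid (h : M.IsBraided R ω) {s t : J} (hst : M s t = 3) (hs : s ∉ ω)
    (ht : t ∉ ω) : M.IsBraided (fun a b => R a b ∨ (a = s ∧ b = t) ∨ (a = t ∧ b = s))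
      ([s, t, s] ++ ω) := by
  have hne := ne_of_eq_three hst
  have hRs : ∀ {a b}, R a b → a ≠ s ∧ a ≠ t ∧ b ≠ s ∧ b ≠ t := by
    intro a b hab
    have ha := h.mem_of_rel hab
    have hb := h.mem_of_rel (h.symm hab)
    refine ⟨?_, ?_, ?_, ?_⟩ <;> rintro rfl <;> contradiction
  have hst' : ([s, t, s] ++ ω).restrictPair s t = [s, t, s] := by
    rw [restrictPair_append, restrictPair_eq_nil_iff.2 ⟨hs, ht⟩]
    simp [restrictPair]
  constructor
  · constructor
    · rintro a b (hab | hab | hab)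
      · exact Or.inl (h.symm hab)
      · exact Or.inr (Or.inr ⟨hab.2, hab.1⟩)
      · exact Or.inr (Or.inl ⟨hab.2, hab.1⟩)
    · rintro a b c (hab | ⟨rfl, rfl⟩ | ⟨rfl, rfl⟩) (hac | ⟨h1, h2⟩ | ⟨h1, h2⟩)
      · exact h.unique hab hac
      · exact absurd h1 (hRs hab).1
      · exact absurd h1 (hRs hab).2.1
      · exact absurd rfl (hRs hac).1
      · exact h2.symm
      · exact absurd h1 hne
      · exact absurd rfl (hRs hac).2.1
      · exact absurd h1.symm hne
      · exact h2.symm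
    · rintro a b (hab | ⟨rfl, rfl⟩ | ⟨rfl, rfl⟩)
      · exact h.bond hab
      · exact hst
      · exact (M.symmetric _ _).trans hst
    · rintro a b (hab | ⟨rfl, rfl⟩ | ⟨rfl, rfl⟩)
      · obtain ⟨h1, h2, h3, h4⟩ := hRs hab
        rw [restrictPair_append, restrictPair_eq_nil_iff.2
          ⟨by simp [h1, h2], by simp [h3, h4]⟩]
        exact h.restrict hab
      · exact Or.inl hst'
      · rw [restrictPair_comm]
        exact Or.inr hst'
    · intro a ha
      by_cases has : a = s
      · exact ⟨t, Or.inr (Or.inl ⟨has, rfl⟩)⟩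
      by_cases hat : a = t
      · exact ⟨s, Or.inr (Or.inr ⟨hat, rfl⟩)⟩
      obtain ⟨b, hb⟩ := h.exists_of_dup (ha.of_append_of_head_notMem (by simp [has, hat]))
      exact ⟨b, Or.inl hb⟩
  · intro c x hc
    by_cases hcs : c = s
    · subst hcs
      have h1 := Sublist.of_append_of_last_notMem (l := [c, x]) hs hc
      have h2 := h1.eq_of_length rfl
      simp only [nil_append, cons_append, cons.injEq, and_true, true_and] at h2
      exact Or.inr (Or.inr (Or.inl ⟨rfl, h2⟩))
    by_cases hct : c = t
    · subst hct
      have h1 := Sublist.of_append_of_last_notMem (l := [c, x]) ht hc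
      have h2 := h1.eq_of_length rfl
      simp only [nil_append, cons_append, cons.injEq] at h2
      exact absurd h2.1 hcs
    exact (h.eq_two_or (hc.of_append_of_head_notMem (by simp [hcs, hct]))).imp_right Or.inl

variable {J' : Type*} {M' : CoxeterMatrix J'} {f : J → J'}

theorem _root_.List.restrictPair_map (hf : Function.Injective f) (a b : J) (l : List J) :
    (l.map f).restrictPair (f a) (f b) = (l.restrictPair a b).map f := by
  unfold restrictPair
  rw [filter_map]
  congr 1
  refine filter_congr fun x _ => ?_
  simp [hf.eq_iff]

theorem _root_.List.map_sublist_map_iff_of_injective (hf : Function.Injective f) {k l : List J} :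
    k.map f <+ l.map f ↔ k <+ l := by
  refine ⟨fun h => ?_, fun h => h.map f⟩
  obtain ⟨l', hl', h'⟩ := sublist_map_iff.1 h
  rwa [map_injective_iff.2 hf h']

theorem IsBraided.map (h : M.IsBraided R ω) (hf : Function.Injective f)
    (hM : ∀ a b, M' (f a) (f b) = M a b) :
    M'.IsBraided (fun x y => ∃ a b, x = f a ∧ y = f b ∧ R a b) (ω.map f) := by
  have hmem : ∀ {y k}, k <+ ω.map f → y ∈ k → ∃ a, f a = y := fun hk hy => by
    obtain ⟨a, -, ha⟩ := mem_map.1 (hk.subset hy)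
    exact ⟨a, ha⟩
  constructor
  · constructor
    · rintro x y ⟨a, b, rfl, rfl, hab⟩
      exact ⟨b, a, rfl, rfl, h.symm hab⟩
    · rintro x y z ⟨a, b, rfl, rfl, hab⟩ ⟨a', c, h1, rfl, hac⟩
      obtain rfl := hf h1
      rw [h.unique hab hac]
    · rintro x y ⟨a, b, rfl, rfl, hab⟩
      rw [hM, h.bond hab]
    · rintro x y ⟨a, b, rfl, rfl, hab⟩
      rw [restrictPair_map hf]
      rcases h.restrict hab with hr | hr <;> simp [hr]
    · intro x hx
      obtain ⟨a, rfl⟩ := hmem hx (y := x) (by simp)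
      obtain ⟨b, hb⟩ := h.exists_of_dup (a := a) ((map_sublist_map_iff_of_injective hf).1 (by simpa using hx))
      exact ⟨f b, a, b, rfl, rfl, hb⟩
  · intro x y hx
    obtain ⟨a, rfl⟩ := hmem hx (y := x) (by simp)
    obtain ⟨b, rfl⟩ := hmem hx (y := y) (by simp)
    rw [hM]
    exact (h.eq_two_or (c := a) (x := b)
      ((map_sublist_map_iff_of_injective hf).1 (by simpa using hx))).imp_right
      fun hR => ⟨a, b, rfl, rfl, hR⟩

theorem IsBraided.of_map {R : J' → J' → Prop} (h : M'.IsBraided R (ω.map f))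
    (hf : Function.Injective f) (hM : ∀ a b, M' (f a) (f b) = M a b) :
    M.IsBraided (fun a b => R (f a) (f b)) ω where
  symm := h.symm
  unique hab hac := hf (h.unique hab hac)
  bond {a b} hab := by rw [← hM, h.bond hab]
  restrict {a b} hab := by
    have := h.restrict hab
    rw [restrictPair_map hf] at this
    refine this.imp (fun hr => ?_) (fun hr => ?_) <;> exact map_injective_iff.2 hf (by simpa using hr)
  exists_of_dup {a} ha := by
    obtain ⟨y, hy⟩ := h.exists_of_dup (a := f a) (by simpa using ha.map f)
    obtain ⟨b, -, rfl⟩ := mem_map.1 (h.mem_of_rel (h.symm hy))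
    exact ⟨b, hy⟩
  eq_two_or {c x} hc := by
    rw [← hM]
    exact h.eq_two_or (by simpa using hc.map f)

theorem coxeterForm_simpleRoot_nonpos (hM : M.IsSimplyLaced) {x : J} {v : J →₀ ℝ}
    (hv : ∀ k, 0 ≤ v k) (hx : v x = 0) : M.coxeterForm (simpleRoot x) v ≤ 0 := by
  have : M.coxeterForm (simpleRoot x) v =
      v.sum fun j r => r * M.coxeterForm (simpleRoot x) (simpleRoot j) := by
    conv_lhs => rw [← v.sum_single]
    rw [map_finsuppSum]
    refine Finsupp.sum_congr fun j _ => ?_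
    rw [← smul_eq_mul, ← map_smul, simpleRoot, simpleRoot, Finsupp.smul_single, smul_eq_mul, mul_one]
  rw [this]
  refine Finset.sum_nonpos fun j hj => mul_nonpos_of_nonneg_of_nonpos (hv j) ?_
  have hxj : x ≠ j := by
    rintro rfl
    exact Finsupp.mem_support_iff.1 hj hx
  rcases hM x j hxj with h | h
  · rw [coxeterForm_of_eq_two h]
  · rw [coxeterForm_of_eq_three h]
    norm_num

/-- The c-component of v contributes −v_c/2, and the remaining components contribute nothing
positive. -/
theorem coxeterForm_simpleRoot_le (hM : M.IsSimplyLaced) {x c : J} (hc : M x c = 3) {v : J →₀ ℝ}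
    (hv : ∀ k, 0 ≤ v k) (hx : v x = 0) : M.coxeterForm (simpleRoot x) v ≤ -(v c) / 2 := by
  classical
  have hxc := ne_of_eq_three hc
  have h1 := coxeterForm_simpleRoot_nonpos hM (x := x) (v := v - v c • simpleRoot c)
    (fun k => by
      by_cases hk : k = c
      · subst hk; simp
      · simpa [simpleRoot_apply_of_ne hk] using hv k)
    (by simp [simpleRoot_apply_of_ne hxc, hx])
  rw [map_sub, map_smul, coxeterForm_of_eq_three hc, smul_eq_mul] at h1
  linarith

end CoxeterMatrix

/-! ### Reduced words with new letters -/

namespace CoxeterSystem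

open CoxeterMatrix List

variable {J : Type*} {M : CoxeterMatrix J} {W : Type*} [Group W]
  (hM : M.IsSimplyLaced) (cs : CoxeterSystem M W)

/-- A reduced word without `x` that contains a neighbour `c` of `x` moves `α_x`. -/
theorem reflRep_wordProd_pos {ω : List J} (hω : cs.IsReduced ω) {x c : J} (hx : x ∉ ω)
    (hc : c ∈ ω) (hxc : M x c = 3) :
    0 < cs.reflRep hM (cs.wordProd ω) (simpleRoot x) c := by
  induction ω with
  | nil => simp at hc
  | cons i ω ih =>
    obtain ⟨hred, hpos⟩ := (cs.isReduced_cons_iff hM i ω).1 hω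
    simp only [mem_cons, not_or] at hx hc
    rw [wordProd_cons, reflRep_mul_apply, reflRep_simple]
    by_cases hci : c = i
    · subst hci
      -- With u the product of ω, s_c changes the c-coordinate of u α_x by −2B(α_x, u⁻¹α_c), which
      -- is nonnegative because u⁻¹α_c ≥ 0 has no x-component. If c occurs in ω, the old coordinate
      -- is positive by induction; if not, u⁻¹α_c has c-coordinate 1 and the change is at least 1.
      have hB : M.coxeterForm (cs.reflRep hM (cs.wordProd ω) (simpleRoot x)) (simpleRoot c) =
          M.coxeterForm (simpleRoot x) (cs.reflRep hM (cs.wordProd ω)⁻¹ (simpleRoot c)) := by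
        rw [← cs.coxeterForm_reflRep hM (cs.wordProd ω) (simpleRoot x), reflRep_apply_inv_self]
      have hle := coxeterForm_simpleRoot_le hM hxc hpos (by
        rw [cs.reflRep_wordProd_inv_apply_of_notMem hM hx.2, simpleRoot_apply_of_ne hx.1])
      rw [reflection_apply, Finsupp.sub_apply, Finsupp.smul_apply, simpleRoot_apply_self, hB,
        smul_eq_mul]
      by_cases hcω : c ∈ ω
      · have := ih hred hx.2 hcω
        have := hpos c
        linarith
      · rw [cs.reflRep_wordProd_inv_apply_of_notMem hM hcω, simpleRoot_apply_self] at hle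
        rw [cs.reflRep_wordProd_apply_of_notMem hM hcω,
          simpleRoot_apply_of_ne (ne_of_eq_three hxc).symm]
        linarith
    · rw [reflection_apply_of_ne hci]
      exact ih hred hx.2 (hc.resolve_left hci)

include hM in
-- The prefix k avoids c, so the positive c-coordinate produced by ω survives. This is what makes
-- left and right descents exclusive.
theorem length_lt_append_mul_simple {k ω : List J} (hω : cs.IsReduced ω) {x c : J} (hx : x ∉ ω)
    (hc : c ∈ ω) (hck : c ∉ k) (hxc : M x c = 3) :
    cs.length (cs.wordProd (k ++ ω)) < cs.length (cs.wordProd (k ++ ω) * cs.simple x) := by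
  apply cs.length_lt_mul_simple_of_pos hM (k := c)
  rw [wordProd_append, reflRep_mul_apply, cs.reflRep_wordProd_apply_of_notMem hM hck]
  exact cs.reflRep_wordProd_pos hM hω hx hc hxc

include hM in
-- As for a single new letter: (sω)⁻¹α_t has s-coordinate 1, and (tsω)⁻¹α_s = ω⁻¹α_t has
-- t-coordinate 1.
theorem isReduced_cons_braid {ω : List J} (hω : cs.IsReduced ω) {s t : J} (hst : M s t = 3)
    (hs : s ∉ ω) (ht : t ∉ ω) : cs.IsReduced ([s, t, s] ++ ω) := by
  have hne := ne_of_eq_three hst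
  have hts := (M.symmetric t s).trans hst
  have h1 := cs.isReduced_cons_of_notMem hM hω hs
  have key : ∀ {w : W} {i k : J}, 0 < cs.reflRep hM w⁻¹ (simpleRoot i) k →
      cs.length w < cs.length (cs.simple i * w) := by
    intro w i k hk
    have := cs.length_lt_mul_simple_of_pos hM hk
    rwa [← cs.length_inv w, ← cs.length_inv (cs.simple i * w), mul_inv_rev, inv_simple]
  have h2 : cs.IsReduced (t :: s :: ω) := by
    refine (cs.isReduced_cons_iff_length _ _).2 ⟨h1, key (k := s) ?_⟩
    rw [wordProd_cons, mul_inv_rev, reflRep_mul_apply, inv_simple, reflRep_simple,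
      reflection_of_eq_three hst, cs.reflRep_wordProd_inv_apply_of_notMem hM hs,
      Finsupp.add_apply, simpleRoot_apply_self, simpleRoot_apply_of_ne hne]
    norm_num
  change cs.IsReduced (s :: t :: s :: ω)
  refine (cs.isReduced_cons_iff_length _ _).2 ⟨h2, key (k := t) ?_⟩
  rw [wordProd_cons, wordProd_cons, mul_inv_rev, mul_inv_rev, reflRep_mul_apply,
    reflRep_mul_apply, inv_simple, inv_simple, reflRep_simple, reflRep_simple,
    reflection_of_eq_three hts, map_add, reflection_self, reflection_of_eq_three hst,
    cs.reflRep_wordProd_inv_apply_of_notMem hM ht]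
  simp

end CoxeterSystem

/-! ### Content maximal elements: inversion, new letters, splitting -/

namespace CoxeterSystem

open CoxeterMatrix List

variable {J : Type*} {M : CoxeterMatrix J} {W : Type*} [Group W]
  {hM : M.IsSimplyLaced} {cs : CoxeterSystem M W} {w : W}

theorem IsReducedExpr.reverse {ω : List J} (h : cs.IsReducedExpr ω w) :
    cs.IsReducedExpr ω.reverse w⁻¹ :=
  ⟨h.1.reverse, by rw [wordProd_reverse, h.2]⟩

theorem IsContentMaximal.inv (hw : cs.IsContentMaximal hM w) : cs.IsContentMaximal hM w⁻¹ := by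
  obtain ⟨ω, hω⟩ := cs.exists_isReducedExpr w
  exact (hw.isBraided hM hω).reverse.isContentMaximal hM hω.reverse

theorem isContentMaximal_inv_iff : cs.IsContentMaximal hM w⁻¹ ↔ cs.IsContentMaximal hM w :=
  ⟨fun h => by simpa using h.inv, fun h => h.inv⟩

theorem supp_inv : cs.supp w⁻¹ = cs.supp w := by
  have key : ∀ w, cs.supp w ⊆ cs.supp w⁻¹ := fun w a ⟨ω, hω, ha⟩ =>
    ⟨ω.reverse, hω.reverse, by simpa using ha⟩
  exact Set.Subset.antisymm (by simpa using key w⁻¹) (key w)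

theorem isBraidedIn_inv_iff {x : J} : cs.IsBraidedIn x w⁻¹ ↔ cs.IsBraidedIn x w := by
  have key : ∀ w, cs.IsBraidedIn x w → cs.IsBraidedIn x w⁻¹ := by
    rintro w ⟨ω, hω, hx⟩
    refine ⟨ω.reverse, hω.reverse, ?_⟩
    rw [duplicate_iff_sublist] at hx ⊢
    simpa using hx.reverse
  exact ⟨fun h => by simpa using key _ h, key w⟩

theorem mem_supp_iff (hM : M.IsSimplyLaced) {ω : List J} (h : cs.IsReducedExpr ω w) {a : J} :
    a ∈ cs.supp w ↔ a ∈ ω := by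
  rw [cs.supp_eq hM h]
  rfl

theorem IsContentMaximal.isBraidedIn_iff (hw : cs.IsContentMaximal hM w) {x : J} :
    cs.IsBraidedIn x w ↔ ∃ b, cs.BraidRel w x b := by
  constructor
  · rintro ⟨ω, hω, hx⟩
    exact (hw.isBraided hM hω).exists_of_dup (duplicate_iff_sublist.1 hx)
  · rintro ⟨b, -, u, v, h⟩
    refine ⟨_, h, duplicate_iff_sublist.2 ?_⟩
    have : [x, x] <+ [x, b, x] := by simp
    exact this.trans ((sublist_append_right u _).trans (sublist_append_left _ v))

/-! ### Multiplication by a new letter -/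

section NewLetter

variable (hw : cs.IsContentMaximal hM w) {x : J} (hx : x ∉ cs.supp w)
include hw hx

theorem IsContentMaximal.exists_isReducedExpr_cons : ∃ ω, cs.IsReducedExpr ω w ∧ x ∉ ω ∧
    cs.IsReducedExpr (x :: ω) (cs.simple x * w) ∧ M.IsBraided (cs.BraidRel w) (x :: ω) := by
  obtain ⟨ω, hω⟩ := cs.exists_isReducedExpr w
  rw [mem_supp_iff hM hω] at hx
  exact ⟨ω, hω, hx, ⟨cs.isReduced_cons_of_notMem hM hω.1 hx, by rw [wordProd_cons, hω.2]⟩,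
    (hw.isBraided hM hω).cons hx⟩

theorem IsContentMaximal.simple_mul : cs.IsContentMaximal hM (cs.simple x * w) := by
  obtain ⟨ω, -, -, h, hb⟩ := hw.exists_isReducedExpr_cons hx
  exact hb.isContentMaximal hM h

theorem IsContentMaximal.mem_supp_simple_mul {a : J} :
    a ∈ cs.supp (cs.simple x * w) ↔ a = x ∨ a ∈ cs.supp w := by
  obtain ⟨ω, h0, -, h, -⟩ := hw.exists_isReducedExpr_cons hx
  rw [mem_supp_iff hM h, mem_supp_iff hM h0, mem_cons]

theorem IsContentMaximal.not_isBraidedIn_simple_mul : ¬ cs.IsBraidedIn x (cs.simple x * w) := by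
  obtain ⟨ω, h0, hxω, h, hb⟩ := hw.exists_isReducedExpr_cons hx
  rw [(hw.simple_mul hx).isBraidedIn_iff]
  rintro ⟨b, hxb⟩
  exact hxω ((hw.isBraided hM h0).mem_of_rel (hb.rel_of_braidRel hM h hxb))

theorem IsContentMaximal.leftDescent_simple_mul :
    cs.length (cs.simple x * (cs.simple x * w)) < cs.length (cs.simple x * w) := by
  obtain ⟨ω, h0, -, h, -⟩ := hw.exists_isReducedExpr_cons hx
  rw [simple_mul_simple_cancel_left, cs.length_eq h0, cs.length_eq h]
  simp

theorem IsContentMaximal.not_rightDescent_simple_mul {c : J} (hc : c ∈ cs.supp w)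
    (hxc : M x c = 3) :
    ¬ cs.length (cs.simple x * w * cs.simple x) < cs.length (cs.simple x * w) := by
  obtain ⟨ω, h0, hxω, h, -⟩ := hw.exists_isReducedExpr_cons hx
  rw [mem_supp_iff hM h0] at hc
  have := cs.length_lt_append_mul_simple hM (k := [x]) h0.1 hxω hc
    (by simpa using (ne_of_eq_three hxc).symm) hxc
  rw [wordProd_append, wordProd_singleton, h0.2] at this
  omega

end NewLetter

/-! ### Multiplication by a long braid in new letters -/

section NewBraid

variable (hw : cs.IsContentMaximal hM w) {s t : J} (hst : M s t = 3) (hs : s ∉ cs.supp w)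
  (ht : t ∉ cs.supp w)
include hw hst hs ht

theorem IsContentMaximal.exists_isReducedExpr_braid : ∃ ω R, cs.IsReducedExpr ω w ∧ s ∉ ω ∧ t ∉ ω ∧
    cs.IsReducedExpr ([s, t, s] ++ ω) (cs.wordProd [s, t, s] * w) ∧
    M.IsBraided R ([s, t, s] ++ ω) := by
  obtain ⟨ω, hω⟩ := cs.exists_isReducedExpr w
  rw [mem_supp_iff hM hω] at hs ht
  exact ⟨ω, _, hω, hs, ht, ⟨cs.isReduced_cons_braid hM hω.1 hst hs ht,
    by rw [wordProd_append, hω.2]⟩, (hw.isBraided hM hω).cons_braid hst hs ht⟩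

theorem IsContentMaximal.braid_mul : cs.IsContentMaximal hM (cs.wordProd [s, t, s] * w) := by
  obtain ⟨ω, R, -, -, -, h, hb⟩ := hw.exists_isReducedExpr_braid hst hs ht
  exact hb.isContentMaximal hM h

theorem IsContentMaximal.mem_supp_braid_mul {a : J} :
    a ∈ cs.supp (cs.wordProd [s, t, s] * w) ↔ a = s ∨ a = t ∨ a ∈ cs.supp w := by
  obtain ⟨ω, R, h0, -, -, h, -⟩ := hw.exists_isReducedExpr_braid hst hs ht
  rw [mem_supp_iff hM h, mem_supp_iff hM h0]
  simp
  tauto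

theorem IsContentMaximal.isBraidedIn_braid_mul :
    cs.IsBraidedIn s (cs.wordProd [s, t, s] * w) := by
  obtain ⟨ω, R, -, -, -, h, -⟩ := hw.exists_isReducedExpr_braid hst hs ht
  refine ⟨_, h, duplicate_iff_sublist.2 ?_⟩
  have : [s, s] <+ [s, t, s] := by simp
  exact this.trans (sublist_append_left _ ω)

theorem IsContentMaximal.leftDescent_braid_mul :
    cs.length (cs.simple t * (cs.wordProd [s, t, s] * w)) <
      cs.length (cs.wordProd [s, t, s] * w) := by
  obtain ⟨ω, R, h0, -, -, h, -⟩ := hw.exists_isReducedExpr_braid hst hs ht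
  have h' : cs.IsReducedExpr (t :: s :: t :: ω) (cs.wordProd [s, t, s] * w) :=
    h.of_braidStep (.braid [] ω hst)
  have h2 : cs.simple t * (cs.wordProd [s, t, s] * w) = cs.wordProd (s :: t :: ω) := by
    rw [← h'.2, wordProd_cons, simple_mul_simple_cancel_left]
  rw [h2, cs.length_eq h']
  exact lt_of_le_of_lt (cs.length_wordProd_le _) (by simp)

theorem IsContentMaximal.not_rightDescent_braid_mul {c : J} (hc : c ∈ cs.supp w)
    (htc : M t c = 3) :
    ¬ cs.length (cs.wordProd [s, t, s] * w * cs.simple t) <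
      cs.length (cs.wordProd [s, t, s] * w) := by
  obtain ⟨ω, R, h0, -, htω, h, -⟩ := hw.exists_isReducedExpr_braid hst hs ht
  have hcs : c ≠ s := fun e => hs (e ▸ hc)
  have hct : c ≠ t := fun e => ht (e ▸ hc)
  rw [mem_supp_iff hM h0] at hc
  have := cs.length_lt_append_mul_simple hM (k := [s, t, s]) h0.1 htω hc
    (by simp [hcs, hct]) htc
  rw [wordProd_append, h0.2] at this
  omega

end NewBraid

/-! ### Splitting off letters -/

theorem wordProd_mul_wordProd_comm {k u : List J} (h : ∀ a ∈ k, ∀ y ∈ u, M a y = 2) :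
    cs.wordProd u * cs.wordProd k = cs.wordProd k * cs.wordProd u := by
  induction k with
  | nil => simp
  | cons a k ih =>
    rw [wordProd_cons, ← mul_assoc, cs.wordProd_mul_simple_comm (h a mem_cons_self), mul_assoc,
      ih fun a ha => h a (mem_cons_of_mem _ ha), mul_assoc]

theorem exists_eq_mul_left {u k v : List J} {R : J → J → Prop}
    (h : cs.IsReducedExpr (u ++ k ++ v) w) (hR : M.IsBraided R (u ++ v))
    (hk : ∀ a ∈ k, a ∉ u ∧ a ∉ v) (hM : M.IsSimplyLaced) (hu : ∀ a ∈ k, ∀ y ∈ u, M a y = 2) :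
    ∃ w', cs.IsContentMaximal hM w' ∧ (∀ a ∈ k, a ∉ cs.supp w') ∧ w = cs.wordProd k * w' := by
  have h1 : cs.IsReducedExpr (k ++ (u ++ v)) w := h.of_wordProd_eq (by simp; omega) (by
    rw [wordProd_append, wordProd_append, wordProd_append, wordProd_append, ← mul_assoc,
      wordProd_mul_wordProd_comm hu])
  have h2 : cs.IsReducedExpr (u ++ v) (cs.wordProd (u ++ v)) := ⟨h1.1.of_append_right, rfl⟩
  refine ⟨_, hR.isContentMaximal hM h2, fun a ha => ?_, by rw [← h1.2, wordProd_append]⟩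
  rw [mem_supp_iff hM h2, mem_append, not_or]
  exact hk a ha

theorem exists_eq_mul_right {u k v : List J} {R : J → J → Prop}
    (h : cs.IsReducedExpr (u ++ k ++ v) w) (hR : M.IsBraided R (u ++ v))
    (hk : ∀ a ∈ k, a ∉ u ∧ a ∉ v) (hM : M.IsSimplyLaced) (hv : ∀ a ∈ k, ∀ y ∈ v, M a y = 2) :
    ∃ w', cs.IsContentMaximal hM w' ∧ (∀ a ∈ k, a ∉ cs.supp w') ∧ w = w' * cs.wordProd k := by
  have h1 : cs.IsReducedExpr (u ++ v ++ k) w := h.of_wordProd_eq (by simp; omega) (by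
    rw [wordProd_append, wordProd_append, wordProd_append, wordProd_append, mul_assoc, mul_assoc,
      wordProd_mul_wordProd_comm hv])
  have h2 : cs.IsReducedExpr (u ++ v) (cs.wordProd (u ++ v)) := ⟨h1.1.of_append_left, rfl⟩
  refine ⟨_, hR.isContentMaximal hM h2, fun a ha => ?_, by rw [← h1.2, wordProd_append]⟩
  rw [mem_supp_iff hM h2, mem_append, not_or]
  exact hk a ha

section Split

variable (hw : cs.IsContentMaximal hM w)
include hw

/-- A neighbour c on both sides would enclose x between two occurrences of c and so be its partner,
but x has none. -/
theorem IsContentMaximal.exists_split_of_not_isBraidedIn {x : J} (hx : x ∈ cs.supp w)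
    (hxb : ¬ cs.IsBraidedIn x w) : ∃ u v R, cs.IsReducedExpr (u ++ [x] ++ v) w ∧
      M.IsBraided R (u ++ v) ∧ (∀ a ∈ [x], a ∉ u ∧ a ∉ v) ∧ ∀ c, M x c = 3 → c ∉ u ∨ c ∉ v := by
  obtain ⟨ω, hω, hxω⟩ := hx
  obtain ⟨u, v, rfl⟩ := mem_iff_append.1 hxω
  rw [append_cons] at hω
  have hB := hw.isBraided hM hω
  have hdup : ¬ [x, x] <+ u ++ [x] ++ v := fun h => hxb ⟨_, hω, duplicate_iff_sublist.2 h⟩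
  have hk : ∀ a ∈ [x], a ∉ u ∧ a ∉ v := by
    intro a ha
    rw [mem_singleton] at ha
    subst ha
    constructor
    · intro h
      exact hdup (((singleton_sublist.2 h).append (Sublist.refl [a])).trans
        (sublist_append_left _ _))
    · intro h
      refine hdup ?_
      rw [append_assoc]
      exact ((Sublist.refl [a]).append (singleton_sublist.2 h)).trans
        (sublist_append_right _ _)
  have hno : ∀ b, ¬ cs.BraidRel w x b := fun b hb => hxb (hw.isBraidedIn_iff.2 ⟨b, hb⟩)
  obtain ⟨R', hR'⟩ := hB.exists_delete hk fun a b hab hb => by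
    rw [mem_singleton] at hb
    subst hb
    exact absurd hab.symm (hno a)
  refine ⟨u, v, R', hω, hR', hk, fun c hc => ?_⟩
  by_contra hcon
  push Not at hcon
  rcases hB.eq_two_or (((singleton_sublist.2 hcon.1).append (Sublist.refl [x])).append
    (singleton_sublist.2 hcon.2)) with h | h
  · rw [M.symmetric, hc] at h
    omega
  · exact hno c h.symm

/-- The partner of s can only be its single possible neighbour t. A neighbour c ≠ s of t on both
sides of sts would enclose t and become a second partner of it. -/
theorem IsContentMaximal.exists_split_of_isBraidedIn {s t : J} (hs : cs.IsBraidedIn s w)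
    (hst : ∀ y, M s y = 3 → y = t) : M s t = 3 ∧ ∃ u v R, cs.IsReducedExpr (u ++ [s, t, s] ++ v) w ∧
      M.IsBraided R (u ++ v) ∧ (∀ a ∈ [s, t, s], a ∉ u ∧ a ∉ v) ∧
      ∀ c, c ≠ s → M t c = 3 → c ∉ u ∨ c ∉ v := by
  obtain ⟨t', ht'⟩ := hw.isBraidedIn_iff.1 hs
  obtain rfl := hst t' ht'.1
  obtain ⟨h3, u, v, hω⟩ := id ht'
  have hB := hw.isBraided hM hω
  obtain ⟨-, hu, hv⟩ := hB.rel_of_infix h3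
  have hk : ∀ a ∈ [s, t', s], a ∉ u ∧ a ∉ v := by
    intro a ha
    rcases (by simp at ha; tauto : a = s ∨ a = t') with rfl | rfl
    · exact ⟨hu.1, hv.1⟩
    · exact ⟨hu.2, hv.2⟩
  obtain ⟨R', hR'⟩ := hB.exists_delete hk fun a b hab hb => by
    rcases (by simp at hb; tauto : b = s ∨ b = t') with rfl | rfl
    · rw [hB.unique (hB.symm hab) ht']; simp
    · rw [hB.unique (hB.symm hab) ht'.symm]; simp
  refine ⟨h3, u, v, R', hω, hR', hk, fun c hcs hc => ?_⟩
  by_contra hcon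
  push Not at hcon
  rcases hB.eq_two_or (((singleton_sublist.2 hcon.1).append (by simp : [t'] <+ [s, t', s])).append
    (singleton_sublist.2 hcon.2)) with h | h
  · rw [M.symmetric, hc] at h
    omega
  · exact hcs (hB.unique h.symm ht'.symm)

end Split

end CoxeterSystem

/-! ### Parabolic subgroups -/

namespace CoxeterSystem

open CoxeterMatrix List

section Parabolic

variable {J J' : Type*} {M : CoxeterMatrix J} {M' : CoxeterMatrix J'} {W W' : Type*} [Group W]
  [Group W'] (hM : M.IsSimplyLaced) (hM' : M'.IsSimplyLaced) (cs : CoxeterSystem M W)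
  (cs' : CoxeterSystem M' W') {f : J → J'}

theorem isLiftable_simple_comp (h : ∀ a b, M' (f a) (f b) = M a b) :
    M.IsLiftable (cs'.simple ∘ f) := fun a b => by
  rw [← h]
  exact cs'.simple_mul_simple_pow (f a) (f b)

/-- The homomorphism that sends `s_i` to `s_{f i}`. -/
def parabolicMap (h : ∀ a b, M' (f a) (f b) = M a b) : W →* W' :=
  cs.lift ⟨cs'.simple ∘ f, cs'.isLiftable_simple_comp h⟩

variable (h : ∀ a b, M' (f a) (f b) = M a b)

theorem parabolicMap_wordProd (ω : List J) :
    cs.parabolicMap cs' h (cs.wordProd ω) = cs'.wordProd (ω.map f) := by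
  induction ω with
  | nil => simp
  | cons i ω ih =>
    rw [wordProd_cons, map_mul, ih, map_cons, wordProd_cons, parabolicMap, lift_apply_simple]
    rfl

include h in
theorem _root_.CoxeterMatrix.reflection_mapDomain (i : J) (v : J →₀ ℝ) :
    M'.reflection (f i) (v.mapDomain f) = (M.reflection i v).mapDomain f := by
  have hs : ∀ j, (simpleRoot j : J →₀ ℝ).mapDomain f = simpleRoot (f j) := fun j => by
    simp [simpleRoot]
  have hB : M'.coxeterForm (v.mapDomain f) (simpleRoot (f i)) =
      M.coxeterForm v (simpleRoot i) := by
    induction v using Finsupp.induction_linear with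
    | zero => simp
    | add u v hu hv => simp [Finsupp.mapDomain_add, hu, hv]
    | single j r =>
      have h1 : (Finsupp.single j r : J →₀ ℝ) = r • simpleRoot j := by simp [simpleRoot]
      rw [h1, Finsupp.mapDomain_smul, hs, map_smul, map_smul, LinearMap.smul_apply,
        LinearMap.smul_apply, coxeterForm_simpleRoot, coxeterForm_simpleRoot, h]
  rw [reflection_apply, reflection_apply, hB, sub_eq_add_neg, sub_eq_add_neg, ← neg_smul,
    ← neg_smul, Finsupp.mapDomain_add, Finsupp.mapDomain_smul, hs]

include h in
theorem reflRep_map (ω : List J) (v : J →₀ ℝ) :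
    cs'.reflRep hM' (cs'.wordProd (ω.map f)) (v.mapDomain f) =
      (cs.reflRep hM (cs.wordProd ω) v).mapDomain f := by
  induction ω with
  | nil => simp
  | cons i ω ih =>
    rw [map_cons, wordProd_cons, wordProd_cons, reflRep_mul_apply, reflRep_mul_apply, ih,
      reflRep_simple, reflRep_simple, reflection_mapDomain h]

include hM hM' h in
-- Reducedness can be read off the signs of coordinates of roots, and `Finsupp.mapDomain f`,
-- extension by zero, intertwines the two representations.
theorem isReduced_map_iff (hf : Function.Injective f) (ω : List J) :
    cs'.IsReduced (ω.map f) ↔ cs.IsReduced ω := by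
  induction ω with
  | nil => simp [IsReduced]
  | cons i ω ih =>
    rw [map_cons, isReduced_cons_iff hM', isReduced_cons_iff hM, ih, ← wordProd_reverse,
      ← wordProd_reverse, ← map_reverse]
    have hs : simpleRoot (f i) = (simpleRoot i : J →₀ ℝ).mapDomain f := by simp [simpleRoot]
    rw [hs, reflRep_map hM hM' cs cs' h]
    refine and_congr_right fun _ => ⟨fun hk k => ?_, fun hk k => ?_⟩
    · rw [← Finsupp.mapDomain_apply hf]
      exact hk (f k)
    · by_cases hkr : k ∈ Set.range f
      · obtain ⟨j, rfl⟩ := hkr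
        rw [Finsupp.mapDomain_apply hf]
        exact hk j
      · rw [Finsupp.mapDomain_of_notMem_range _ _ hkr]

include hM hM' in
theorem IsReducedExpr.map {cs : CoxeterSystem M W} (hf : Function.Injective f) {ω : List J} {w : W}
    (hω : cs.IsReducedExpr ω w) : cs'.IsReducedExpr (ω.map f) (cs.parabolicMap cs' h w) :=
  ⟨(cs.isReduced_map_iff hM hM' cs' h hf ω).2 hω.1, by rw [← hω.2, parabolicMap_wordProd]⟩

include hM hM' in
theorem parabolicMap_injective (hf : Function.Injective f) :
    Function.Injective (cs.parabolicMap cs' h) := by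
  rw [injective_iff_map_eq_one]
  intro w hw
  obtain ⟨ω, hω⟩ := cs.exists_isReducedExpr w
  have := cs'.length_eq (hω.map hM hM' cs' h hf)
  rw [hw, length_one, length_map, ← cs.length_eq hω] at this
  exact cs.length_eq_zero_iff.1 this.symm

/-- The content maximal elements of a parabolic subgroup are those with support in its alphabet. -/
theorem ncard_contentMaximalSet_eq (hf : Function.Injective f) (h : ∀ a b, M' (f a) (f b) = M a b) :
    (cs.contentMaximalSet hM).ncard =
      {w | cs'.IsContentMaximal hM' w ∧ ∀ a ∈ cs'.supp w, a ∈ Set.range f}.ncard := by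
  rw [← Set.ncard_image_of_injective _ (cs.parabolicMap_injective hM hM' cs' h hf)]
  congr 1
  ext w'
  constructor
  · rintro ⟨w, hw, rfl⟩
    obtain ⟨ω, hω⟩ := cs.exists_isReducedExpr w
    have hω' := hω.map hM hM' cs' h hf
    refine ⟨((IsContentMaximal.isBraided hM hw hω).map hf h).isContentMaximal hM' hω', fun a ha => ?_⟩
    rw [mem_supp_iff hM' hω'] at ha
    obtain ⟨b, -, rfl⟩ := mem_map.1 ha
    exact ⟨b, rfl⟩
  · rintro ⟨hw', hsupp⟩
    obtain ⟨ω', hω'⟩ := cs'.exists_isReducedExpr w'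
    have : ω' ∈ Set.range (List.map f) := by
      rw [Set.range_list_map]
      exact fun a ha => hsupp a ((mem_supp_iff hM' hω').2 ha)
    obtain ⟨ω, rfl⟩ := this
    have hω : cs.IsReducedExpr ω (cs.wordProd ω) :=
      ⟨(cs.isReduced_map_iff hM hM' cs' h hf ω).1 hω'.1, rfl⟩
    refine ⟨cs.wordProd ω, ?_, by rw [parabolicMap_wordProd, hω'.2]⟩
    exact ((hw'.isBraided hM' hω').of_map hf h).isContentMaximal hM hω

end Parabolic

/-! ### Structure and enumeration at an end letter of the diagram -/

variable {J : Type*} {M : CoxeterMatrix J} {W : Type*} [Group W]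
  {hM : M.IsSimplyLaced} {cs : CoxeterSystem M W} {w : W}

/-- Braided words use every letter at most twice, so their length is at most twice the size of the
alphabet. -/
theorem finite_contentMaximalSet [Finite J] : (cs.contentMaximalSet hM).Finite := by
  classical
  have := Fintype.ofFinite J
  refine ((List.finite_length_le J (2 * Fintype.card J)).image cs.wordProd).subset ?_
  intro w hw
  obtain ⟨ω, hω⟩ := cs.exists_isReducedExpr w
  refine ⟨ω, ?_, hω.2⟩
  have hp := (IsContentMaximal.isBraided hM hw hω).toIsPaired
  change ω.length ≤ _
  rw [hp.length_eq, two_mul]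
  exact Nat.add_le_add (Finset.card_le_univ _)
    ((Finset.card_filter_le _ _).trans (Finset.card_le_univ _))

theorem length_simple_mul_inv_lt_iff {i : J} :
    cs.length (cs.simple i * w⁻¹) < cs.length w⁻¹ ↔ cs.length (w * cs.simple i) < cs.length w :=
  cs.isLeftDescent_inv_iff

theorem length_inv_mul_simple_lt_iff {i : J} :
    cs.length (w⁻¹ * cs.simple i) < cs.length w⁻¹ ↔ cs.length (cs.simple i * w) < cs.length w :=
  cs.isRightDescent_inv_iff

/-! ### A letter with a single neighbour, occurring once -/

section Single

variable {x b : J} (hxb : ∀ y, M x y = 3 ↔ y = b)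
include hxb

/-- The letter x can move to any end without b on the way. If b does not occur at all, the left end
is always available, which gives a unique normal form. -/
theorem IsContentMaximal.eq_mul_of_not_isBraidedIn (hw : cs.IsContentMaximal hM w)
    (hx : x ∈ cs.supp w) (hxw : ¬ cs.IsBraidedIn x w) :
    ((∃ w', cs.IsContentMaximal hM w' ∧ x ∉ cs.supp w' ∧ w = cs.simple x * w') ∨
      (∃ w', cs.IsContentMaximal hM w' ∧ x ∉ cs.supp w' ∧ w = w' * cs.simple x)) ∧
    (b ∉ cs.supp w → ∃ w', cs.IsContentMaximal hM w' ∧ x ∉ cs.supp w' ∧ w = cs.simple x * w') := by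
  obtain ⟨u, v, R, hω, hR, hk, hc⟩ := hw.exists_split_of_not_isBraidedIn hx hxw
  have hcomm : ∀ l : List J, x ∉ l → b ∉ l → ∀ a ∈ [x], ∀ y ∈ l, M a y = 2 := by
    intro l hxl hbl a ha y hy
    rw [mem_singleton] at ha
    subst ha
    exact (hM a y fun e => hxl (e ▸ hy)).resolve_right fun h3 => hbl ((hxb y).1 h3 ▸ hy)
  have hkx := hk x (by simp)
  have hL : b ∉ u → ∃ w', cs.IsContentMaximal hM w' ∧ x ∉ cs.supp w' ∧ w = cs.simple x * w' := by
    intro hbu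
    obtain ⟨w', h1, h2, h3⟩ := exists_eq_mul_left hω hR hk hM (hcomm u hkx.1 hbu)
    exact ⟨w', h1, h2 x (by simp), by rw [h3, wordProd_singleton]⟩
  refine ⟨?_, fun hb => hL fun hbu => hb ?_⟩
  · refine (hc b ((hxb b).2 rfl)).imp hL fun hbv => ?_
    obtain ⟨w', h1, h2, h3⟩ := exists_eq_mul_right hω hR hk hM (hcomm v hkx.2 hbv)
    exact ⟨w', h1, h2 x (by simp), by rw [h3, wordProd_singleton]⟩
  · rw [mem_supp_iff hM hω]
    simp [hbu]

theorem IsContentMaximal.descents_of_not_isBraidedIn (hw : cs.IsContentMaximal hM w)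
    (hx : x ∈ cs.supp w) (hxw : ¬ cs.IsBraidedIn x w) (hb : b ∈ cs.supp w) :
    (cs.length (cs.simple x * w) < cs.length w ∧ ¬ cs.length (w * cs.simple x) < cs.length w ∧
      ∃ w', cs.IsContentMaximal hM w' ∧ x ∉ cs.supp w' ∧ w = cs.simple x * w') ∨
    (cs.length (w * cs.simple x) < cs.length w ∧ ¬ cs.length (cs.simple x * w) < cs.length w) := by
  have h3 : M x b = 3 := (hxb b).2 rfl
  have hne := (ne_of_eq_three h3).symm
  rcases (hw.eq_mul_of_not_isBraidedIn hxb hx hxw).1 with ⟨w', h1, h2, rfl⟩ | ⟨w', h1, h2, rfl⟩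
  · exact Or.inl ⟨h1.leftDescent_simple_mul h2, h1.not_rightDescent_simple_mul h2
      (((h1.mem_supp_simple_mul h2).1 hb).resolve_left hne) h3, w', h1, h2, rfl⟩
  · right
    rw [← supp_inv] at h2
    rw [← length_inv_mul_simple_lt_iff (w := w' * _),
      ← length_simple_mul_inv_lt_iff (w := w' * _), mul_inv_rev, inv_simple]
    rw [← supp_inv, mul_inv_rev, inv_simple] at hb
    exact ⟨h1.inv.leftDescent_simple_mul h2, h1.inv.not_rightDescent_simple_mul h2
      (((h1.inv.mem_supp_simple_mul h2).1 hb).resolve_left hne) h3⟩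

theorem ncard_single_of_notMem : {w | cs.IsContentMaximal hM w ∧ x ∈ cs.supp w ∧
    ¬ cs.IsBraidedIn x w ∧ b ∉ cs.supp w}.ncard =
      {w | cs.IsContentMaximal hM w ∧ x ∉ cs.supp w ∧ b ∉ cs.supp w}.ncard := by
  have hne := (ne_of_eq_three ((hxb b).2 rfl)).symm
  rw [← Set.ncard_image_of_injective {w | cs.IsContentMaximal hM w ∧ x ∉ cs.supp w ∧ b ∉ cs.supp w}
    (mul_right_injective (cs.simple x))]
  congr 1
  ext w
  constructor
  · rintro ⟨hw, hx, hxw, hb⟩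
    obtain ⟨w', h1, h2, rfl⟩ := (hw.eq_mul_of_not_isBraidedIn hxb hx hxw).2 hb
    exact ⟨w', ⟨h1, h2, fun h => hb ((h1.mem_supp_simple_mul h2).2 (Or.inr h))⟩, rfl⟩
  · rintro ⟨w', ⟨h1, h2, h3⟩, rfl⟩
    refine ⟨h1.simple_mul h2, (h1.mem_supp_simple_mul h2).2 (Or.inl rfl),
      h1.not_isBraidedIn_simple_mul h2, fun h => ?_⟩
    rcases (h1.mem_supp_simple_mul h2).1 h with h | h
    · exact hne h
    · exact h3 h

theorem ncard_single_leftDescent : {w | cs.IsContentMaximal hM w ∧ x ∈ cs.supp w ∧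
    ¬ cs.IsBraidedIn x w ∧ b ∈ cs.supp w ∧ cs.length (cs.simple x * w) < cs.length w}.ncard =
      {w | cs.IsContentMaximal hM w ∧ x ∉ cs.supp w ∧ b ∈ cs.supp w}.ncard := by
  have hne := (ne_of_eq_three ((hxb b).2 rfl)).symm
  rw [← Set.ncard_image_of_injective {w | cs.IsContentMaximal hM w ∧ x ∉ cs.supp w ∧ b ∈ cs.supp w}
    (mul_right_injective (cs.simple x))]
  congr 1
  ext w
  constructor
  · rintro ⟨hw, hx, hxw, hb, hl⟩
    obtain ⟨-, -, w', h1, h2, rfl⟩ :=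
      (hw.descents_of_not_isBraidedIn hxb hx hxw hb).resolve_right fun h => h.2 hl
    exact ⟨w', ⟨h1, h2, ((h1.mem_supp_simple_mul h2).1 hb).resolve_left hne⟩, rfl⟩
  · rintro ⟨w', ⟨h1, h2, h3⟩, rfl⟩
    exact ⟨h1.simple_mul h2, (h1.mem_supp_simple_mul h2).2 (Or.inl rfl),
      h1.not_isBraidedIn_simple_mul h2, (h1.mem_supp_simple_mul h2).2 (Or.inr h3),
      h1.leftDescent_simple_mul h2⟩

omit hxb in
-- Inversion exchanges left and right descents and preserves the other conditions.
theorem ncard_single_rightDescent : {w | cs.IsContentMaximal hM w ∧ x ∈ cs.supp w ∧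
    ¬ cs.IsBraidedIn x w ∧ b ∈ cs.supp w ∧ cs.length (w * cs.simple x) < cs.length w}.ncard =
      {w | cs.IsContentMaximal hM w ∧ x ∈ cs.supp w ∧ ¬ cs.IsBraidedIn x w ∧ b ∈ cs.supp w ∧
        cs.length (cs.simple x * w) < cs.length w}.ncard := by
  rw [← Set.ncard_image_of_injective _ (inv_injective (G := W))]
  congr 1
  ext w
  rw [Set.image_inv_eq_inv, Set.mem_inv]
  simp only [Set.mem_ofPred_eq, isContentMaximal_inv_iff, supp_inv, isBraidedIn_inv_iff,
    length_inv_mul_simple_lt_iff]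

end Single

/-! ### A letter with a single neighbour, occurring in a long braid -/

section Braid

variable {x b c : J} (hxb : ∀ y, M x y = 3 ↔ y = b) (hbc : ∀ y, M b y = 3 ↔ y = x ∨ y = c)
  (hcx : c ≠ x)
include hxb hbc hcx

/-- The factor xbx moves as a block: c is the only letter outside it that does not commute with it.
-/
theorem IsContentMaximal.eq_mul_of_isBraidedIn (hw : cs.IsContentMaximal hM w)
    (hxw : cs.IsBraidedIn x w) :
    ((∃ w', cs.IsContentMaximal hM w' ∧ x ∉ cs.supp w' ∧ b ∉ cs.supp w' ∧
        w = cs.wordProd [x, b, x] * w') ∨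
      (∃ w', cs.IsContentMaximal hM w' ∧ x ∉ cs.supp w' ∧ b ∉ cs.supp w' ∧
        w = w' * cs.wordProd [x, b, x])) ∧
    (c ∉ cs.supp w → ∃ w', cs.IsContentMaximal hM w' ∧ x ∉ cs.supp w' ∧ b ∉ cs.supp w' ∧
      w = cs.wordProd [x, b, x] * w') := by
  obtain ⟨hb3, u, v, R, hω, hR, hk, hc⟩ :=
    hw.exists_split_of_isBraidedIn hxw fun y => (hxb y).1
  have hcomm : ∀ l : List J, x ∉ l → b ∉ l → c ∉ l → ∀ a ∈ [x, b, x], ∀ y ∈ l, M a y = 2 := by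
    intro l hxl hbl hcl a ha y hy
    have hax : M x y = 2 :=
      (hM x y fun e => hxl (e ▸ hy)).resolve_right fun h3 => hbl ((hxb y).1 h3 ▸ hy)
    have hab : M b y = 2 := (hM b y fun e => hbl (e ▸ hy)).resolve_right fun h3 => by
      rcases (hbc y).1 h3 with rfl | rfl <;> contradiction
    simp only [mem_cons, not_mem_nil, or_false] at ha
    rcases ha with rfl | rfl | rfl <;> assumption
  have hkx := hk x (by simp)
  have hkb := hk b (by simp)
  have hL : c ∉ u → ∃ w', cs.IsContentMaximal hM w' ∧ x ∉ cs.supp w' ∧ b ∉ cs.supp w' ∧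
      w = cs.wordProd [x, b, x] * w' := by
    intro hcu
    obtain ⟨w', h1, h2, h3⟩ := exists_eq_mul_left hω hR hk hM (hcomm u hkx.1 hkb.1 hcu)
    exact ⟨w', h1, h2 x (by simp), h2 b (by simp), h3⟩
  refine ⟨?_, fun hcs => hL fun hcu => hcs ?_⟩
  · refine (hc c hcx ((hbc c).2 (Or.inr rfl))).imp hL fun hcv => ?_
    obtain ⟨w', h1, h2, h3⟩ := exists_eq_mul_right hω hR hk hM (hcomm v hkx.2 hkb.2 hcv)
    exact ⟨w', h1, h2 x (by simp), h2 b (by simp), h3⟩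
  · rw [mem_supp_iff hM hω]
    simp [hcu]

/-- The end is detected by b, a descent there because xbx = bxb. The letter x would not do: it
commutes with w' and is a descent on both sides. -/
theorem IsContentMaximal.descents_of_isBraidedIn (hw : cs.IsContentMaximal hM w)
    (hxw : cs.IsBraidedIn x w) (hc : c ∈ cs.supp w) :
    (cs.length (cs.simple b * w) < cs.length w ∧ ¬ cs.length (w * cs.simple b) < cs.length w ∧
      ∃ w', cs.IsContentMaximal hM w' ∧ x ∉ cs.supp w' ∧ b ∉ cs.supp w' ∧
        w = cs.wordProd [x, b, x] * w') ∨
    (cs.length (w * cs.simple b) < cs.length w ∧ ¬ cs.length (cs.simple b * w) < cs.length w) := by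
  have h3 : M x b = 3 := (hxb b).2 rfl
  have h3' : M b c = 3 := (hbc c).2 (Or.inr rfl)
  have hcb := (ne_of_eq_three h3').symm
  rcases (hw.eq_mul_of_isBraidedIn hxb hbc hcx hxw).1 with
    ⟨w', h1, h2, h2', rfl⟩ | ⟨w', h1, h2, h2', rfl⟩
  · exact Or.inl ⟨h1.leftDescent_braid_mul h3 h2 h2', h1.not_rightDescent_braid_mul h3 h2 h2'
      ((((h1.mem_supp_braid_mul h3 h2 h2').1 hc).resolve_left hcx).resolve_left hcb) h3',
      w', h1, h2, h2', rfl⟩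
  · right
    have hinv : (w' * cs.wordProd [x, b, x])⁻¹ = cs.wordProd [x, b, x] * w'⁻¹ := by
      rw [mul_inv_rev, ← wordProd_reverse]
      rfl
    rw [← supp_inv] at h2 h2'
    rw [← length_inv_mul_simple_lt_iff (w := w' * _),
      ← length_simple_mul_inv_lt_iff (w := w' * _), hinv]
    rw [← supp_inv, hinv] at hc
    exact ⟨h1.inv.leftDescent_braid_mul h3 h2 h2', h1.inv.not_rightDescent_braid_mul h3 h2 h2'
      ((((h1.inv.mem_supp_braid_mul h3 h2 h2').1 hc).resolve_left hcx).resolve_left hcb) h3'⟩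

theorem ncard_braid_of_notMem : {w | cs.IsContentMaximal hM w ∧ x ∈ cs.supp w ∧
    cs.IsBraidedIn x w ∧ c ∉ cs.supp w}.ncard =
      {w | cs.IsContentMaximal hM w ∧ x ∉ cs.supp w ∧ b ∉ cs.supp w ∧ c ∉ cs.supp w}.ncard := by
  have h3 : M x b = 3 := (hxb b).2 rfl
  have hcb := (ne_of_eq_three ((hbc c).2 (Or.inr rfl))).symm
  rw [← Set.ncard_image_of_injective
    {w | cs.IsContentMaximal hM w ∧ x ∉ cs.supp w ∧ b ∉ cs.supp w ∧ c ∉ cs.supp w}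
    (mul_right_injective (cs.wordProd [x, b, x]))]
  congr 1
  ext w
  constructor
  · rintro ⟨hw, hx, hxw, hc⟩
    obtain ⟨w', h1, h2, h2', rfl⟩ := (hw.eq_mul_of_isBraidedIn hxb hbc hcx hxw).2 hc
    exact ⟨w', ⟨h1, h2, h2', fun h =>
      hc ((h1.mem_supp_braid_mul h3 h2 h2').2 (Or.inr (Or.inr h)))⟩, rfl⟩
  · rintro ⟨w', ⟨h1, h2, h2', h4⟩, rfl⟩
    refine ⟨h1.braid_mul h3 h2 h2', (h1.mem_supp_braid_mul h3 h2 h2').2 (Or.inl rfl),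
      h1.isBraidedIn_braid_mul h3 h2 h2', fun h => ?_⟩
    rcases (h1.mem_supp_braid_mul h3 h2 h2').1 h with h | h | h
    · exact hcx h
    · exact hcb h
    · exact h4 h

theorem ncard_braid_leftDescent : {w | cs.IsContentMaximal hM w ∧ x ∈ cs.supp w ∧
    cs.IsBraidedIn x w ∧ c ∈ cs.supp w ∧ cs.length (cs.simple b * w) < cs.length w}.ncard =
      {w | cs.IsContentMaximal hM w ∧ x ∉ cs.supp w ∧ b ∉ cs.supp w ∧ c ∈ cs.supp w}.ncard := by
  have h3 : M x b = 3 := (hxb b).2 rfl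
  have hcb := (ne_of_eq_three ((hbc c).2 (Or.inr rfl))).symm
  rw [← Set.ncard_image_of_injective
    {w | cs.IsContentMaximal hM w ∧ x ∉ cs.supp w ∧ b ∉ cs.supp w ∧ c ∈ cs.supp w}
    (mul_right_injective (cs.wordProd [x, b, x]))]
  congr 1
  ext w
  constructor
  · rintro ⟨hw, hx, hxw, hc, hl⟩
    obtain ⟨-, -, w', h1, h2, h2', rfl⟩ :=
      (hw.descents_of_isBraidedIn hxb hbc hcx hxw hc).resolve_right fun h => h.2 hl
    exact ⟨w', ⟨h1, h2, h2',
      (((h1.mem_supp_braid_mul h3 h2 h2').1 hc).resolve_left hcx).resolve_left hcb⟩, rfl⟩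
  · rintro ⟨w', ⟨h1, h2, h2', h4⟩, rfl⟩
    exact ⟨h1.braid_mul h3 h2 h2', (h1.mem_supp_braid_mul h3 h2 h2').2 (Or.inl rfl),
      h1.isBraidedIn_braid_mul h3 h2 h2', (h1.mem_supp_braid_mul h3 h2 h2').2 (Or.inr (Or.inr h4)),
      h1.leftDescent_braid_mul h3 h2 h2'⟩

omit hxb hbc hcx in
theorem ncard_braid_rightDescent : {w | cs.IsContentMaximal hM w ∧ x ∈ cs.supp w ∧
    cs.IsBraidedIn x w ∧ c ∈ cs.supp w ∧ cs.length (w * cs.simple b) < cs.length w}.ncard =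
      {w | cs.IsContentMaximal hM w ∧ x ∈ cs.supp w ∧ cs.IsBraidedIn x w ∧ c ∈ cs.supp w ∧
        cs.length (cs.simple b * w) < cs.length w}.ncard := by
  rw [← Set.ncard_image_of_injective _ (inv_injective (G := W))]
  congr 1
  ext w
  rw [Set.image_inv_eq_inv, Set.mem_inv]
  simp only [Set.mem_ofPred_eq, isContentMaximal_inv_iff, supp_inv, isBraidedIn_inv_iff,
    length_inv_mul_simple_lt_iff]

end Braid

end CoxeterSystem

/-! ### Partition into the seven cases -/

theorem Set.ncard_eq_sum_of_existsUnique {α : Type*} {S : Set α} (hS : S.Finite) {m : ℕ}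
    {P : Fin m → α → Prop} (h : ∀ w ∈ S, ∃! k, P k w) :
    S.ncard = ∑ k, {w | w ∈ S ∧ P k w}.ncard := by
  classical
  -- The `Option` provides a value outside S, where no index need exist; `Fin m` may even be empty.
  have hk : ∀ w, ∃ k : Option (Fin m), w ∈ S → ∃ k', k = some k' ∧ P k' w := by
    intro w
    by_cases hw : w ∈ S
    · obtain ⟨k, hk, -⟩ := h w hw
      exact ⟨some k, fun _ => ⟨k, rfl, hk⟩⟩
    · exact ⟨none, fun h => absurd h hw⟩
  choose K hK using hk
  rw [Set.ncard_eq_toFinset_card S hS, Finset.card_eq_sum_card_fiberwise (f := K)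
    (t := Finset.univ.image some)]
  · rw [Finset.sum_image (fun _ _ _ _ h => Option.some_injective _ h)]
    refine Finset.sum_congr rfl fun k _ => ?_
    rw [← Set.ncard_coe_finset]
    congr 1
    ext w
    simp only [Finset.coe_filter, Set.Finite.mem_toFinset, Set.mem_ofPred_eq]
    refine and_congr_right fun hw => ?_
    obtain ⟨k', hk', hP⟩ := hK w hw
    rw [hk', Option.some_inj]
    exact ⟨fun e => e ▸ hP, fun hP' => (h w hw).unique hP hP'⟩
  · intro w hw
    obtain ⟨k', hk', hP⟩ := hK w (by simpa using hw)
    simp [hk']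

namespace CoxeterSystem

variable {B : Type*} {A : Set B} {M' : CoxeterMatrix A} {W : Type*} [Group W]
  {cs : CoxeterSystem M' W} {w : W} {x : B}

theorem inSupp_iff (hx : x ∈ A) : cs.InSupp x w ↔ (⟨x, hx⟩ : A) ∈ cs.supp w :=
  ⟨fun ⟨_, h⟩ => h, fun h => ⟨hx, h⟩⟩

theorem braided_iff (hx : x ∈ A) : cs.Braided x w ↔ cs.IsBraidedIn ⟨x, hx⟩ w :=
  ⟨fun ⟨_, h⟩ => h, fun h => ⟨hx, h⟩⟩

theorem rightDescent_iff (hx : x ∈ A) :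
    cs.RightDescent x w ↔ cs.length (w * cs.simple ⟨x, hx⟩) < cs.length w :=
  ⟨fun ⟨_, h⟩ => h, fun h => ⟨hx, h⟩⟩

theorem leftDescent_iff (hx : x ∈ A) :
    cs.LeftDescent x w ↔ cs.length (cs.simple ⟨x, hx⟩ * w) < cs.length w :=
  ⟨fun ⟨_, h⟩ => h, fun h => ⟨hx, h⟩⟩

/-- The seven conditions are the leaves of a decision tree: occurrence of i_n, whether it is
braided, presence of the next relevant letter, side of the descent. -/
theorem existsUnique_chainCase {i : ℕ → B} {n : ℕ} (hn : 1 ≤ n)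
    (h1 : n = 1 → ¬ cs.Braided (i n) w)
    (hs : 1 < n → cs.InSupp (i n) w → ¬ cs.Braided (i n) w → cs.InSupp (i (n - 1)) w →
      (cs.LeftDescent (i n) w ∧ ¬ cs.RightDescent (i n) w) ∨
      (cs.RightDescent (i n) w ∧ ¬ cs.LeftDescent (i n) w))
    (hb : 2 < n → cs.Braided (i n) w → cs.InSupp (i (n - 2)) w →
      (cs.LeftDescent (i (n - 1)) w ∧ ¬ cs.RightDescent (i (n - 1)) w) ∨
      (cs.RightDescent (i (n - 1)) w ∧ ¬ cs.LeftDescent (i (n - 1)) w)) :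
    ∃! k : Fin 7, cs.ChainCase i n w k := by
  have key : ∀ k, cs.ChainCase i n w k → (∀ j, j ≠ k → ¬ cs.ChainCase i n w j) →
      ∃! k : Fin 7, cs.ChainCase i n w k :=
    fun k hk h => ⟨k, hk, fun j hj => by_contra fun hne => h j hne hj⟩
  have hn1 : 1 < n ∨ n = 1 := by omega
  by_cases hS : cs.InSupp (i n) w
  · by_cases hB : cs.Braided (i n) w
    · have hn1' : 1 < n := hn1.resolve_right fun h => h1 h hB
      by_cases hc : 2 < n ∧ cs.InSupp (i (n - 2)) w
      · rcases hb hc.1 hB hc.2 with h | h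
        · refine key 6 ⟨hc.1, hS, hB, hc.2, h.1⟩ fun j hj => ?_
          fin_cases j <;> first | exact absurd rfl hj | simp [ChainCase, hS, hB, hc, h]
        · refine key 5 ⟨hc.1, hS, hB, hc.2, h.1⟩ fun j hj => ?_
          fin_cases j <;> first | exact absurd rfl hj | simp [ChainCase, hS, hB, hc, h]
      · refine key 4 ⟨hn1', hS, hB, fun h h' => hc ⟨h, h'⟩⟩ fun j hj => ?_
        fin_cases j <;> first | exact absurd rfl hj | exact fun h => hc ⟨h.1, h.2.2.2.1⟩ |
          simp [ChainCase, hS, hB]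
    · by_cases hc : 1 < n ∧ cs.InSupp (i (n - 1)) w
      · rcases hs hc.1 hS hB hc.2 with h | h
        · refine key 3 ⟨hc.1, hS, hB, hc.2, h.1⟩ fun j hj => ?_
          fin_cases j <;> first | exact absurd rfl hj | simp [ChainCase, hS, hB, hc, h]
        · refine key 2 ⟨hc.1, hS, hB, hc.2, h.1⟩ fun j hj => ?_
          fin_cases j <;> first | exact absurd rfl hj | simp [ChainCase, hS, hB, hc, h]
      · refine key 1 ⟨hS, hB, fun h h' => hc ⟨h, h'⟩⟩ fun j hj => ?_
        fin_cases j <;> first | exact absurd rfl hj | exact fun h => hc ⟨h.1, h.2.2.2.1⟩ |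
          simp [ChainCase, hS, hB]
  · refine key 0 hS fun j hj => ?_
    fin_cases j <;> first | exact absurd rfl hj | simp [ChainCase, hS]

end CoxeterSystem

theorem Set.ncard_add_ncard_of_and_not {α : Type*} {S : Set α} (hS : S.Finite) {p q : α → Prop} :
    {w | w ∈ S ∧ p w ∧ q w}.ncard + {w | w ∈ S ∧ p w ∧ ¬ q w}.ncard =
      {w | w ∈ S ∧ p w}.ncard := by
  rw [← Set.ncard_union_eq (Set.disjoint_left.2 fun w h h' => h'.2.2 h.2.2)
    (hS.subset fun w h => h.1) (hS.subset fun w h => h.1)]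
  congr 1
  ext w
  simp only [Set.mem_union, Set.mem_ofPred_eq]
  tauto

theorem forall_mem_ne {α : Type*} {S : Set α} {x : α} : (∀ a ∈ S, ¬ a = x) ↔ x ∉ S :=
  ⟨fun h hx => h x hx rfl, fun h _ ha e => h (e ▸ ha)⟩

end

/-! ### The chain of Coxeter groups -/

theorem lemma4p1 {B : Type*} (I : ℕ → Set B) (M : ∀ n, CoxeterMatrix (I n))
    (W : ℕ → Type*) [∀ n, Group (W n)] (cs : ∀ n, CoxeterSystem (M n) (W n))
    (hM : ∀ n, (M n).IsSimplyLaced) (i : ℕ → B)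
    -- `i_1 ∈ I_1`, and `I_n` is the disjoint union of `I_{n-1}` and `{i_n}` for `n > 1`
    (hi1 : i 1 ∈ I 1)
    (hI : ∀ n, 1 < n → i n ∉ I (n - 1) ∧ I n = insert (i n) (I (n - 1)))
    -- for `m < n`, the Coxeter matrix of `W_m` is the restriction of that of `W_n`
    (hcompat : ∀ m n, 1 ≤ m → m < n → ∀ (x y : B) (hx : x ∈ I m) (hy : y ∈ I m)
      (hx' : x ∈ I n) (hy' : y ∈ I n), M m ⟨x, hx⟩ ⟨y, hy⟩ = M n ⟨x, hx'⟩ ⟨y, hy'⟩)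
    -- `i_n` commutes with every letter of `I_{n-1}` except `i_{n-1}`
    (hcomm : ∀ n, 1 < n → ∀ (x : B), x ∈ I (n - 1) → ∀ (hi : i n ∈ I n) (hx : x ∈ I n),
      M n ⟨i n, hi⟩ ⟨x, hx⟩ = 2 ↔ x ≠ i (n - 1)) :
    -- exactly one of the seven conditions holds
    (∀ n, 1 ≤ n → (1 < n ∨ ∀ x : I 1, (x : B) ≠ i 1 → M 1 ⟨i 1, hi1⟩ x = 2) →
      ∀ w : W n, (cs n).IsContentMaximal (hM n) w → ∃! k : Fin 7, (cs n).ChainCase i n w k) ∧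
    -- enumeration, for finite alphabets
    ((I 1).Finite →
      (∀ n, 1 ≤ n → ((cs n).contentMaximalSet (hM n)).Finite) ∧
      ∀ f : ℕ → ℤ, (∀ n, f n = (cs n).numContentMaximal (hM n)) →
      ∀ n, 3 < n →
        (((cs n).caseSet (hM n) i n 0).ncard : ℤ) = f (n - 1) ∧
        (((cs n).caseSet (hM n) i n 1).ncard : ℤ) = f (n - 2) ∧
        (((cs n).caseSet (hM n) i n 2).ncard : ℤ) = f (n - 1) - f (n - 2) ∧
        (((cs n).caseSet (hM n) i n 3).ncard : ℤ) = f (n - 1) - f (n - 2) ∧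
        (((cs n).caseSet (hM n) i n 4).ncard : ℤ) = f (n - 3) ∧
        (((cs n).caseSet (hM n) i n 5).ncard : ℤ) = f (n - 2) - f (n - 3) ∧
        (((cs n).caseSet (hM n) i n 6).ncard : ℤ) = f (n - 2) - f (n - 3) ∧
        f n = 3 * f (n - 1) + f (n - 2) - f (n - 3)) := by
  classical
  have hmem : ∀ n, 1 ≤ n → i n ∈ I n := by
    intro n hn
    rcases hn.eq_or_lt with rfl | hn
    · exact hi1
    · rw [(hI n hn).2]
      exact Set.mem_insert _ _
  have hsub : ∀ m n, 1 ≤ m → m ≤ n → I m ⊆ I n := by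
    intro m n hm hmn
    induction n, hmn using Nat.le_induction with
    | base => exact subset_rfl
    | succ n hmn ih =>
      rw [(hI (n + 1) (by omega)).2]
      exact ih.trans (Set.subset_insert _ _)
  have hnotMem : ∀ m n, 1 ≤ m → m < n → i n ∉ I m := fun m n hm hmn h =>
    (hI n (by omega)).1 (hsub m (n - 1) hm (by omega) h)
  have hne : ∀ m n, 1 ≤ m → m < n → i m ≠ i n := fun m n hm hmn h =>
    hnotMem m n hm hmn (h ▸ hmem m hm)
  have hval : ∀ (n : ℕ) (y : I n) (z : B) (hz : z ∈ I n), (y : B) = z ↔ y = ⟨z, hz⟩ :=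
    fun n y z hz => ⟨fun h => Subtype.ext h, fun h => congrArg Subtype.val h⟩
  have hnb : ∀ n, 1 < n → ∀ (hx : i n ∈ I n) (y : I n),
      M n ⟨i n, hx⟩ y = 3 ↔ (y : B) = i (n - 1) := by
    intro n hn hx y
    by_cases hy : (y : B) = i n
    · have hy' : y = ⟨i n, hx⟩ := Subtype.ext hy
      rw [hy, hy']
      simpa using (hne (n - 1) n (by omega) (by omega)).symm
    · have hyI : (y : B) ∈ I (n - 1) :=
        (Set.mem_insert_iff.1 ((hI n hn).2.subset y.2)).resolve_left hy
      have h1 := hcomm n hn y hyI hx y.2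
      have h2 := hM n ⟨i n, hx⟩ y fun h => hy (congrArg Subtype.val h).symm
      constructor
      · intro h3
        by_contra h4
        have := h1.2 h4
        simp only [Subtype.coe_eta] at this
        omega
      · intro h3
        refine h2.resolve_left fun h4 => ?_
        exact h1.1 h4 h3
  -- The bound n > 2 gives n − 1 > 1, so the neighbours of i_{n-1} in I_{n-1} are known; they are
  -- inherited through the compatibility of the matrices.
  have hnb' : ∀ n, 2 < n → ∀ (hx : i (n - 1) ∈ I n) (y : I n),
      M n ⟨i (n - 1), hx⟩ y = 3 ↔ (y : B) = i n ∨ (y : B) = i (n - 2) := by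
    intro n hn hx y
    by_cases hy : (y : B) = i n
    · have hy' : y = ⟨i n, hmem n (by omega)⟩ := Subtype.ext hy
      rw [hy', (M n).symmetric, hnb n (by omega)]
      simp
    · have hyI : (y : B) ∈ I (n - 1) :=
        (Set.mem_insert_iff.1 ((hI n (by omega)).2.subset y.2)).resolve_left hy
      have h1 := hcompat (n - 1) n (by omega) (by omega) (i (n - 1)) y (hmem _ (by omega)) hyI hx y.2
      rw [show (⟨(y : B), y.2⟩ : I n) = y from rfl] at h1
      rw [← h1, hnb (n - 1) (by omega)]
      simp only [hy, false_or]
      rfl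
  have huniq : ∀ n, 1 ≤ n → (1 < n ∨ ∀ x : I 1, (x : B) ≠ i 1 → M 1 ⟨i 1, hi1⟩ x = 2) →
      ∀ w : W n, (cs n).IsContentMaximal (hM n) w → ∃! k : Fin 7, (cs n).ChainCase i n w k := by
    intro n hn hn1 w hw
    apply CoxeterSystem.existsUnique_chainCase hn
    · rintro rfl ⟨hx, h⟩
      obtain ⟨y, hy, -⟩ := hw.isBraidedIn_iff.1 h
      have h2 := (hn1.resolve_left (by omega)) y fun h => by
        exact CoxeterMatrix.ne_of_eq_three hy (Subtype.ext h.symm)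
      omega
    · rintro hn1 ⟨hx, hS⟩ hB ⟨hb, hSb⟩
      have h := hw.descents_of_not_isBraidedIn (b := ⟨i (n - 1), hb⟩)
        (fun y => (hnb n hn1 hx y).trans (hval n y _ _)) hS (fun h => hB ⟨hx, h⟩) hSb
      rw [CoxeterSystem.leftDescent_iff hx, CoxeterSystem.rightDescent_iff hx]
      tauto
    · rintro hn2 ⟨hx, hB⟩ ⟨hc, hSc⟩
      have hb : i (n - 1) ∈ I n := hsub (n - 1) n (by omega) (by omega) (hmem _ (by omega))
      have h := hw.descents_of_isBraidedIn (b := ⟨i (n - 1), hb⟩) (c := ⟨i (n - 2), hc⟩)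
        (fun y => (hnb n (by omega) hx y).trans (hval n y _ _))
        (fun y => (hnb' n hn2 hb y).trans (or_congr (hval n y _ _) (hval n y _ _)))
        (fun h => hne (n - 2) n (by omega) (by omega) (congrArg Subtype.val h)) hB hSc
      rw [CoxeterSystem.leftDescent_iff hb, CoxeterSystem.rightDescent_iff hb]
      tauto
  refine ⟨huniq, fun hfin => ?_⟩
  have hIfin : ∀ n, 1 ≤ n → (I n).Finite := by
    intro n hn
    induction n, hn using Nat.le_induction with
    | base => exact hfin
    | succ n hn ih =>
      rw [(hI (n + 1) (by omega)).2]
      exact ih.insert _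
  have hCfin : ∀ n, 1 ≤ n → ((cs n).contentMaximalSet (hM n)).Finite := by
    intro n hn
    have := (hIfin n hn).to_subtype
    exact CoxeterSystem.finite_contentMaximalSet
  refine ⟨hCfin, fun f hf n hn => ?_⟩
  have hx := hmem n (by omega)
  have hb : i (n - 1) ∈ I n := hsub (n - 1) n (by omega) (by omega) (hmem _ (by omega))
  have hc : i (n - 2) ∈ I n := hsub (n - 2) n (by omega) (by omega) (hmem _ (by omega))
  have hI1 : ∀ a : I n, (a : B) ∈ I (n - 1) ↔ a ≠ ⟨i n, hx⟩ := by
    intro a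
    have ha : (a : B) ∈ insert (i n) (I (n - 1)) := by
      rw [← (hI n (by omega)).2]
      exact a.2
    rw [Ne, ← hval n a _ _]
    exact ⟨fun h h' => hnotMem (n - 1) n (by omega) (by omega) (h' ▸ h),
      fun h => ha.resolve_left h⟩
  have hI2 : ∀ a : I n, (a : B) ∈ I (n - 2) ↔ a ≠ ⟨i n, hx⟩ ∧ a ≠ ⟨i (n - 1), hb⟩ := by
    intro a
    rw [← hI1, Ne, ← hval n a _ _, (hI (n - 1) (by omega)).2, Set.mem_insert_iff]
    have h1 := hnotMem (n - 2) (n - 1) (by omega) (by omega)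
    rw [show n - 1 - 1 = n - 2 by omega]
    constructor
    · exact fun h => ⟨Or.inr h, fun h' => h1 (h' ▸ h)⟩
    · exact fun h => h.1.resolve_left h.2
  have hI3 : ∀ a : I n, (a : B) ∈ I (n - 3) ↔
      (a ≠ ⟨i n, hx⟩ ∧ a ≠ ⟨i (n - 1), hb⟩) ∧ a ≠ ⟨i (n - 2), hc⟩ := by
    intro a
    rw [← hI2, Ne, ← hval n a _ _, (hI (n - 2) (by omega)).2, Set.mem_insert_iff]
    have h1 := hnotMem (n - 3) (n - 2) (by omega) (by omega)
    rw [show n - 2 - 1 = n - 3 by omega]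
    constructor
    · exact fun h => ⟨Or.inr h, fun h' => h1 (h' ▸ h)⟩
    · exact fun h => h.1.resolve_left h.2
  -- The parabolic embedding moves all counts into W_n.
  have hcount : ∀ m, 1 ≤ m → m < n → f m = ({w : W n | (cs n).IsContentMaximal (hM n) w ∧
      ∀ a ∈ (cs n).supp w, (a : B) ∈ I m}.ncard : ℤ) := by
    intro m hm hmn
    rw [hf, CoxeterSystem.numContentMaximal,
      CoxeterSystem.ncard_contentMaximalSet_eq (hM m) (hM n) (cs m) (cs n)
        (f := Set.inclusion (hsub m n hm hmn.le)) (Set.inclusion_injective _)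
        (fun a b => (hcompat m n hm hmn a b a.2 b.2 _ _).symm)]
    simp only [Set.range_inclusion]
    rfl
  have hF1 := hcount (n - 1) (by omega) (by omega)
  have hF2 := hcount (n - 2) (by omega) (by omega)
  -- Here n > 3 is essential: level n − 3 must belong to the chain, which starts at 1.
  have hF3 := hcount (n - 3) (by omega) (by omega)
  simp only [hI1, hI2, hI3, imp_and, forall_and, ne_eq, and_assoc, forall_mem_ne] at hF1 hF2 hF3
  have hxb : ∀ y, M n ⟨i n, hx⟩ y = 3 ↔ y = ⟨i (n - 1), hb⟩ := fun y =>
    (hnb n (by omega) hx y).trans (hval n y _ _)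
  have hbc : ∀ y, M n ⟨i (n - 1), hb⟩ y = 3 ↔ y = ⟨i n, hx⟩ ∨ y = ⟨i (n - 2), hc⟩ := fun y =>
    (hnb' n (by omega) hb y).trans (or_congr (hval n y _ _) (hval n y _ _))
  have hcx : (⟨i (n - 2), hc⟩ : I n) ≠ ⟨i n, hx⟩ := fun h =>
    hne (n - 2) n (by omega) (by omega) (congrArg Subtype.val h)
  -- The differences: f(n-1) − f(n-2) counts the elements that avoid x and contain b, and f(n-2) −
  -- f(n-3) those that avoid x, b and contain c.
  have hG1 := Set.ncard_add_ncard_of_and_not (hCfin n (by omega))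
    (p := fun w => (⟨i n, hx⟩ : I n) ∉ (cs n).supp w)
    (q := fun w => (⟨i (n - 1), hb⟩ : I n) ∉ (cs n).supp w)
  have hG2 := Set.ncard_add_ncard_of_and_not (hCfin n (by omega))
    (p := fun w => (⟨i n, hx⟩ : I n) ∉ (cs n).supp w ∧ (⟨i (n - 1), hb⟩ : I n) ∉ (cs n).supp w)
    (q := fun w => (⟨i (n - 2), hc⟩ : I n) ∉ (cs n).supp w)
  simp only [CoxeterSystem.contentMaximalSet, Set.mem_ofPred_eq, not_not, and_assoc] at hG1 hG2
  have hC : ∀ k, ((cs n).caseSet (hM n) i n k) =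
      {w | (cs n).IsContentMaximal (hM n) w ∧ (cs n).ChainCase i n w k} := fun _ => rfl
  have hn1 : 1 < n := by omega
  have hn2 : 2 < n := by omega
  have h0 : (((cs n).caseSet (hM n) i n 0).ncard : ℤ) = f (n - 1) := by
    simpa only [hC, CoxeterSystem.ChainCase, CoxeterSystem.inSupp_iff hx] using hF1.symm
  have h1 := CoxeterSystem.ncard_single_of_notMem (cs := cs n) (hM := hM n) hxb
  have h3 := CoxeterSystem.ncard_single_leftDescent (cs := cs n) (hM := hM n) hxb
  have h2 := (CoxeterSystem.ncard_single_rightDescent (cs := cs n) (hM := hM n)).trans h3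
  have h4 := CoxeterSystem.ncard_braid_of_notMem (cs := cs n) (hM := hM n) hxb hbc hcx
  have h6 := CoxeterSystem.ncard_braid_leftDescent (cs := cs n) (hM := hM n) hxb hbc hcx
  have h5 := (CoxeterSystem.ncard_braid_rightDescent (cs := cs n) (hM := hM n)).trans h6
  -- The recurrence is the sum of the seven counts: f(n-1) + f(n-2) + 2(f(n-1) − f(n-2)) + f(n-3) +
  -- 2(f(n-2) − f(n-3)).
  have hS := Set.ncard_eq_sum_of_existsUnique (hCfin n (by omega)) (huniq n (by omega) (Or.inl hn1))
  change _ = ∑ k, ((cs n).caseSet (hM n) i n k).ncard at hS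
  rw [Fin.sum_univ_seven] at hS
  have hfn := hf n
  rw [CoxeterSystem.numContentMaximal, hS] at hfn
  simp only [hC, CoxeterSystem.ChainCase, CoxeterSystem.inSupp_iff hx, CoxeterSystem.inSupp_iff hb,
    CoxeterSystem.inSupp_iff hc, CoxeterSystem.braided_iff hx, CoxeterSystem.rightDescent_iff hx,
    CoxeterSystem.rightDescent_iff hb, CoxeterSystem.leftDescent_iff hx,
    CoxeterSystem.leftDescent_iff hb, hn1, hn2, true_and, true_imp_iff] at hfn h0 ⊢
  omega
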